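/- **Conventions.** Let $A^{\bullet}=\{A^{2n}\}_{n\in\mathbb Z}$ be an evenly graded commutative ring with a commutative one-dimensional formal group law $F(x,y)=\sum a_{ij}x^iy^j$, $a_{ij}\in A^{2-2i-2j}$; the main case is the complex cobordism ring $A^\bullet=MU^\bullet$ with its universal formal group law. An (evenly graded) *Hopf ring over $A^\bullet$* is an evenly graded commutative $A^\bullet$-algebra object $\mathscr H^\bullet=\{\mathscr H^{2n}\}_{n\in\mathbb Z}$ in the category of counital, coassociative, cocommutative coalgebras in $\mathbb Z$-graded abelian groups (with tensor product and the Koszul sign rule). Thus for every such coalgebra $C$ the coalgebra maps $\mathscr H^{2n}(C)=\mathrm{Hom}(C,\mathscr H^{2n})$ form an evenly graded commutative $A^\bullet$-algebra; $[a]$ denotes the constant of $a\in A^{2n}$. Let $\mathbb A^1=\mathbb Z\{\beta_0,\beta_1,\dots\}$, $|\beta_i|=2i$, with coproduct $\beta_n\mapsto\sum_{i+j=n}\beta_i\otimes\beta_j$ and group law $\mu(\beta_i\otimes\beta_j)=\binom{i+j}{i}\beta_{i+j}$. An *additive curve* in $\mathscr H^\bullet$ is a coalgebra map $x:\mathbb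 A^1\to\mathscr H^2$ with $\beta_0^*x=[0]$ and $\mu^*x=\sum [a_{ij}]\,x^iy^j$ in $\mathscr H^2(\mathbb A^1\otimes\mathbb A^1)$, where on the right $x,y$ are the pullbacks of the curve along the two projections. A *Ravenel-Wilson Hopf ring* $\mathscr H_{RW}^\bullet$ is a Hopf ring over $A^\bullet$ with an additive curve $x$ that is universal: for every Hopf ring $\mathscr K^\bullet$ over $A^\bullet$ with an additive curve $y$ there is exactly one map of Hopf rings $\mathscr H_{RW}^\bullet\to\mathscr K^\bullet$ over $A^\bullet$ that carries $x$ to $y$. For $k\in\mathbb Z$ let $\Phi^k$ be the functor from evenly graded abelian groups to graded $\mathbb F_2$-vector spaces with $\Phi^k(B)_m=\bigoplus_{j:\,kj=m}B_{2j}\otimes\mathbb F_2$; it sends coalgebras to coalgebras. For a cocommutative coalgebra $V$ over $\mathbb F_2$ with twist $\tau$ on $V\otimes V$, the map $v\mapsto v\otimes v$ induces an isomorphism $V\cong\ker(1-\tau)/\operatorname{im}(1+\tau)$, and the *Verschiebung* $\mathbf v(x)\in V$ is the element that corresponds to the class of the coproduct $\Delta(x)$. If $V$ is graded, $\mathbf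 v$ maps $V_{2n}$ to $V_n$ and vanishes on $V_{2n+1}$, so that for $V=\Phi^k(C)$ it is a map of graded vector spaces $\Phi^k(C)\to\Phi^{2k}(C)$. **Proposition.** A Ravenel-Wilson Hopf ring over $A^\bullet$ exists, and for each such Hopf ring $\mathscr H_{RW}^\bullet$ and every $k\in\mathbb Z$ the Verschiebung $$\Phi^k(\mathscr H_{RW}^{\bullet})\to\Phi^{2k}(\mathscr H_{RW}^{\bullet})$$ is a surjective map of evenly graded objects of graded $\mathbb F_2$-vector spaces: for all $n,m\in\mathbb Z$ the image of $\Phi^k(\mathscr H_{RW}^{2n})_m$ under $\mathbf v$ is exactly $\Phi^{2k}(\mathscr H_{RW}^{2n})_m$. -/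

import Mathlib

open scoped TensorProduct DirectSum

universe u

noncomputable section

/-! ### Cocommutative coalgebras in graded modules (Koszul sign convention) -/

section Koszul

variable {𝕜 : Type*} [CommRing 𝕜] {C : Type*} [AddCommGroup C] [Module 𝕜 C]
  (deg : ℤ → Submodule 𝕜 C) [DirectSum.Decomposition deg]

/-- The projection of a graded module onto the sum of its pieces of odd degree. -/
def oddProj : C →ₗ[𝕜] C :=
  DirectSum.toModule 𝕜 ℤ C (fun i => if Odd i then (deg i).subtype else 0) ∘ₗ
    (DirectSum.decomposeLinearEquiv deg).toLinearMap

variable {D : Type*} [AddCommGroup D] [Module 𝕜 D]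
  (deg' : ℤ → Submodule 𝕜 D) [DirectSum.Decomposition deg']

/-- The symmetry `x ⊗ y ↦ (-1)^(|x||y|) y ⊗ x` (`x`, `y` homogeneous) of graded modules. -/
def koszulSwap : C ⊗[𝕜] D →ₗ[𝕜] D ⊗[𝕜] C :=
  (TensorProduct.comm 𝕜 C D).toLinearMap ∘ₗ
    (LinearMap.id - (2 : 𝕜) • TensorProduct.map (oddProj deg) (oddProj deg'))

/-- The interchange `(a ⊗ c) ⊗ (d ⊗ b) ↦ (-1)^(|c||d|) (a ⊗ d) ⊗ (c ⊗ b)`. -/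
def koszulInterchange (A B : Type*) [AddCommGroup A] [AddCommGroup B]
    [Module 𝕜 A] [Module 𝕜 B] :
    (A ⊗[𝕜] C) ⊗[𝕜] (D ⊗[𝕜] B) →ₗ[𝕜] (A ⊗[𝕜] D) ⊗[𝕜] (C ⊗[𝕜] B) :=
  (TensorProduct.tensorTensorTensorComm 𝕜 A C D B).toLinearMap ∘ₗ
    (LinearMap.id - (2 : 𝕜) • TensorProduct.map
      (TensorProduct.map LinearMap.id (oddProj deg))
      (TensorProduct.map (oddProj deg') LinearMap.id))

end Koszul

/-- A counital, coassociative, cocommutative coalgebra in the symmetric monoidal category of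
`ℤ`-graded `𝕜`-modules with the Koszul sign rule. -/
structure GradedCoalg (𝕜 : Type*) [CommRing 𝕜] where
  /-- the direct sum of all graded pieces -/
  carrier : Type u
  [group : AddCommGroup carrier]
  [module : Module 𝕜 carrier]
  [coalgebra : Coalgebra 𝕜 carrier]
  /-- the graded pieces -/
  deg : ℤ → Submodule 𝕜 carrier
  [decomposition : DirectSum.Decomposition deg]
  counit_deg : ∀ i : ℤ, i ≠ 0 → ∀ x ∈ deg i, Coalgebra.counit (R := 𝕜) x = 0
  comul_deg : ∀ i : ℤ, ∀ x ∈ deg i, Coalgebra.comul (R := 𝕜) x ∈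
    ⨆ (p : ℤ) (q : ℤ) (_ : p + q = i),
      LinearMap.range (TensorProduct.map (deg p).subtype (deg q).subtype)
  cocomm : koszulSwap deg deg ∘ₗ Coalgebra.comul (R := 𝕜) = Coalgebra.comul (R := 𝕜)

namespace GradedCoalg

variable {𝕜 : Type*} [CommRing 𝕜]

instance : CoeSort (GradedCoalg.{u} 𝕜) (Type u) := ⟨carrier⟩

instance (C : GradedCoalg.{u} 𝕜) : AddCommGroup C := C.group
instance (C : GradedCoalg.{u} 𝕜) : Module 𝕜 C := C.module
instance (C : GradedCoalg.{u} 𝕜) : Coalgebra 𝕜 C := C.coalgebra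
instance (C : GradedCoalg.{u} 𝕜) : DirectSum.Decomposition C.deg := C.decomposition

/-- Morphisms of graded coalgebras: coalgebra maps preserving degree. -/
structure Hom (C D : GradedCoalg.{u} 𝕜) where
  /-- the underlying map of coalgebras -/
  map : C →ₗc[𝕜] D
  map_deg : ∀ (i : ℤ) (x : C), x ∈ C.deg i → map x ∈ D.deg i

/-- `f : C ⊗ D → E` is a morphism of graded coalgebras; `C ⊗ D` (the product of `C` and `D` in
graded coalgebras) has the coproduct `(1 ⊗ τ ⊗ 1) ∘ (Δ ⊗ Δ)`, with `τ` the Koszul symmetry, and the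
counit `ε ⊗ ε`. -/
structure IsTensorHom {C D E : GradedCoalg.{u} 𝕜} (f : C ⊗[𝕜] D →ₗ[𝕜] E) : Prop where
  map_deg : ∀ (i j : ℤ) (x : C) (y : D), x ∈ C.deg i → y ∈ D.deg j → f (x ⊗ₜ y) ∈ E.deg (i + j)
  counit_map : ∀ (x : C) (y : D), Coalgebra.counit (R := 𝕜) (f (x ⊗ₜ y)) =
    Coalgebra.counit (R := 𝕜) x * Coalgebra.counit (R := 𝕜) y
  comul_map : Coalgebra.comul (R := 𝕜) ∘ₗ f =
    TensorProduct.map f f ∘ₗ koszulInterchange C.deg D.deg C D ∘ₗ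
      TensorProduct.map (Coalgebra.comul (R := 𝕜)) (Coalgebra.comul (R := 𝕜))

end GradedCoalg

/-! ### Evenly graded Hopf rings over an evenly graded commutative ring -/

/-- A Hopf ring over the evenly graded commutative ring `A` in graded `𝕜`-modules, that is, an
evenly graded commutative `A`-algebra object in graded coalgebras. The index `n : ℤ` stands for the
even degree `2n`: `𝒜 n` is `A²ⁿ` and `obj n` is the coalgebra `H²ⁿ`. Addition is a commutative group
law on each `obj n` (the product usually written `*`) and multiplication is the product usually
written `∘`. -/
structure HopfRing (𝕜 : Type*) [CommRing 𝕜] {R : Type u} [CommRing R] (𝒜 : ℤ → AddSubgroup R) where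
  /-- the coalgebra in external degree `2n` -/
  obj : ℤ → GradedCoalg.{u} 𝕜
  /-- addition -/
  add : ∀ n, obj n ⊗[𝕜] obj n →ₗ[𝕜] obj n
  /-- multiplication -/
  mul : ∀ i j k, i + j = k → (obj i ⊗[𝕜] obj j →ₗ[𝕜] obj k)
  /-- the constants `[a] : 1 → H²ⁿ`, as group-like elements -/
  const : ∀ n, 𝒜 n → obj n
  add_isHom : ∀ n, GradedCoalg.IsTensorHom (add n)
  mul_isHom : ∀ i j k h, GradedCoalg.IsTensorHom (mul i j k h)
  const_deg : ∀ n a, const n a ∈ (obj n).deg 0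
  counit_const : ∀ n a, Coalgebra.counit (R := 𝕜) (const n a) = 1
  comul_const : ∀ n a, Coalgebra.comul (R := 𝕜) (const n a) = const n a ⊗ₜ[𝕜] const n a
  add_assoc : ∀ n (x y z : obj n),
    add n (add n (x ⊗ₜ y) ⊗ₜ z) = add n (x ⊗ₜ add n (y ⊗ₜ z))
  add_comm : ∀ n, add n ∘ₗ koszulSwap (obj n).deg (obj n).deg = add n
  zero_add : ∀ n (x : obj n), add n (const n 0 ⊗ₜ x) = x
  exists_neg : ∀ n, ∃ χ : GradedCoalg.Hom (obj n) (obj n), ∀ x : obj n,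
    add n (TensorProduct.map LinearMap.id χ.map.toLinearMap (Coalgebra.comul (R := 𝕜) x)) =
      Coalgebra.counit (R := 𝕜) x • const n 0
  mul_assoc : ∀ i j k ij jk t (h₁ : i + j = ij) (h₂ : ij + k = t) (h₃ : j + k = jk)
    (h₄ : i + jk = t) (x : obj i) (y : obj j) (z : obj k),
    mul ij k t h₂ (mul i j ij h₁ (x ⊗ₜ y) ⊗ₜ z) = mul i jk t h₄ (x ⊗ₜ mul j k jk h₃ (y ⊗ₜ z))
  mul_comm : ∀ i j k (h : i + j = k) (h' : j + i = k),
    mul j i k h' ∘ₗ koszulSwap (obj i).deg (obj j).deg = mul i j k h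
  one_mul : ∀ (e : 𝒜 0), (e : R) = 1 → ∀ n (h : 0 + n = n) (x : obj n),
    mul 0 n n h (const 0 e ⊗ₜ x) = x
  /-- `[0] ∘ x = ε(x) [0]` -/
  zero_mul : ∀ i j k (h : i + j = k) (x : obj j),
    mul i j k h (const i 0 ⊗ₜ x) = Coalgebra.counit (R := 𝕜) x • const k 0
  /-- `x ∘ (y * z) = ∑ ± (x' ∘ y) * (x'' ∘ z)` -/
  mul_add : ∀ i j k (h : i + j = k),
    mul i j k h ∘ₗ TensorProduct.map LinearMap.id (add j) =
      add k ∘ₗ TensorProduct.map (mul i j k h) (mul i j k h) ∘ₗ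
        koszulInterchange (obj i).deg (obj j).deg (obj i) (obj j) ∘ₗ
          TensorProduct.map (Coalgebra.comul (R := 𝕜)) LinearMap.id
  const_add : ∀ n (a b : 𝒜 n), const n (a + b) = add n (const n a ⊗ₜ const n b)
  const_mul : ∀ i j k (h : i + j = k) (a : 𝒜 i) (b : 𝒜 j) (c : 𝒜 k), (c : R) = a * b →
    const k c = mul i j k h (const i a ⊗ₜ const j b)

namespace HopfRing

variable {𝕜 : Type*} [CommRing 𝕜] {R : Type u} [CommRing R] {𝒜 : ℤ → AddSubgroup R}

/-- Maps of Hopf rings over `A`. -/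
structure Hom (H K : HopfRing 𝕜 𝒜) where
  /-- the component in external degree `2n` -/
  app : ∀ n, GradedCoalg.Hom (H.obj n) (K.obj n)
  map_add : ∀ n (x y : H.obj n),
    (app n).map (H.add n (x ⊗ₜ y)) = K.add n ((app n).map x ⊗ₜ (app n).map y)
  map_mul : ∀ i j k (h : i + j = k) (x : H.obj i) (y : H.obj j),
    (app k).map (H.mul i j k h (x ⊗ₜ y)) = K.mul i j k h ((app i).map x ⊗ₜ (app j).map y)
  map_const : ∀ n (a : 𝒜 n), (app n).map (H.const n a) = K.const n a

/-! The ring operations on the `C`-valued points `H²ⁿ(C)`, for a coalgebra `C` concentrated in even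
degrees, expressed on the underlying linear maps. -/

section Points

variable (H : HopfRing 𝕜 𝒜) {C : Type*} [AddCommGroup C] [Module 𝕜 C] [Coalgebra 𝕜 C]

/-- The sum of two points. -/
def ptAdd (n : ℤ) (f g : C →ₗ[𝕜] H.obj n) : C →ₗ[𝕜] H.obj n :=
  H.add n ∘ₗ TensorProduct.map f g ∘ₗ Coalgebra.comul (R := 𝕜)

/-- The product of two points. -/
def ptMul (i j k : ℤ) (h : i + j = k) (f : C →ₗ[𝕜] H.obj i) (g : C →ₗ[𝕜] H.obj j) :
    C →ₗ[𝕜] H.obj k :=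
  H.mul i j k h ∘ₗ TensorProduct.map f g ∘ₗ Coalgebra.comul (R := 𝕜)

/-- The constant point `[a]`. -/
def ptConst (n : ℤ) (a : 𝒜 n) : C →ₗ[𝕜] H.obj n :=
  (Coalgebra.counit (R := 𝕜) (A := C)).smulRight (H.const n a)

/-- The powers `fⁱ ∈ H²ⁱ(C)` of a point `f ∈ H²(C)`. -/
def ptPow [SetLike.GradedOne 𝒜] (f : C →ₗ[𝕜] H.obj 1) : ∀ i : ℕ, C →ₗ[𝕜] H.obj i
  | 0 => H.ptConst 0 ⟨1, SetLike.GradedOne.one_mem⟩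
  | i + 1 => H.ptMul i 1 (i + 1 : ℕ) (by push_cast; rfl) (ptPow f i) f

/-- The sum of a finite list of points. -/
def ptSum (n : ℤ) (l : List (C →ₗ[𝕜] H.obj n)) : C →ₗ[𝕜] H.obj n :=
  l.foldr (H.ptAdd n) (H.ptConst n 0)

end Points

end HopfRing

/-! ### The group object `𝔸¹ = H_*(ℂP^∞; 𝕜)` -/

/-- The free `𝕜`-module on `β₀, β₁, …`, where `βₙ` has degree `2n`. -/
def AffineLine (𝕜 : Type*) [CommRing 𝕜] : Type _ := ℕ →₀ 𝕜

namespace AffineLine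

variable {𝕜 : Type*} [CommRing 𝕜]

instance : AddCommGroup (AffineLine 𝕜) := inferInstanceAs (AddCommGroup (ℕ →₀ 𝕜))
instance : Module 𝕜 (AffineLine 𝕜) := inferInstanceAs (Module 𝕜 (ℕ →₀ 𝕜))

/-- The basis element `βₙ`. -/
def β (n : ℕ) : AffineLine 𝕜 := Finsupp.single n (1 : 𝕜)

/-- The linear map with prescribed values on the basis. -/
def lift {M : Type*} [AddCommMonoid M] [Module 𝕜 M] (f : ℕ → M) : AffineLine 𝕜 →ₗ[𝕜] M :=
  (Finsupp.linearCombination 𝕜 f : (ℕ →₀ 𝕜) →ₗ[𝕜] M)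

@[simp] lemma lift_β {M : Type*} [AddCommMonoid M] [Module 𝕜 M] (f : ℕ → M) (n : ℕ) : lift f (β (𝕜 := 𝕜) n) = f n := by
  have h := Finsupp.linearCombination_single 𝕜 (v := f) (1 : 𝕜) n
  rw [one_smul] at h
  exact h

lemma hom_ext {M : Type*} [AddCommMonoid M] [Module 𝕜 M] {f g : AffineLine 𝕜 →ₗ[𝕜] M}
    (h : ∀ n, f (β n) = g (β n)) : f = g := by
  have : (f : (ℕ →₀ 𝕜) →ₗ[𝕜] M) = g := by
    apply Finsupp.lhom_ext'
    intro n
    apply LinearMap.ext_ring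
    exact h n
  exact this

/-- The coproduct `βₙ ↦ ∑_{i+j=n} βᵢ ⊗ βⱼ` and the counit `βₙ ↦ δ_{n0}`. -/
instance : CoalgebraStruct 𝕜 (AffineLine 𝕜) where
  comul := lift fun n => ∑ p ∈ Finset.HasAntidiagonal.antidiagonal n, β p.1 ⊗ₜ[𝕜] β p.2
  counit := lift fun n => if n = 0 then 1 else 0

lemma comul_β (n : ℕ) : Coalgebra.comul (R := 𝕜) (β (𝕜 := 𝕜) n) =
    ∑ p ∈ Finset.HasAntidiagonal.antidiagonal n, β p.1 ⊗ₜ[𝕜] β p.2 := lift_β _ n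

lemma counit_β (n : ℕ) : Coalgebra.counit (R := 𝕜) (β (𝕜 := 𝕜) n) = if n = 0 then 1 else 0 := lift_β _ n

instance : Coalgebra 𝕜 (AffineLine 𝕜) where
  coassoc := by
    apply hom_ext
    intro n
    simp only [LinearMap.coe_comp, Function.comp_apply, LinearEquiv.coe_coe, comul_β, map_sum,
      LinearMap.rTensor_tmul, LinearMap.lTensor_tmul, TensorProduct.sum_tmul,
      TensorProduct.tmul_sum, TensorProduct.assoc_tmul]
    rw [Finset.sum_sigma', Finset.sum_sigma']
    refine Finset.sum_nbij' (fun t => ⟨(t.2.1, t.2.2 + t.1.2), (t.2.2, t.1.2)⟩)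
      (fun t => ⟨(t.1.1 + t.2.1, t.2.2), (t.1.1, t.2.1)⟩) ?_ ?_ ?_ ?_ ?_
    · rintro ⟨⟨a, b⟩, ⟨c, d⟩⟩ h
      simp only [Finset.mem_sigma, Finset.HasAntidiagonal.mem_antidiagonal] at h ⊢
      exact ⟨by omega, trivial⟩
    · rintro ⟨⟨a, b⟩, ⟨c, d⟩⟩ h
      simp only [Finset.mem_sigma, Finset.HasAntidiagonal.mem_antidiagonal] at h ⊢
      exact ⟨by omega, trivial⟩
    · rintro ⟨⟨a, b⟩, ⟨c, d⟩⟩ h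
      simp only [Finset.mem_sigma, Finset.HasAntidiagonal.mem_antidiagonal] at h
      obtain ⟨h1, rfl⟩ := h
      rfl
    · rintro ⟨⟨a, b⟩, ⟨c, d⟩⟩ h
      simp only [Finset.mem_sigma, Finset.HasAntidiagonal.mem_antidiagonal] at h
      obtain ⟨h1, rfl⟩ := h
      rfl
    · rintro ⟨⟨a, b⟩, ⟨c, d⟩⟩ h
      rfl
  rTensor_counit_comp_comul := by
    apply hom_ext
    intro n
    simp only [LinearMap.coe_comp, Function.comp_apply, comul_β, map_sum,
      LinearMap.rTensor_tmul, counit_β, TensorProduct.mk_apply]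
    rw [Finset.sum_eq_single (0, n)]
    · simp
    · rintro ⟨a, b⟩ h1 h2
      have : a ≠ 0 := by
        rintro rfl
        simp at h1 h2
        exact h2 h1
      simp [this]
    · simp
  lTensor_counit_comp_comul := by
    apply hom_ext
    intro n
    simp only [LinearMap.coe_comp, Function.comp_apply, comul_β, map_sum,
      LinearMap.lTensor_tmul, counit_β, LinearMap.flip_apply, TensorProduct.mk_apply]
    rw [Finset.sum_eq_single (n, 0)]
    · simp
    · rintro ⟨a, b⟩ h1 h2
      have : b ≠ 0 := by
        rintro rfl
        simp at h1 h2
        exact h2 h1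
      simp [this]
    · simp

/-- The group law `μ : 𝔸² → 𝔸¹`, `βᵢ ⊗ βⱼ ↦ (i+j choose i) βᵢ₊ⱼ`. -/
def μ : AffineLine 𝕜 ⊗[𝕜] AffineLine 𝕜 →ₗ[𝕜] AffineLine 𝕜 :=
  TensorProduct.lift (lift fun i => lift fun j => ((i + j).choose i : 𝕜) • β (i + j))

/-- The first projection `π₁ : 𝔸² → 𝔸¹`. -/
def π₁ : AffineLine 𝕜 ⊗[𝕜] AffineLine 𝕜 →ₗ[𝕜] AffineLine 𝕜 :=
  (TensorProduct.rid 𝕜 (AffineLine 𝕜)).toLinearMap ∘ₗ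
    LinearMap.lTensor (AffineLine 𝕜) (Coalgebra.counit (R := 𝕜))

/-- The second projection `π₂ : 𝔸² → 𝔸¹`. -/
def π₂ : AffineLine 𝕜 ⊗[𝕜] AffineLine 𝕜 →ₗ[𝕜] AffineLine 𝕜 :=
  (TensorProduct.lid 𝕜 (AffineLine 𝕜)).toLinearMap ∘ₗ
    LinearMap.rTensor (AffineLine 𝕜) (Coalgebra.counit (R := 𝕜))

end AffineLine

/-! ### Additive curves and the Ravenel-Wilson Hopf ring -/

/-- The coefficient `a_{ij}` of a formal group law `F(x, y) = ∑ a_{ij} xⁱ yʲ`. -/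
def FormalGroup.a {R : Type*} [CommRing R] (F : FormalGroup R) (i j : ℕ) : R :=
  F.toPowerSeries.coeff (Finsupp.single 0 i + Finsupp.single 1 j)

/-- A formal group law over an evenly graded ring is graded if `a_{ij}` has degree `2 - 2i - 2j`. -/
def FormalGroup.IsGraded {R : Type*} [CommRing R] (F : FormalGroup R)
    (𝒜 : ℤ → AddSubgroup R) : Prop :=
  ∀ i j : ℕ, F.a i j ∈ 𝒜 (1 - i - j)

namespace HopfRing

variable {𝕜 : Type*} [CommRing 𝕜] {R : Type u} [CommRing R] {𝒜 : ℤ → AddSubgroup R}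

/-- The partial sum `∑_{i,j ≤ N} [a_{ij}] xⁱ yʲ` in `H²(𝔸²)`, for `x ∈ H²(𝔸¹)`; here the symbols
`x` and `y` in the sum stand for `π₁^* x` and `π₂^* x`. -/
def formalSum [SetLike.GradedOne 𝒜] (H : HopfRing 𝕜 𝒜) (F : FormalGroup R) (hF : F.IsGraded 𝒜)
    (x : AffineLine 𝕜 →ₗ[𝕜] H.obj 1) (N : ℕ) :
    AffineLine 𝕜 ⊗[𝕜] AffineLine 𝕜 →ₗ[𝕜] H.obj 1 :=
  H.ptSum 1 ((List.range (N + 1) ×ˢ List.range (N + 1)).map fun p =>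
    H.ptMul (1 - p.1 - p.2) (p.1 + p.2) 1 (by ring)
      (H.ptConst (1 - p.1 - p.2) ⟨F.a p.1 p.2, hF p.1 p.2⟩)
      (H.ptMul p.1 p.2 (p.1 + p.2) rfl
        (H.ptPow (x ∘ₗ AffineLine.π₁) p.1) (H.ptPow (x ∘ₗ AffineLine.π₂) p.2)))

/-- An additive curve in `H`: a map of graded coalgebras `x : 𝔸¹ → H²` with `β₀^* x = [0]` and
`μ^* x = ∑ [a_{ij}] xⁱ yʲ`. The infinite sum is locally finite: on `βₘ ⊗ βₙ` the summands with
`i > m` or `j > n` are equal to the zero of the ring of points, so there the sum is the partial sum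
over `i, j ≤ N`, for any `N ≥ m, n`. -/
structure AdditiveCurve [SetLike.GradedOne 𝒜] (H : HopfRing 𝕜 𝒜) (F : FormalGroup R)
    (hF : F.IsGraded 𝒜) where
  /-- the underlying map of coalgebras -/
  map : AffineLine 𝕜 →ₗc[𝕜] H.obj 1
  map_deg : ∀ n : ℕ, map (AffineLine.β n) ∈ (H.obj 1).deg (2 * n)
  map_zero : map (AffineLine.β 0) = H.const 1 0
  map_mu : ∀ m n N : ℕ, m ≤ N → n ≤ N →
    map (AffineLine.μ (AffineLine.β m ⊗ₜ[𝕜] AffineLine.β n)) =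
      H.formalSum F hF map.toLinearMap N (AffineLine.β m ⊗ₜ[𝕜] AffineLine.β n)

/-- `(H, x)` is the Ravenel-Wilson Hopf ring of the graded formal group law `F`, with its universal
additive curve: maps of Hopf rings `H → K` correspond to additive curves in `K`. -/
def IsRavenelWilson [SetLike.GradedOne 𝒜] (F : FormalGroup R) (hF : F.IsGraded 𝒜)
    (H : HopfRing 𝕜 𝒜) (x : H.AdditiveCurve F hF) : Prop :=
  ∀ (K : HopfRing 𝕜 𝒜) (y : K.AdditiveCurve F hF),
    ∃! f : Hom H K, ∀ c : AffineLine 𝕜, (f.app 1).map (x.map c) = y.map c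

end HopfRing

/-! ### The Verschiebung of a cocommutative coalgebra over `𝔽₂` -/

section Verschiebung

variable (V : Type*) [AddCommGroup V] [Module (ZMod 2) V]

/-- The map `1 + τ` on `V ⊗ V`, where `τ (x ⊗ y) = y ⊗ x`. Over `𝔽₂` it is equal to `1 - τ`. -/
def oneAddSwap : V ⊗[ZMod 2] V →ₗ[ZMod 2] V ⊗[ZMod 2] V :=
  LinearMap.id + (TensorProduct.comm (ZMod 2) V V).toLinearMap

/-- The Tate cohomology `ker (1 - τ) / im (1 + τ)` of `V ⊗ V`. -/
abbrev Tate : Type _ :=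
  LinearMap.ker (oneAddSwap V) ⧸
    (LinearMap.range (oneAddSwap V)).submoduleOf (LinearMap.ker (oneAddSwap V))

variable {V}

lemma two_eq_zero' {M : Type*} [AddCommGroup M] [Module (ZMod 2) M] (x : M) : x + x = 0 := by
  have h : (2 : ZMod 2) • x = 0 := by
    have : (2 : ZMod 2) = 0 := rfl
    rw [this, zero_smul]
  rwa [two_smul] at h

lemma oneAddSwap_diag (x : V) : x ⊗ₜ[ZMod 2] x ∈ LinearMap.ker (oneAddSwap V) := by
  simp [oneAddSwap, two_eq_zero']

variable (V)

/-- The linear map `v ↦ v ⊗ v` from `V` to the Tate cohomology of `V ⊗ V`. -/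
def tateDiag : V →ₗ[ZMod 2] Tate V where
  toFun x := Submodule.Quotient.mk ⟨x ⊗ₜ x, oneAddSwap_diag x⟩
  map_add' x y := by
    rw [← Submodule.Quotient.mk_add, Submodule.Quotient.eq]
    simp only [Submodule.submoduleOf, Submodule.mem_comap, LinearMap.mem_range]
    refine ⟨x ⊗ₜ y, ?_⟩
    change x ⊗ₜ[ZMod 2] y + y ⊗ₜ[ZMod 2] x =
      (x + y) ⊗ₜ[ZMod 2] (x + y) - (x ⊗ₜ[ZMod 2] x + y ⊗ₜ[ZMod 2] y)
    rw [TensorProduct.add_tmul, TensorProduct.tmul_add, TensorProduct.tmul_add]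
    abel
  map_smul' c x := by
    rw [RingHom.id_apply, ← Submodule.Quotient.mk_smul]
    congr 1
    ext
    simp only [TensorProduct.smul_tmul', TensorProduct.tmul_smul, Submodule.coe_smul, smul_smul]
    congr 2
    revert c
    decide

lemma tateDiag_injective : Function.Injective (tateDiag V) := by
  rw [← LinearMap.ker_eq_bot, LinearMap.ker_eq_bot']
  intro x hx
  have hx' : (Submodule.Quotient.mk ⟨x ⊗ₜ x, oneAddSwap_diag x⟩ : Tate V) = 0 := hx
  rw [Submodule.Quotient.mk_eq_zero] at hx'
  simp only [Submodule.submoduleOf, Submodule.mem_comap, LinearMap.mem_range] at hx'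
  obtain ⟨z, hz⟩ := hx'
  rw [← Module.forall_dual_apply_eq_zero_iff (ZMod 2)]
  intro f
  have key : ∀ w : V ⊗[ZMod 2] V,
      TensorProduct.lift ((LinearMap.mul (ZMod 2) (ZMod 2)).compl₁₂ f f) (oneAddSwap V w) = 0 := by
    intro w
    induction w with
    | zero => simp
    | tmul a b =>
      simp only [oneAddSwap, LinearMap.add_apply, LinearMap.id_apply, LinearEquiv.coe_coe,
        TensorProduct.comm_tmul, map_add, TensorProduct.lift.tmul, LinearMap.compl₁₂_apply,
        LinearMap.mul_apply']
      rw [mul_comm (f b)]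
      exact two_eq_zero' _
    | add a b ha hb => rw [map_add, map_add, ha, hb, add_zero]
  have h := key z
  rw [hz] at h
  simpa using h

lemma tateDiag_surjective : Function.Surjective (tateDiag V) := by
  classical
  intro q
  obtain ⟨⟨t, ht⟩, rfl⟩ := Submodule.Quotient.mk_surjective _ q
  let b := Module.Basis.ofVectorSpace (ZMod 2) V
  let ι := Module.Basis.ofVectorSpaceIndex (ZMod 2) V
  let _ : LinearOrder ι := linearOrderOfSTO (WellOrderingRel (α := ι))
  let e := b.tensorProduct b
  let L : V ⊗[ZMod 2] V →ₗ[ZMod 2] V ⊗[ZMod 2] V :=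
    e.constr (ZMod 2) fun p => if p.1 < p.2 then b p.1 ⊗ₜ b p.2 else 0
  let G : V ⊗[ZMod 2] V →ₗ[ZMod 2] V ⊗[ZMod 2] V :=
    e.constr (ZMod 2) fun p => if p.1 = p.2 then b p.1 ⊗ₜ b p.2 else 0
  let δ : V ⊗[ZMod 2] V →ₗ[ZMod 2] V :=
    e.constr (ZMod 2) fun p => if p.1 = p.2 then b p.1 else 0
  let τ : V ⊗[ZMod 2] V →ₗ[ZMod 2] V ⊗[ZMod 2] V := (TensorProduct.comm (ZMod 2) V V).toLinearMap
  have hL : ∀ i j, L (b i ⊗ₜ b j) = if i < j then b i ⊗ₜ b j else 0 := fun i j => by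
    have := e.constr_basis (ZMod 2) (fun p => if p.1 < p.2 then b p.1 ⊗ₜ[ZMod 2] b p.2 else 0) (i, j)
    rwa [Module.Basis.tensorProduct_apply] at this
  have hG : ∀ i j, G (b i ⊗ₜ b j) = if i = j then b i ⊗ₜ b j else 0 := fun i j => by
    have := e.constr_basis (ZMod 2) (fun p => if p.1 = p.2 then b p.1 ⊗ₜ[ZMod 2] b p.2 else 0) (i, j)
    rwa [Module.Basis.tensorProduct_apply] at this
  have hδ : ∀ i j, δ (b i ⊗ₜ b j) = if i = j then b i else 0 := fun i j => by
    have := e.constr_basis (ZMod 2) (fun p => if p.1 = p.2 then b p.1 else 0) (i, j)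
    rwa [Module.Basis.tensorProduct_apply] at this
  have hid : LinearMap.id = L + τ ∘ₗ L ∘ₗ τ + G := by
    apply e.ext
    rintro ⟨i, j⟩
    rw [Module.Basis.tensorProduct_apply]
    simp only [LinearMap.id_apply, LinearMap.add_apply, LinearMap.comp_apply, hL, hG, τ,
      LinearEquiv.coe_coe, TensorProduct.comm_tmul]
    rcases lt_trichotomy i j with h | h | h
    · simp [h, h.ne, h.not_gt]
    · simp [h]
    · simp [h, h.ne', h.not_gt]
  have hdiag : ∀ w, δ w ⊗ₜ δ w - G w ∈ LinearMap.range (oneAddSwap V) := by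
    intro w
    have hw : w ∈ Submodule.span (ZMod 2) (Set.range e) := by rw [e.span_eq]; trivial
    induction hw using Submodule.span_induction with
    | mem x hx =>
      obtain ⟨⟨i, j⟩, rfl⟩ := hx
      rw [Module.Basis.tensorProduct_apply, hδ, hG]
      by_cases h : i = j
      · simp [h]
      · simp [h]
    | zero => simp
    | add x y _ _ hx hy =>
      have h3 : oneAddSwap V (δ x ⊗ₜ δ y) ∈ LinearMap.range (oneAddSwap V) := ⟨_, rfl⟩
      convert add_mem (add_mem hx hy) h3 using 1
      simp only [oneAddSwap, LinearMap.add_apply, LinearMap.id_apply, LinearEquiv.coe_coe,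
        TensorProduct.comm_tmul, map_add, TensorProduct.add_tmul, TensorProduct.tmul_add]
      abel
    | smul c x _ hx =>
      have hc : c * c = c := by
        revert c
        decide
      convert Submodule.smul_mem _ c hx using 1
      rw [map_smul, map_smul, TensorProduct.smul_tmul_smul, hc, smul_sub]
  refine ⟨δ t, ?_⟩
  change (Submodule.Quotient.mk ⟨δ t ⊗ₜ δ t, oneAddSwap_diag (δ t)⟩ : Tate V) = _
  rw [Submodule.Quotient.eq]
  simp only [Submodule.submoduleOf, Submodule.mem_comap, Submodule.subtype_apply,
    AddSubgroupClass.coe_sub]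
  have hτ : τ t = t := by
    have h1 : t + τ t = 0 := ht
    have h2 : t + t = 0 := two_eq_zero' t
    exact add_left_cancel (h1.trans h2.symm)
  have h4 : t = L t + τ (L t) + G t := by
    have := LinearMap.congr_fun hid t
    simpa [hτ] using this
  have h5 : oneAddSwap V (L t) = L t + τ (L t) := rfl
  have h6 : δ t ⊗ₜ[ZMod 2] δ t - t = (δ t ⊗ₜ δ t - G t) - oneAddSwap V (L t) := by
    rw [h5]
    nth_rw 3 [h4]
    abel
  rw [h6]
  exact sub_mem (hdiag t) ⟨_, rfl⟩

/-- `v ↦ v ⊗ v` is an isomorphism from `V` to the Tate cohomology of `V ⊗ V`. -/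
def tateEquiv : V ≃ₗ[ZMod 2] Tate V :=
  LinearEquiv.ofBijective (tateDiag V) ⟨tateDiag_injective V, tateDiag_surjective V⟩

variable [Coalgebra (ZMod 2) V] [Coalgebra.IsCocomm (ZMod 2) V]

lemma comul_mem_ker (x : V) :
    Coalgebra.comul (R := ZMod 2) x ∈ LinearMap.ker (oneAddSwap V) := by
  simp [oneAddSwap, two_eq_zero']

/-- The Verschiebung: `v(x)` corresponds to the class of `Δ(x)` in Tate cohomology. If `V` is
graded, then `v` maps `V₂ₙ` to `Vₙ`, and it vanishes on the pieces of odd degree. -/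
def verschiebung : V →ₗ[ZMod 2] V :=
  (tateEquiv V).symm.toLinearMap ∘ₗ
    Submodule.mkQ _ ∘ₗ
      LinearMap.codRestrict (LinearMap.ker (oneAddSwap V)) (Coalgebra.comul (R := ZMod 2))
        (comul_mem_ker V)

end Verschiebung

/-! ### The functors `Φᵏ` -/

namespace GradedCoalg

variable {𝕜 : Type*} [CommRing 𝕜] [Algebra 𝕜 (ZMod 2)]

/-- The reduction mod 2 of a graded coalgebra, as a coalgebra over `𝔽₂`. -/
abbrev Mod2 (C : GradedCoalg.{u} 𝕜) : Type u := ZMod 2 ⊗[𝕜] C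

instance (C : GradedCoalg.{u} 𝕜) : Coalgebra.IsCocomm (ZMod 2) C.Mod2 where
  comm_comp_comul := by
    ext x
    let Ψ : C ⊗[𝕜] C →ₗ[𝕜] C.Mod2 ⊗[ZMod 2] C.Mod2 :=
      (TensorProduct.AlgebraTensorModule.tensorTensorTensorComm 𝕜 (ZMod 2) 𝕜 (ZMod 2)
        (ZMod 2) (ZMod 2) C C).toLinearMap.restrictScalars 𝕜 ∘ₗ
        TensorProduct.mk 𝕜 (ZMod 2 ⊗[ZMod 2] ZMod 2) (C ⊗[𝕜] C) (1 ⊗ₜ 1)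
    have h1 : Coalgebra.comul (R := ZMod 2) ((1 : ZMod 2) ⊗ₜ[𝕜] x) =
        Ψ (Coalgebra.comul (R := 𝕜) x) := rfl
    have h2 : ∀ w, TensorProduct.comm (ZMod 2) C.Mod2 C.Mod2 (Ψ w) =
        Ψ (TensorProduct.comm 𝕜 C C w) := by
      intro w
      induction w with
      | zero => simp
      | tmul a b => rfl
      | add a b ha hb => simp only [map_add, ha, hb]
    have h3 : Ψ (TensorProduct.comm 𝕜 C C (Coalgebra.comul (R := 𝕜) x)) =
        Ψ (Coalgebra.comul (R := 𝕜) x) := by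
      have h := LinearMap.congr_fun C.cocomm x
      simp only [koszulSwap, LinearMap.comp_apply, LinearMap.sub_apply, LinearMap.smul_apply,
        LinearMap.id_apply, LinearEquiv.coe_coe, map_sub, map_smul] at h
      conv_rhs => rw [← h]
      have h4 : ∀ v : C.Mod2 ⊗[ZMod 2] C.Mod2, v + v = 0 := fun v => two_eq_zero' v
      rw [map_sub, map_smul, two_smul]
      refine Eq.symm (sub_eq_self.mpr ?_)
      exact h4 _
    change TensorProduct.comm (ZMod 2) C.Mod2 C.Mod2
      (Coalgebra.comul (R := ZMod 2) ((1 : ZMod 2) ⊗ₜ[𝕜] x)) =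
      Coalgebra.comul (R := ZMod 2) ((1 : ZMod 2) ⊗ₜ[𝕜] x)
    rw [h1, h2, h3]

/-- The degree `m` piece of `Φᵏ(C)`: the sum of the `C₂ⱼ ⊗ 𝔽₂` over all `j` with `k j = m`
(for `k ≠ 0` there is at most one such `j`). If `C` is concentrated in even degrees, then the
coalgebra `Φᵏ(C)` is `C.Mod2` with this grading. -/
def phiDeg (C : GradedCoalg.{u} 𝕜) (k m : ℤ) : Submodule (ZMod 2) C.Mod2 :=
  ⨆ (j : ℤ) (_ : k * j = m), (C.deg (2 * j)).baseChange (ZMod 2)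

end GradedCoalg

end

/-! Existence is the construction of a free object. Expressions in constants `[a]` and curve
components `βᵢ` under formal sum and product span a free module. Its coproduct is defined by
recursion: constants are group-like, `βᵢ` splits as on the affine line, and sum and product are made
into coalgebra maps. The Hopf ring is the quotient by the span of the Hopf ring axioms and the curve
equations, closed under both operations. Three facts make this work.

The span is a coideal (`Rel.isCoidealElem`). Almost every relation is a difference `f c - g c` for
coalgebra maps `f`, `g` that agree in the quotient, or a difference of two group-like elements with
the same class. The coproduct of such a difference dies in the tensor square of the quotient.

The relations are homogeneous (`Rel.exists_weight`), where the weight of an expression is the sum of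
its curve indices. So the quotient is graded by twice the weight and lies in even degrees, where no
Koszul sign survives.

Negatives need no separate generator: multiplication by `[-1]` is an antipode, by distributivity.

Expressions can be evaluated in any Hopf ring with an additive curve, and their values there have
even degree, so signs disappear in the target as well. Evaluation kills the relations, and a map of
Hopf rings that carries the curve along has no other choice on expressions. This is the universal
property.

For the Verschiebung, let `(H, x)` be any universal pair. The map from `H` to the constructed Hopf
ring followed by evaluation is the identity of `H`, by uniqueness, so the values of expressions span
every graded piece (`deg_eq_span`). Modulo 2 the Verschiebung is compatible with sums and products
of expressions, fixes constants, and sends `β₂ᵢ` to `βᵢ` and `β₂ᵢ₊₁` to `0`. Hence an expression is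
the Verschiebung of the one with all curve indices doubled, which gives surjectivity
(`isVerschiebung_double`). Conversely the Verschiebung of an expression is zero or an expression of
half the weight, so the image stays in the expected degree (`exists_isVerschiebung`). -/

noncomputable section

/-! ### Tensor products of coalgebra structures, elementwise -/

section CoalgebraStruct

open TensorProduct Coalgebra

variable {𝕜 : Type*} [CommRing 𝕜] {A B D : Type*} [AddCommGroup A] [AddCommGroup B] [AddCommGroup D]
  [Module 𝕜 A] [Module 𝕜 B] [Module 𝕜 D] [CoalgebraStruct 𝕜 A] [CoalgebraStruct 𝕜 B]
  [CoalgebraStruct 𝕜 D]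

variable (𝕜) in
/-- The coalgebra axioms and cocommutativity, at one element of a coalgebra structure. -/
structure IsCocommAt (x : A) : Prop where
  coassoc : TensorProduct.assoc 𝕜 A A A ((comul (R := 𝕜)).rTensor A (comul (R := 𝕜) x)) =
    (comul (R := 𝕜)).lTensor A (comul (R := 𝕜) x)
  rTensor_counit : (counit (R := 𝕜)).rTensor A (comul (R := 𝕜) x) = 1 ⊗ₜ[𝕜] x
  lTensor_counit : (counit (R := 𝕜)).lTensor A (comul (R := 𝕜) x) = x ⊗ₜ[𝕜] 1
  comm : TensorProduct.comm 𝕜 A A (comul (R := 𝕜) x) = comul (R := 𝕜) x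

/-- Each axiom at `x ⊗ y` is the pair of axioms at `x` and `y`, carried through a permutation of
tensor factors. Working at one element matters: the axioms are later proved by induction on terms,
before any module of terms is known to be a coalgebra. -/
lemma IsCocommAt.tmul {x : A} {y : B} (hx : IsCocommAt 𝕜 x) (hy : IsCocommAt 𝕜 y) :
    IsCocommAt 𝕜 (x ⊗ₜ[𝕜] y) where
  coassoc := by
    -- `T` pairs the three factors from `A` with the three from `B`; both sides of coassociativity
    -- factor through it.
    let T : A ⊗[𝕜] (A ⊗[𝕜] A) ⊗[𝕜] (B ⊗[𝕜] (B ⊗[𝕜] B)) →ₗ[𝕜]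
        A ⊗[𝕜] B ⊗[𝕜] (A ⊗[𝕜] B ⊗[𝕜] (A ⊗[𝕜] B)) :=
      TensorProduct.map .id (tensorTensorTensorComm 𝕜 A A B B).toLinearMap ∘ₗ
        (tensorTensorTensorComm 𝕜 A (A ⊗[𝕜] A) B (B ⊗[𝕜] B)).toLinearMap
    have h₁ : ∀ (u : A ⊗[𝕜] A) (v : B ⊗[𝕜] B),
        TensorProduct.assoc 𝕜 (A ⊗[𝕜] B) (A ⊗[𝕜] B) (A ⊗[𝕜] B)
          ((comul (R := 𝕜)).rTensor (A ⊗[𝕜] B) (tensorTensorTensorComm 𝕜 A A B B (u ⊗ₜ v))) =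
        T (TensorProduct.assoc 𝕜 A A A ((comul (R := 𝕜)).rTensor A u) ⊗ₜ
          TensorProduct.assoc 𝕜 B B B ((comul (R := 𝕜)).rTensor B v)) := by
      intro u v
      induction u with
      | zero => simp
      | add u₁ u₂ h₁ h₂ => simp only [add_tmul, map_add, h₁, h₂]
      | tmul a a' =>
        induction v with
        | zero => simp
        | add u₁ u₂ h₁ h₂ => simp only [tmul_add, map_add, h₁, h₂]
        | tmul b b' =>
          simp only [tensorTensorTensorComm_tmul, LinearMap.rTensor_tmul, comul_tmul,
            AlgebraTensorModule.tensorTensorTensorComm_eq]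
          induction comul (R := 𝕜) a with
          | zero => simp
          | add u₁ u₂ h₁ h₂ => simp only [add_tmul, map_add, h₁, h₂]
          | tmul c c' =>
            induction comul (R := 𝕜) b with
            | zero => simp
            | add u₁ u₂ h₁ h₂ => simp only [add_tmul, tmul_add, map_add, h₁, h₂]
            | tmul d d' => rfl
    have h₂ : ∀ (u : A ⊗[𝕜] A) (v : B ⊗[𝕜] B),
          (comul (R := 𝕜)).lTensor (A ⊗[𝕜] B) (tensorTensorTensorComm 𝕜 A A B B (u ⊗ₜ v)) =
        T ((comul (R := 𝕜)).lTensor A u ⊗ₜ (comul (R := 𝕜)).lTensor B v) := by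
      intro u v
      induction u with
      | zero => simp
      | add u₁ u₂ h₁ h₂ => simp only [add_tmul, map_add, h₁, h₂]
      | tmul a a' =>
        induction v with
        | zero => simp
        | add u₁ u₂ h₁ h₂ => simp only [tmul_add, map_add, h₁, h₂]
        | tmul b b' => rfl
    have h := h₁ (comul (R := 𝕜) x) (comul (R := 𝕜) y)
    rw [hx.coassoc, hy.coassoc, ← h₂] at h
    exact h
  rTensor_counit := by
    have h₁ : ∀ (u : A ⊗[𝕜] A) (v : B ⊗[𝕜] B),
        (counit (R := 𝕜)).rTensor (A ⊗[𝕜] B) (tensorTensorTensorComm 𝕜 A A B B (u ⊗ₜ v)) =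
        TensorProduct.map (TensorProduct.lid 𝕜 𝕜).toLinearMap .id (tensorTensorTensorComm 𝕜 𝕜 A 𝕜 B
          ((counit (R := 𝕜)).rTensor A u ⊗ₜ (counit (R := 𝕜)).rTensor B v)) := by
      intro u v
      induction u with
      | zero => simp
      | add u₁ u₂ h₁ h₂ => simp only [add_tmul, map_add, h₁, h₂]
      | tmul a a' =>
        induction v with
        | zero => simp
        | add u₁ u₂ h₁ h₂ => simp only [tmul_add, map_add, h₁, h₂]
        | tmul b b' => simp [mul_comm]
    have h := h₁ (comul (R := 𝕜) x) (comul (R := 𝕜) y)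
    rw [hx.rTensor_counit, hy.rTensor_counit] at h
    refine h.trans ?_
    simp
  lTensor_counit := by
    have h₁ : ∀ (u : A ⊗[𝕜] A) (v : B ⊗[𝕜] B),
        (counit (R := 𝕜)).lTensor (A ⊗[𝕜] B) (tensorTensorTensorComm 𝕜 A A B B (u ⊗ₜ v)) =
        TensorProduct.map .id (TensorProduct.lid 𝕜 𝕜).toLinearMap (tensorTensorTensorComm 𝕜 A 𝕜 B 𝕜
          ((counit (R := 𝕜)).lTensor A u ⊗ₜ (counit (R := 𝕜)).lTensor B v)) := by
      intro u v
      induction u with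
      | zero => simp
      | add u₁ u₂ h₁ h₂ => simp only [add_tmul, map_add, h₁, h₂]
      | tmul a a' =>
        induction v with
        | zero => simp
        | add u₁ u₂ h₁ h₂ => simp only [tmul_add, map_add, h₁, h₂]
        | tmul b b' => simp [mul_comm]
    have h := h₁ (comul (R := 𝕜) x) (comul (R := 𝕜) y)
    rw [hx.lTensor_counit, hy.lTensor_counit] at h
    refine h.trans ?_
    simp
  comm := by
    have h₁ : ∀ (u : A ⊗[𝕜] A) (v : B ⊗[𝕜] B),
        TensorProduct.comm 𝕜 _ _ (tensorTensorTensorComm 𝕜 A A B B (u ⊗ₜ v)) =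
        tensorTensorTensorComm 𝕜 A A B B
          (TensorProduct.comm 𝕜 _ _ u ⊗ₜ TensorProduct.comm 𝕜 _ _ v) := by
      intro u v
      induction u with
      | zero => simp
      | add u₁ u₂ h₁ h₂ => simp only [add_tmul, map_add, h₁, h₂]
      | tmul a a' =>
        induction v with
        | zero => simp
        | add u₁ u₂ h₁ h₂ => simp only [tmul_add, map_add, h₁, h₂]
        | tmul b b' => rfl
    have h := h₁ (comul (R := 𝕜) x) (comul (R := 𝕜) y)
    rw [hx.comm, hy.comm] at h
    exact h

/-- The axioms are natural for maps that respect coproduct and counit. With `f` the sum or product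
of terms and `IsCocommAt.tmul`, this is the inductive step for compound terms. -/
lemma IsCocommAt.map {x : A} (hx : IsCocommAt 𝕜 x) (f : A →ₗ[𝕜] D)
    (hf : ∀ a, comul (R := 𝕜) (f a) = TensorProduct.map f f (comul (R := 𝕜) a))
    (hf' : ∀ a, counit (R := 𝕜) (f a) = counit (R := 𝕜) a) : IsCocommAt 𝕜 (f x) where
  coassoc := by
    have h₁ : ∀ u : A ⊗[𝕜] A, TensorProduct.assoc 𝕜 D D D
        ((comul (R := 𝕜)).rTensor D (TensorProduct.map f f u)) =
        TensorProduct.map f (TensorProduct.map f f)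
          (TensorProduct.assoc 𝕜 A A A ((comul (R := 𝕜)).rTensor A u)) := by
      intro u
      induction u with
      | zero => simp
      | add u₁ u₂ h₁ h₂ => simp only [map_add, h₁, h₂]
      | tmul a a' =>
        simp only [map_tmul, LinearMap.rTensor_tmul, hf]
        induction comul (R := 𝕜) a with
        | zero => simp
        | add u₁ u₂ h₁ h₂ => simp only [map_add, add_tmul, h₁, h₂]
        | tmul c d => rfl
    have h₂ : ∀ u : A ⊗[𝕜] A, (comul (R := 𝕜)).lTensor D (TensorProduct.map f f u) =
        TensorProduct.map f (TensorProduct.map f f) ((comul (R := 𝕜)).lTensor A u) := by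
      intro u
      induction u with
      | zero => simp
      | add u₁ u₂ h₁ h₂ => simp only [map_add, h₁, h₂]
      | tmul a a' => simp only [map_tmul, LinearMap.lTensor_tmul, hf]
    rw [hf, h₁, h₂, hx.coassoc]
  rTensor_counit := by
    have h₁ : ∀ u : A ⊗[𝕜] A, (counit (R := 𝕜)).rTensor D (TensorProduct.map f f u) =
        TensorProduct.map .id f ((counit (R := 𝕜)).rTensor A u) := by
      intro u
      induction u with
      | zero => simp
      | add u₁ u₂ h₁ h₂ => simp only [map_add, h₁, h₂]
      | tmul a a' => simp [hf']
    rw [hf, h₁, hx.rTensor_counit]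
    simp
  lTensor_counit := by
    have h₁ : ∀ u : A ⊗[𝕜] A, (counit (R := 𝕜)).lTensor D (TensorProduct.map f f u) =
        TensorProduct.map f .id ((counit (R := 𝕜)).lTensor A u) := by
      intro u
      induction u with
      | zero => simp
      | add u₁ u₂ h₁ h₂ => simp only [map_add, h₁, h₂]
      | tmul a a' => simp [hf']
    rw [hf, h₁, hx.lTensor_counit]
    simp
  comm := by
    have h₁ : ∀ u : A ⊗[𝕜] A, TensorProduct.comm 𝕜 D D (TensorProduct.map f f u) =
        TensorProduct.map f f (TensorProduct.comm 𝕜 A A u) := by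
      intro u
      induction u with
      | zero => simp
      | add u₁ u₂ h₁ h₂ => simp only [map_add, h₁, h₂]
      | tmul a a' => simp
    rw [hf, h₁, hx.comm]

end CoalgebraStruct

/-! ### Formal terms in the language of Hopf rings with a curve -/

namespace FormalHopf

variable {R : Type u} [CommRing R]

/-- Formal expressions built from constants and the components of a curve. -/
inductive Term (𝒜 : ℤ → AddSubgroup R) : ℤ → Type u
  | const (n : ℤ) (a : 𝒜 n) : Term 𝒜 n
  | curve (i : ℕ) : Term 𝒜 1
  | add {n : ℤ} (s t : Term 𝒜 n) : Term 𝒜 n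
  | mul {i j k : ℤ} (h : i + j = k) (s : Term 𝒜 i) (t : Term 𝒜 j) : Term 𝒜 k

variable {𝒜 : ℤ → AddSubgroup R}

/-- Half the degree of a term. -/
def Term.weight : {n : ℤ} → Term 𝒜 n → ℕ
  | _, .const _ _ => 0
  | _, .curve i => i
  | _, .add s t => s.weight + t.weight
  | _, .mul _ s t => s.weight + t.weight

/-- The free module on the terms. -/
def FreeModule (𝕜 : Type) [CommRing 𝕜] (𝒜 : ℤ → AddSubgroup R) (n : ℤ) : Type u := Term 𝒜 n →₀ 𝕜

namespace FreeModule

variable {𝕜 : Type} [CommRing 𝕜] {n : ℤ}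

instance : AddCommGroup (FreeModule 𝕜 𝒜 n) := inferInstanceAs (AddCommGroup (Term 𝒜 n →₀ 𝕜))
instance : Module 𝕜 (FreeModule 𝕜 𝒜 n) := inferInstanceAs (Module 𝕜 (Term 𝒜 n →₀ 𝕜))

variable (𝕜) in
/-- The basis element of a term. -/
def of (t : Term 𝒜 n) : FreeModule 𝕜 𝒜 n := Finsupp.single t (1 : 𝕜)

/-- The linear map with prescribed values on terms. -/
def lift {M : Type*} [AddCommMonoid M] [Module 𝕜 M] (f : Term 𝒜 n → M) : FreeModule 𝕜 𝒜 n →ₗ[𝕜] M :=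
  (Finsupp.linearCombination 𝕜 f : (Term 𝒜 n →₀ 𝕜) →ₗ[𝕜] M)

@[simp] lemma lift_of {M : Type*} [AddCommMonoid M] [Module 𝕜 M] (f : Term 𝒜 n → M) (t : Term 𝒜 n) :
    lift f (of 𝕜 t) = f t := by
  have h := Finsupp.linearCombination_single 𝕜 (v := f) (1 : 𝕜) t
  rw [one_smul] at h
  exact h

lemma hom_ext {M : Type*} [AddCommMonoid M] [Module 𝕜 M] {f g : FreeModule 𝕜 𝒜 n →ₗ[𝕜] M}
    (h : ∀ t, f (of 𝕜 t) = g (of 𝕜 t)) : f = g := by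
  have : (f : (Term 𝒜 n →₀ 𝕜) →ₗ[𝕜] M) = g := by
    apply Finsupp.lhom_ext'
    intro t
    apply LinearMap.ext_ring
    exact h t
  exact this

variable (𝕜 𝒜 n) in
/-- Addition of terms, extended bilinearly. -/
def add : FreeModule 𝕜 𝒜 n ⊗[𝕜] FreeModule 𝕜 𝒜 n →ₗ[𝕜] FreeModule 𝕜 𝒜 n :=
  TensorProduct.lift (lift fun s => lift fun t => of 𝕜 (s.add t))

variable (𝕜 𝒜) in
/-- Multiplication of terms, extended bilinearly. -/
def mul {i j k : ℤ} (h : i + j = k) :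
    FreeModule 𝕜 𝒜 i ⊗[𝕜] FreeModule 𝕜 𝒜 j →ₗ[𝕜] FreeModule 𝕜 𝒜 k :=
  TensorProduct.lift (lift fun s => lift fun t => of 𝕜 (s.mul h t))

@[simp] lemma add_of (s t : Term 𝒜 n) : add 𝒜 𝕜 n (of 𝕜 s ⊗ₜ of 𝕜 t) = of 𝕜 (s.add t) := by
  simp [add]

@[simp] lemma mul_of {i j k : ℤ} (h : i + j = k) (s : Term 𝒜 i) (t : Term 𝒜 j) :
    mul 𝒜 𝕜 h (of 𝕜 s ⊗ₜ of 𝕜 t) = of 𝕜 (s.mul h t) := by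
  simp [mul]

variable (𝕜) in
/-- The coproduct of a term. -/
def termComul : {n : ℤ} → Term 𝒜 n → FreeModule 𝕜 𝒜 n ⊗[𝕜] FreeModule 𝕜 𝒜 n
  | _, .const n a => of 𝕜 (.const n a) ⊗ₜ of 𝕜 (.const n a)
  | _, .curve i => ∑ p ∈ Finset.HasAntidiagonal.antidiagonal i,
      of 𝕜 (.curve p.1) ⊗ₜ of 𝕜 (.curve p.2)
  | n, .add s t => TensorProduct.map (add 𝒜 𝕜 n) (add 𝒜 𝕜 n)
      (TensorProduct.tensorTensorTensorComm 𝕜 _ _ _ _ (termComul s ⊗ₜ termComul t))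
  | _, .mul h s t => TensorProduct.map (mul 𝒜 𝕜 h) (mul 𝒜 𝕜 h)
      (TensorProduct.tensorTensorTensorComm 𝕜 _ _ _ _ (termComul s ⊗ₜ termComul t))

variable (𝕜) in
/-- The counit on terms. -/
def termCounit : {n : ℤ} → Term 𝒜 n → 𝕜
  | _, .const _ _ => 1
  | _, .curve i => if i = 0 then 1 else 0
  | _, .add s t => termCounit s * termCounit t
  | _, .mul _ s t => termCounit s * termCounit t

open Coalgebra

instance : CoalgebraStruct 𝕜 (FreeModule 𝕜 𝒜 n) where
  comul := lift (termComul 𝕜)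
  counit := lift (termCounit 𝕜)

lemma comul_of (t : Term 𝒜 n) : comul (R := 𝕜) (of 𝕜 t) = termComul 𝕜 t := lift_of _ _
lemma counit_of (t : Term 𝒜 n) : counit (R := 𝕜) (of 𝕜 t) = termCounit 𝕜 t := lift_of _ _

/-- On basis elements this is the recursion that defines `termComul`, which was chosen to make it
true. -/
lemma comul_add (z : FreeModule 𝕜 𝒜 n ⊗[𝕜] FreeModule 𝕜 𝒜 n) : comul (R := 𝕜) (add 𝒜 𝕜 n z) =
    TensorProduct.map (add 𝒜 𝕜 n) (add 𝒜 𝕜 n) (comul (R := 𝕜) z) := by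
  refine LinearMap.congr_fun (f := comul ∘ₗ add 𝒜 𝕜 n)
    (g := TensorProduct.map (add 𝒜 𝕜 n) (add 𝒜 𝕜 n) ∘ₗ comul)
    (TensorProduct.ext <| hom_ext fun s => hom_ext fun t => ?_) z
  simp [comul_of, termComul, TensorProduct.AlgebraTensorModule.tensorTensorTensorComm_eq]

lemma comul_mul {i j k : ℤ} (h : i + j = k) (z : FreeModule 𝕜 𝒜 i ⊗[𝕜] FreeModule 𝕜 𝒜 j) :
    comul (R := 𝕜) (mul 𝒜 𝕜 h z) =
      TensorProduct.map (mul 𝒜 𝕜 h) (mul 𝒜 𝕜 h) (comul (R := 𝕜) z) := by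
  refine LinearMap.congr_fun (f := comul ∘ₗ mul 𝒜 𝕜 h)
    (g := TensorProduct.map (mul 𝒜 𝕜 h) (mul 𝒜 𝕜 h) ∘ₗ comul)
    (TensorProduct.ext <| hom_ext fun s => hom_ext fun t => ?_) z
  simp [comul_of, termComul, TensorProduct.AlgebraTensorModule.tensorTensorTensorComm_eq]

lemma counit_add (z : FreeModule 𝕜 𝒜 n ⊗[𝕜] FreeModule 𝕜 𝒜 n) :
    counit (R := 𝕜) (add 𝒜 𝕜 n z) = counit (R := 𝕜) z := by
  refine LinearMap.congr_fun (f := counit ∘ₗ add 𝒜 𝕜 n) (g := counit)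
    (TensorProduct.ext <| hom_ext fun s => hom_ext fun t => ?_) z
  simp [counit_of, termCounit, mul_comm (termCounit 𝕜 s)]

lemma counit_mul {i j k : ℤ} (h : i + j = k) (z : FreeModule 𝕜 𝒜 i ⊗[𝕜] FreeModule 𝕜 𝒜 j) :
    counit (R := 𝕜) (mul 𝒜 𝕜 h z) = counit (R := 𝕜) z := by
  refine LinearMap.congr_fun (f := counit ∘ₗ mul 𝒜 𝕜 h) (g := counit)
    (TensorProduct.ext <| hom_ext fun s => hom_ext fun t => ?_) z
  simp [counit_of, termCounit, mul_comm (termCounit 𝕜 s)]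

end FreeModule

end FormalHopf

instance {𝕜 : Type*} [CommRing 𝕜] : Coalgebra.IsCocomm 𝕜 (AffineLine 𝕜) where
  comm_comp_comul := AffineLine.hom_ext fun n => by
    simp only [LinearMap.comp_apply, LinearEquiv.coe_coe, AffineLine.comul_β, map_sum,
      TensorProduct.comm_tmul]
    exact Finset.sum_equiv (Equiv.prodComm ℕ ℕ) (by simp [add_comm]) (by simp)

/-! ### The free module on terms as a cocommutative coalgebra -/

namespace FormalHopf

variable {R : Type u} [CommRing R] {𝒜 : ℤ → AddSubgroup R}

namespace FreeModule

variable {𝕜 : Type} [CommRing 𝕜] {n : ℤ}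

open Coalgebra

variable (𝕜 𝒜) in
/-- The tautological curve, as a linear map. -/
def curve : AffineLine 𝕜 →ₗ[𝕜] FreeModule 𝕜 𝒜 1 := AffineLine.lift fun i => of 𝕜 (.curve i)

@[simp] lemma curve_β (i : ℕ) : curve 𝒜 𝕜 (AffineLine.β i) = of 𝕜 (.curve i) :=
  AffineLine.lift_β _ _

lemma comul_curve (c : AffineLine 𝕜) : comul (R := 𝕜) (curve 𝒜 𝕜 c) =
    TensorProduct.map (curve 𝒜 𝕜) (curve 𝒜 𝕜) (comul (R := 𝕜) c) := by
  refine LinearMap.congr_fun (f := comul ∘ₗ curve 𝒜 𝕜)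
    (g := TensorProduct.map (curve 𝒜 𝕜) (curve 𝒜 𝕜) ∘ₗ comul)
    (AffineLine.hom_ext fun i => ?_) c
  simp [comul_of, termComul, AffineLine.comul_β]

lemma counit_curve (c : AffineLine 𝕜) :
    counit (R := 𝕜) (curve 𝒜 𝕜 c) = counit (R := 𝕜) c := by
  refine LinearMap.congr_fun (f := counit ∘ₗ curve 𝒜 𝕜) (g := counit)
    (AffineLine.hom_ext fun i => ?_) c
  simp [counit_of, termCounit, AffineLine.counit_β]

/-- Constants are group-like, curve components come from the affine line, and sums and products are
images of tensors under maps that respect the coalgebra structure. -/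
lemma isCocommAt_of : ∀ {n : ℤ} (t : Term 𝒜 n), IsCocommAt 𝕜 (of 𝕜 t)
  | _, .const n a => by
    have h : comul (R := 𝕜) (of 𝕜 (.const n a)) = of 𝕜 (.const n a) ⊗ₜ of 𝕜 (.const n a) :=
      comul_of _
    have h' : counit (R := 𝕜) (of 𝕜 (.const n a)) = 1 := counit_of _
    constructor <;> simp [h, h']
  | _, .curve i => by
    rw [← curve_β]
    exact IsCocommAt.map ⟨coassoc_apply _, rTensor_counit_comul _, lTensor_counit_comul _,
      comm_comul _ _⟩ _ comul_curve counit_curve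
  | n, .add s t => by
    rw [← add_of]
    exact ((isCocommAt_of s).tmul (isCocommAt_of t)).map _ comul_add counit_add
  | _, .mul h s t => by
    rw [← mul_of]
    exact ((isCocommAt_of s).tmul (isCocommAt_of t)).map _ (comul_mul h) (counit_mul h)

instance : Coalgebra 𝕜 (FreeModule 𝕜 𝒜 n) where
  coassoc := hom_ext fun t => (isCocommAt_of t).coassoc
  rTensor_counit_comp_comul := hom_ext fun t => (isCocommAt_of t).rTensor_counit
  lTensor_counit_comp_comul := hom_ext fun t => (isCocommAt_of t).lTensor_counit

instance : IsCocomm 𝕜 (FreeModule 𝕜 𝒜 n) where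
  comm_comp_comul := hom_ext fun t => (isCocommAt_of t).comm

variable (𝕜 𝒜 n) in
/-- Addition as a map of coalgebras. -/
def addHom : FreeModule 𝕜 𝒜 n ⊗[𝕜] FreeModule 𝕜 𝒜 n →ₗc[𝕜] FreeModule 𝕜 𝒜 n where
  __ := add 𝒜 𝕜 n
  counit_comp := LinearMap.ext counit_add
  map_comp_comul := LinearMap.ext fun z => (comul_add z).symm

variable (𝕜 𝒜) in
/-- Multiplication as a map of coalgebras. -/
def mulHom {i j k : ℤ} (h : i + j = k) :
    FreeModule 𝕜 𝒜 i ⊗[𝕜] FreeModule 𝕜 𝒜 j →ₗc[𝕜] FreeModule 𝕜 𝒜 k where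
  __ := mul 𝒜 𝕜 h
  counit_comp := LinearMap.ext (counit_mul h)
  map_comp_comul := LinearMap.ext fun z => (comul_mul h z).symm

variable (𝕜 𝒜) in
/-- The tautological curve as a map of coalgebras. -/
def curveHom : AffineLine 𝕜 →ₗc[𝕜] FreeModule 𝕜 𝒜 1 where
  __ := curve 𝒜 𝕜
  counit_comp := LinearMap.ext counit_curve
  map_comp_comul := LinearMap.ext fun z => (comul_curve z).symm

@[simp] lemma curveHom_apply (z) : curveHom 𝒜 𝕜 z = curve 𝒜 𝕜 z := rfl

end FreeModule

end FormalHopf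

/-! ### Projections and group law of the affine line as coalgebra maps -/

namespace AffineLine

variable {𝕜 : Type*} [CommRing 𝕜]

/-- The first projection, as a map of coalgebras. -/
def fstHom : AffineLine 𝕜 ⊗[𝕜] AffineLine 𝕜 →ₗc[𝕜] AffineLine 𝕜 :=
  (Coalgebra.TensorProduct.rid 𝕜 𝕜 (AffineLine 𝕜) : _ →ₗc[𝕜] _).comp
    (CoalgHom.lTensor (AffineLine 𝕜) (Coalgebra.counitCoalgHom 𝕜 (AffineLine 𝕜)))

/-- The second projection, as a map of coalgebras. -/
def sndHom : AffineLine 𝕜 ⊗[𝕜] AffineLine 𝕜 →ₗc[𝕜] AffineLine 𝕜 :=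
  (Coalgebra.TensorProduct.lid 𝕜 (AffineLine 𝕜) : _ →ₗc[𝕜] _).comp
    (CoalgHom.rTensor (AffineLine 𝕜) (Coalgebra.counitCoalgHom 𝕜 (AffineLine 𝕜)))

lemma fstHom_tmul (a b : AffineLine 𝕜) :
    fstHom (a ⊗ₜ[𝕜] b) = Coalgebra.counit (R := 𝕜) b • a := rfl

lemma sndHom_tmul (a b : AffineLine 𝕜) :
    sndHom (a ⊗ₜ[𝕜] b) = Coalgebra.counit (R := 𝕜) a • b := rfl

lemma μ_β (i j : ℕ) : μ (β i ⊗ₜ[𝕜] β j) = ((i + j).choose i : 𝕜) • β (i + j) := by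
  simp [μ]

lemma comul_β_tmul_β (m n : ℕ) : Coalgebra.comul (R := 𝕜) (β (𝕜 := 𝕜) m ⊗ₜ[𝕜] β (𝕜 := 𝕜) n) =
    ∑ p ∈ Finset.HasAntidiagonal.antidiagonal m, ∑ q ∈ Finset.HasAntidiagonal.antidiagonal n,
      (β p.1 ⊗ₜ[𝕜] β q.1) ⊗ₜ[𝕜] (β p.2 ⊗ₜ[𝕜] β q.2) := by
  simp only [TensorProduct.comul_tmul, comul_β, TensorProduct.sum_tmul, TensorProduct.tmul_sum,
    map_sum]
  rw [Finset.sum_comm]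
  rfl

/-- The group law, as a map of coalgebras. -/
def μHom : AffineLine 𝕜 ⊗[𝕜] AffineLine 𝕜 →ₗc[𝕜] AffineLine 𝕜 where
  __ := μ
  counit_comp := TensorProduct.ext <| hom_ext fun m => hom_ext fun n => by
    rcases m with _ | m <;> rcases n with _ | n <;> simp [μ_β, counit_β]
  map_comp_comul := TensorProduct.ext <| hom_ext fun m => hom_ext fun n => by
    change TensorProduct.map μ μ (Coalgebra.comul (R := 𝕜) (β m ⊗ₜ β n)) =
      Coalgebra.comul (R := 𝕜) (μ (β m ⊗ₜ β n))
    simp only [comul_β_tmul_β, map_sum, TensorProduct.map_tmul, μ_β, map_smul, comul_β]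
    -- Compatibility of `μ` with the coproducts is Vandermonde's identity.
    have hchoose : ∀ r ∈ Finset.HasAntidiagonal.antidiagonal (m + n), ((m + n).choose m : 𝕜) =
        ∑ p ∈ Finset.HasAntidiagonal.antidiagonal m,
          (r.1.choose p.1 : 𝕜) * (r.2.choose p.2 : 𝕜) := by
      intro r hr
      rw [← Finset.HasAntidiagonal.mem_antidiagonal.1 hr, Nat.add_choose_eq]
      push_cast
      rfl
    rw [Finset.smul_sum]
    have hsum : ∀ r ∈ Finset.HasAntidiagonal.antidiagonal (m + n),
        ((m + n).choose m : 𝕜) • β (𝕜 := 𝕜) r.1 ⊗ₜ[𝕜] β (𝕜 := 𝕜) r.2 =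
        ∑ p ∈ Finset.HasAntidiagonal.antidiagonal m,
          ((r.1.choose p.1 : 𝕜) * (r.2.choose p.2 : 𝕜)) •
            β (𝕜 := 𝕜) r.1 ⊗ₜ[𝕜] β (𝕜 := 𝕜) r.2 := fun r hr => by
      rw [hchoose r hr, Finset.sum_smul]
    refine Eq.trans ?_ (Finset.sum_comm.trans (Finset.sum_congr rfl hsum).symm)
    refine Finset.sum_congr rfl fun p hp => ?_
    obtain rfl := Finset.HasAntidiagonal.mem_antidiagonal.1 hp
    -- For fixed `p` the pairs `q` of sum `n` are translated by `p`. A pair outside the image has a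
    -- coordinate smaller than that of `p`, so one of its binomial coefficients vanishes.
    refine Finset.sum_of_injOn (fun q => (p.1 + q.1, p.2 + q.2)) ?_ ?_ ?_ ?_
    · rintro ⟨a, b⟩ - ⟨c, d⟩ - h
      simpa using h
    · rintro ⟨a, b⟩ h
      simp only [Finset.mem_coe, Finset.HasAntidiagonal.mem_antidiagonal] at h ⊢
      omega
    · rintro ⟨a, b⟩ h h'
      rw [Finset.HasAntidiagonal.mem_antidiagonal] at h
      have : a < p.1 ∨ b < p.2 := by
        by_contra! hab
        refine h' ⟨(a - p.1, b - p.2), ?_, ?_⟩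
        · simp only [Finset.mem_coe, Finset.HasAntidiagonal.mem_antidiagonal] at h ⊢
          omega
        · simp only [Prod.mk.injEq]
          omega
      rcases this with h | h <;> simp [Nat.choose_eq_zero_of_lt h]
    · rintro ⟨a, b⟩ -
      exact TensorProduct.smul_tmul_smul _ _ _ _

end AffineLine

/-! ### Points of the free module, formal sums and evaluations -/

namespace FormalHopf

variable {R : Type u} [CommRing R] {𝒜 : ℤ → AddSubgroup R}

namespace FreeModule

variable {𝕜 : Type} [CommRing 𝕜] {n : ℤ}

open Coalgebra

variable (𝕜) in
/-- The constant `[a]`, as a map of coalgebras. -/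
def constHom (n : ℤ) (a : 𝒜 n) : 𝕜 →ₗc[𝕜] FreeModule 𝕜 𝒜 n where
  __ := LinearMap.toSpanSingleton 𝕜 _ (of 𝕜 (.const n a))
  counit_comp := by ext; simp [counit_of, termCounit]
  map_comp_comul := by ext; simp [comul_of, termComul]

section Points

variable {C : Type*} [AddCommGroup C] [Module 𝕜 C] [Coalgebra 𝕜 C] [IsCocomm 𝕜 C]

/-- The sum of two points. -/
def ptAdd (n : ℤ) (f g : C →ₗc[𝕜] FreeModule 𝕜 𝒜 n) : C →ₗc[𝕜] FreeModule 𝕜 𝒜 n :=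
  (addHom 𝒜 𝕜 n).comp ((Coalgebra.TensorProduct.map f g).comp (comulCoalgHom 𝕜 C))

/-- The product of two points. -/
def ptMul (i j k : ℤ) (h : i + j = k) (f : C →ₗc[𝕜] FreeModule 𝕜 𝒜 i)
    (g : C →ₗc[𝕜] FreeModule 𝕜 𝒜 j) : C →ₗc[𝕜] FreeModule 𝕜 𝒜 k :=
  (mulHom 𝒜 𝕜 h).comp ((Coalgebra.TensorProduct.map f g).comp (comulCoalgHom 𝕜 C))

lemma ptAdd_apply (f g : C →ₗc[𝕜] FreeModule 𝕜 𝒜 n) (c : C) : ptAdd n f g c =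
    add 𝒜 𝕜 n (TensorProduct.map f.toLinearMap g.toLinearMap (comul (R := 𝕜) c)) := rfl

lemma ptMul_apply {i j k : ℤ} (h : i + j = k) (f : C →ₗc[𝕜] FreeModule 𝕜 𝒜 i)
    (g : C →ₗc[𝕜] FreeModule 𝕜 𝒜 j) (c : C) : ptMul i j k h f g c =
    mul 𝒜 𝕜 h (TensorProduct.map f.toLinearMap g.toLinearMap (comul (R := 𝕜) c)) := rfl

/-- The constant point `[a]`. -/
def ptConst (n : ℤ) (a : 𝒜 n) : C →ₗc[𝕜] FreeModule 𝕜 𝒜 n :=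
  (constHom 𝕜 n a).comp (counitCoalgHom 𝕜 C)

omit [IsCocomm 𝕜 C] in
lemma ptConst_apply (a : 𝒜 n) (c : C) :
    ptConst n a c = counit (R := 𝕜) c • of 𝕜 (Term.const n a) := rfl

/-- The powers of a point. -/
def ptPow [SetLike.GradedOne 𝒜] (f : C →ₗc[𝕜] FreeModule 𝕜 𝒜 1) :
    ∀ i : ℕ, C →ₗc[𝕜] FreeModule 𝕜 𝒜 i
  | 0 => ptConst 0 ⟨1, SetLike.GradedOne.one_mem⟩
  | i + 1 => ptMul i 1 (i + 1 : ℕ) (by push_cast; rfl) (ptPow f i) f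

/-- The sum of a finite list of points. -/
def ptSum (n : ℤ) (l : List (C →ₗc[𝕜] FreeModule 𝕜 𝒜 n)) : C →ₗc[𝕜] FreeModule 𝕜 𝒜 n :=
  l.foldr (ptAdd n) (ptConst n 0)

end Points

/-- The partial sum `∑_{i,j ≤ N} [a_{ij}] xⁱ yʲ` for the tautological curve. -/
def formalSum [SetLike.GradedOne 𝒜] (𝕜 : Type) [CommRing 𝕜] (F : FormalGroup R)
    (hF : F.IsGraded 𝒜) (N : ℕ) :
    AffineLine 𝕜 ⊗[𝕜] AffineLine 𝕜 →ₗc[𝕜] FreeModule 𝕜 𝒜 1 :=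
  ptSum 1 ((List.range (N + 1) ×ˢ List.range (N + 1)).map fun p =>
    ptMul (1 - p.1 - p.2) (p.1 + p.2) 1 (by ring)
      (ptConst (1 - p.1 - p.2) ⟨F.a p.1 p.2, hF p.1 p.2⟩)
      (ptMul p.1 p.2 (p.1 + p.2) rfl
        (ptPow ((curveHom 𝒜 𝕜).comp AffineLine.fstHom) p.1)
        (ptPow ((curveHom 𝒜 𝕜).comp AffineLine.sndHom) p.2)))

section Evaluation

variable (K : HopfRing 𝕜 𝒜) (φ : ∀ n, FreeModule 𝕜 𝒜 n →ₗ[𝕜] K.obj n)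
  {C : Type*} [AddCommGroup C] [Module 𝕜 C] [Coalgebra 𝕜 C] [IsCocomm 𝕜 C]

/-- A family of linear maps from the free modules to a Hopf ring that respects the operations. -/
structure IsEval : Prop where
  map_add : ∀ n x y, φ n (add 𝒜 𝕜 n (x ⊗ₜ y)) = K.add n (φ n x ⊗ₜ φ n y)
  map_mul : ∀ i j k (h : i + j = k) x y,
    φ k (mul 𝒜 𝕜 h (x ⊗ₜ y)) = K.mul i j k h (φ i x ⊗ₜ φ j y)
  map_const : ∀ n a, φ n (of 𝕜 (.const n a)) = K.const n a

variable {K φ} (hφ : IsEval K φ)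
include hφ

lemma IsEval.comp_ptAdd (f g : C →ₗc[𝕜] FreeModule 𝕜 𝒜 n) :
    φ n ∘ₗ (ptAdd n f g).toLinearMap =
      K.ptAdd n (φ n ∘ₗ f.toLinearMap) (φ n ∘ₗ g.toLinearMap) := by
  have h : φ n ∘ₗ add 𝒜 𝕜 n = K.add n ∘ₗ TensorProduct.map (φ n) (φ n) :=
    TensorProduct.ext' fun x y => by simp [hφ.map_add]
  rw [HopfRing.ptAdd, TensorProduct.map_comp, ← LinearMap.comp_assoc, ← LinearMap.comp_assoc, ← h]
  rfl

lemma IsEval.comp_ptMul (i j k : ℤ) (e : i + j = k) (f : C →ₗc[𝕜] FreeModule 𝕜 𝒜 i)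
    (g : C →ₗc[𝕜] FreeModule 𝕜 𝒜 j) : φ k ∘ₗ (ptMul i j k e f g).toLinearMap =
      K.ptMul i j k e (φ i ∘ₗ f.toLinearMap) (φ j ∘ₗ g.toLinearMap) := by
  have h : φ k ∘ₗ mul 𝒜 𝕜 e = K.mul i j k e ∘ₗ TensorProduct.map (φ i) (φ j) :=
    TensorProduct.ext' fun x y => by simp [hφ.map_mul]
  rw [HopfRing.ptMul, TensorProduct.map_comp, ← LinearMap.comp_assoc, ← LinearMap.comp_assoc, ← h]
  rfl

omit [IsCocomm 𝕜 C] in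
lemma IsEval.comp_ptConst (a : 𝒜 n) :
    φ n ∘ₗ (ptConst n a : C →ₗc[𝕜] _).toLinearMap = K.ptConst n a := by
  ext c
  change φ n (counit (R := 𝕜) c • of 𝕜 (.const n a)) = _
  rw [map_smul, hφ.map_const]
  rfl

lemma IsEval.comp_ptPow [SetLike.GradedOne 𝒜] (f : C →ₗc[𝕜] FreeModule 𝕜 𝒜 1) (i : ℕ) :
    φ i ∘ₗ (ptPow f i).toLinearMap = K.ptPow (φ 1 ∘ₗ f.toLinearMap) i := by
  induction i with
  | zero => exact hφ.comp_ptConst _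
  | succ i ih =>
    rw [HopfRing.ptPow, ← ih]
    exact hφ.comp_ptMul _ _ _ _ _ _

lemma IsEval.comp_ptSum (l : List (C →ₗc[𝕜] FreeModule 𝕜 𝒜 n)) :
    φ n ∘ₗ (ptSum n l).toLinearMap =
      K.ptSum n (l.map fun f : C →ₗc[𝕜] FreeModule 𝕜 𝒜 n => φ n ∘ₗ f.toLinearMap) := by
  induction l with
  | nil => exact hφ.comp_ptConst _
  | cons f l ih =>
    refine (hφ.comp_ptAdd f (ptSum n l)).trans ?_
    rw [ih]
    rfl

/-- The formal sum is built from the ring operations alone, so any family that respects them carries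
it along, without coalgebra conditions. This is used for the projection, to see that the
tautological curve is additive, and for evaluation, to see that the curve relation goes to zero. -/
lemma IsEval.comp_formalSum [SetLike.GradedOne 𝒜] (F : FormalGroup R) (hF : F.IsGraded 𝒜) (N : ℕ) :
    φ 1 ∘ₗ (formalSum 𝕜 F hF N).toLinearMap = K.formalSum F hF (φ 1 ∘ₗ curve 𝒜 𝕜) N := by
  rw [formalSum, hφ.comp_ptSum, HopfRing.formalSum, List.map_map]
  congr 2
  funext p
  simp only [Function.comp_apply]
  rw [hφ.comp_ptMul, hφ.comp_ptMul, hφ.comp_ptConst, hφ.comp_ptPow, hφ.comp_ptPow]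
  rfl

end Evaluation

/-! ### The weight grading of the free module -/

section Weight

variable (𝕜 𝒜 n) in
/-- The span of the terms of weight `w`. -/
def weightPart (w : ℕ) : Submodule 𝕜 (FreeModule 𝕜 𝒜 n) :=
  Submodule.span 𝕜 (of 𝕜 '' {t | t.weight = w})

lemma of_mem_weightPart (t : Term 𝒜 n) : of 𝕜 t ∈ weightPart 𝒜 𝕜 n t.weight :=
  Submodule.subset_span ⟨t, rfl, rfl⟩

lemma weightPart_le {w : ℕ} {P : Submodule 𝕜 (FreeModule 𝕜 𝒜 n)}
    (h : ∀ t : Term 𝒜 n, t.weight = w → of 𝕜 t ∈ P) : weightPart 𝒜 𝕜 n w ≤ P := by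
  rw [weightPart, Submodule.span_le]
  rintro _ ⟨t, ht, rfl⟩
  exact h t ht

lemma add_mem_weightPart {v w : ℕ} {x y : FreeModule 𝕜 𝒜 n} (hx : x ∈ weightPart 𝒜 𝕜 n v)
    (hy : y ∈ weightPart 𝒜 𝕜 n w) : add 𝒜 𝕜 n (x ⊗ₜ y) ∈ weightPart 𝒜 𝕜 n (v + w) := by
  have h : ∀ t : Term 𝒜 n, t.weight = w →
      weightPart 𝒜 𝕜 n v ≤ (weightPart 𝒜 𝕜 n (v + w)).comap
        (add 𝒜 𝕜 n ∘ₗ (TensorProduct.mk 𝕜 _ _).flip (of 𝕜 t)) := by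
    rintro t rfl
    refine weightPart_le ?_
    rintro s rfl
    rw [Submodule.mem_comap, LinearMap.comp_apply, LinearMap.flip_apply, TensorProduct.mk_apply,
      add_of]
    exact of_mem_weightPart (s.add t)
  have h' : weightPart 𝒜 𝕜 n w ≤ (weightPart 𝒜 𝕜 n (v + w)).comap
        (add 𝒜 𝕜 n ∘ₗ TensorProduct.mk 𝕜 _ _ x) := weightPart_le fun t ht => h t ht hx
  exact h' hy

lemma mul_mem_weightPart {i j k : ℤ} (e : i + j = k) {v w : ℕ} {x : FreeModule 𝕜 𝒜 i}
    {y : FreeModule 𝕜 𝒜 j} (hx : x ∈ weightPart 𝒜 𝕜 i v)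
    (hy : y ∈ weightPart 𝒜 𝕜 j w) : mul 𝒜 𝕜 e (x ⊗ₜ y) ∈ weightPart 𝒜 𝕜 k (v + w) := by
  have h : ∀ t : Term 𝒜 j, t.weight = w →
      weightPart 𝒜 𝕜 i v ≤ (weightPart 𝒜 𝕜 k (v + w)).comap
        (mul 𝒜 𝕜 e ∘ₗ (TensorProduct.mk 𝕜 _ _).flip (of 𝕜 t)) := by
    rintro t rfl
    refine weightPart_le ?_
    rintro s rfl
    rw [Submodule.mem_comap, LinearMap.comp_apply, LinearMap.flip_apply, TensorProduct.mk_apply,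
      mul_of]
    exact of_mem_weightPart (s.mul e t)
  have h' : weightPart 𝒜 𝕜 j w ≤ (weightPart 𝒜 𝕜 k (v + w)).comap
        (mul 𝒜 𝕜 e ∘ₗ TensorProduct.mk 𝕜 _ _ x) := weightPart_le fun t ht => h t ht hx
  exact h' hy

variable (𝕜 𝒜 n) in
/-- The tensors of total weight `w`. -/
def tensorWeightPart (w : ℕ) : Submodule 𝕜 (FreeModule 𝕜 𝒜 n ⊗[𝕜] FreeModule 𝕜 𝒜 n) :=
  Submodule.span 𝕜 {z | ∃ s t : Term 𝒜 n, s.weight + t.weight = w ∧ z = of 𝕜 s ⊗ₜ of 𝕜 t}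

lemma of_tmul_of_mem (s t : Term 𝒜 n) :
    of 𝕜 s ⊗ₜ of 𝕜 t ∈ tensorWeightPart 𝒜 𝕜 n (s.weight + t.weight) :=
  Submodule.subset_span ⟨s, t, rfl, rfl⟩

/-- The interchange only permutes four terms, and `op` adds weights, so total weights add. Stated
for a general `op` to cover sum and product together. -/
lemma map_map_comm_mem {i j k : ℤ} (m : FreeModule 𝕜 𝒜 i ⊗[𝕜] FreeModule 𝕜 𝒜 j →ₗ[𝕜]
    FreeModule 𝕜 𝒜 k) (op : Term 𝒜 i → Term 𝒜 j → Term 𝒜 k)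
    (hm : ∀ s t, m (of 𝕜 s ⊗ₜ of 𝕜 t) = of 𝕜 (op s t))
    (hop : ∀ s t, (op s t).weight = s.weight + t.weight) {v w : ℕ} {x y}
    (hx : x ∈ tensorWeightPart 𝒜 𝕜 i v) (hy : y ∈ tensorWeightPart 𝒜 𝕜 j w) :
    TensorProduct.map m m (TensorProduct.tensorTensorTensorComm 𝕜 _ _ _ _ (x ⊗ₜ y)) ∈
      tensorWeightPart 𝒜 𝕜 k (v + w) := by
  induction hx using Submodule.span_induction with
  | zero => simp
  | add a b _ _ ha hb =>
    simp only [TensorProduct.add_tmul, map_add]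
    exact add_mem ha hb
  | smul c a _ ha =>
    simp only [← TensorProduct.smul_tmul', map_smul]
    exact Submodule.smul_mem _ _ ha
  | mem z hz =>
    obtain ⟨s, t, rfl, rfl⟩ := hz
    induction hy using Submodule.span_induction with
    | zero => simp
    | add a b _ _ ha hb =>
      simp only [TensorProduct.tmul_add, map_add]
      exact add_mem ha hb
    | smul c a _ ha =>
      simp only [TensorProduct.tmul_smul, map_smul]
      exact Submodule.smul_mem _ _ ha
    | mem z hz =>
      obtain ⟨s', t', rfl, rfl⟩ := hz
      simp only [TensorProduct.tensorTensorTensorComm_tmul, TensorProduct.map_tmul, hm]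
      have := of_tmul_of_mem (𝕜 := 𝕜) (op s s') (op t t')
      rwa [hop, hop, add_add_add_comm] at this

/-- The coproduct preserves weight because it does so on constants and on `βᵢ`; this becomes the
degree condition on the coproduct of the quotient. -/
lemma termComul_mem (t : Term 𝒜 n) : termComul 𝕜 t ∈ tensorWeightPart 𝒜 𝕜 n t.weight := by
  induction t with
  | const n a =>
    rw [termComul]
    exact of_tmul_of_mem (.const n a) (.const n a)
  | curve i =>
    rw [termComul]
    refine sum_mem fun p hp => ?_
    obtain rfl := Finset.HasAntidiagonal.mem_antidiagonal.1 hp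
    exact of_tmul_of_mem (.curve p.1) (.curve p.2)
  | add s t hs ht =>
    rw [termComul]
    exact map_map_comm_mem _ Term.add add_of (fun _ _ => rfl) hs ht
  | mul h s t hs ht =>
    rw [termComul]
    exact map_map_comm_mem _ (Term.mul h) (mul_of h) (fun _ _ => rfl) hs ht

/-- A linear map from `𝔸²` is homogeneous if it preserves weights. -/
def IsHomogeneous (f : AffineLine 𝕜 ⊗[𝕜] AffineLine 𝕜 →ₗc[𝕜] FreeModule 𝕜 𝒜 n) : Prop :=
  ∀ a b : ℕ, f (AffineLine.β a ⊗ₜ AffineLine.β b) ∈ weightPart 𝒜 𝕜 n (a + b)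

lemma IsHomogeneous.ptAdd {f g : AffineLine 𝕜 ⊗[𝕜] AffineLine 𝕜 →ₗc[𝕜] FreeModule 𝕜 𝒜 n}
    (hf : IsHomogeneous f) (hg : IsHomogeneous g) : IsHomogeneous (ptAdd n f g) := by
  intro a b
  simp only [ptAdd_apply, AffineLine.comul_β_tmul_β, map_sum]
  refine sum_mem fun p hp => sum_mem fun q hq => ?_
  have := add_mem_weightPart (hf p.1 q.1) (hg p.2 q.2)
  rw [add_add_add_comm, Finset.HasAntidiagonal.mem_antidiagonal.1 hp,
    Finset.HasAntidiagonal.mem_antidiagonal.1 hq] at this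
  exact this

lemma IsHomogeneous.ptMul {i j k : ℤ} (e : i + j = k)
    {f : AffineLine 𝕜 ⊗[𝕜] AffineLine 𝕜 →ₗc[𝕜] FreeModule 𝕜 𝒜 i}
    {g : AffineLine 𝕜 ⊗[𝕜] AffineLine 𝕜 →ₗc[𝕜] FreeModule 𝕜 𝒜 j}
    (hf : IsHomogeneous f) (hg : IsHomogeneous g) : IsHomogeneous (ptMul i j k e f g) := by
  intro a b
  simp only [ptMul_apply, AffineLine.comul_β_tmul_β, map_sum]
  refine sum_mem fun p hp => sum_mem fun q hq => ?_
  have := mul_mem_weightPart e (hf p.1 q.1) (hg p.2 q.2)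
  rw [add_add_add_comm, Finset.HasAntidiagonal.mem_antidiagonal.1 hp,
    Finset.HasAntidiagonal.mem_antidiagonal.1 hq] at this
  exact this

lemma IsHomogeneous.ptConst (a : 𝒜 n) :
    IsHomogeneous (ptConst n a : _ →ₗc[𝕜] FreeModule 𝕜 𝒜 n) := by
  intro b c
  rw [ptConst_apply]
  rcases b with _ | b <;> rcases c with _ | c <;> simp [AffineLine.counit_β]
  exact of_mem_weightPart (.const n a)

lemma IsHomogeneous.ptPow [SetLike.GradedOne 𝒜]
    {f : AffineLine 𝕜 ⊗[𝕜] AffineLine 𝕜 →ₗc[𝕜] FreeModule 𝕜 𝒜 1}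
    (hf : IsHomogeneous f) (i : ℕ) : IsHomogeneous (ptPow f i) := by
  induction i with
  | zero => exact .ptConst _
  | succ i ih => exact .ptMul _ ih hf

lemma IsHomogeneous.ptSum
    (l : List (AffineLine 𝕜 ⊗[𝕜] AffineLine 𝕜 →ₗc[𝕜] FreeModule 𝕜 𝒜 n))
    (hl : ∀ f ∈ l, IsHomogeneous f) : IsHomogeneous (ptSum n l) := by
  induction l with
  | nil => exact .ptConst _
  | cons f l ih =>
    exact .ptAdd (hl f (by simp)) (ih fun g hg => hl g (by simp [hg]))

/-- Every summand preserves weight by itself: constants have weight zero, and each pullback of the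
curve along a projection is homogeneous since the counit kills `βᵢ` for `i > 0`. -/
lemma isHomogeneous_formalSum [SetLike.GradedOne 𝒜] (F : FormalGroup R) (hF : F.IsGraded 𝒜)
    (N : ℕ) : IsHomogeneous (formalSum 𝕜 F hF N) := by
  refine .ptSum _ fun f hf => ?_
  obtain ⟨p, -, rfl⟩ := List.mem_map.1 hf
  refine .ptMul _ (.ptConst _) (.ptMul _ (.ptPow ?_ _) (.ptPow ?_ _))
  · intro a b
    simp only [CoalgHom.coe_comp, Function.comp_apply, AffineLine.fstHom_tmul, curveHom_apply,
      map_smul, curve_β, AffineLine.counit_β]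
    split_ifs with h
    · subst h
      rw [one_smul]
      exact of_mem_weightPart (.curve a)
    · simp
  · intro a b
    simp only [CoalgHom.coe_comp, Function.comp_apply, AffineLine.sndHom_tmul, curveHom_apply,
      map_smul, curve_β, AffineLine.counit_β]
    split_ifs with h
    · subst h
      rw [one_smul, zero_add]
      exact of_mem_weightPart (.curve b)
    · simp

end Weight

end FreeModule

end FormalHopf

/-! ### Disappearance of Koszul signs in even degrees -/

section KoszulEven

open TensorProduct

variable {𝕜 : Type*} [CommRing 𝕜] {C D A B : Type*} [AddCommGroup C] [Module 𝕜 C]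
  [AddCommGroup D] [Module 𝕜 D] [AddCommGroup A] [Module 𝕜 A] [AddCommGroup B] [Module 𝕜 B]
  (deg : ℤ → Submodule 𝕜 C) [DirectSum.Decomposition deg]
  (deg' : ℤ → Submodule 𝕜 D) [DirectSum.Decomposition deg']

lemma oddProj_of_mem {i : ℤ} (hi : Even i) {x : C} (hx : x ∈ deg i) : oddProj deg x = 0 := by
  rw [oddProj, LinearMap.comp_apply, LinearEquiv.coe_coe, DirectSum.decomposeLinearEquiv_apply,
    DirectSum.decompose_of_mem deg hx, ← DirectSum.lof_eq_of 𝕜, DirectSum.toModule_lof,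
    if_neg (Int.not_odd_iff_even.2 hi), LinearMap.zero_apply]

variable {deg} in
-- One even factor removes the sign. The elementwise form serves targets that may have odd elements;
-- `koszulSwap_eq` serves the constructed object, which has none.
lemma koszulSwap_tmul {x : C} (hx : oddProj deg x = 0) (y : D) :
    koszulSwap deg deg' (x ⊗ₜ y) = y ⊗ₜ[𝕜] x := by
  simp [koszulSwap, hx]

lemma koszulSwap_eq (h : oddProj deg = 0) :
    koszulSwap deg deg' = (TensorProduct.comm 𝕜 C D).toLinearMap :=
  TensorProduct.ext' fun x y => koszulSwap_tmul deg' (by simp [h]) y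

variable {deg} in
lemma koszulInterchange_tmul (a : A) {x : C} (hx : oddProj deg x = 0) (y : D) (b : B) :
    koszulInterchange deg deg' A B ((a ⊗ₜ x) ⊗ₜ (y ⊗ₜ b)) = (a ⊗ₜ[𝕜] y) ⊗ₜ[𝕜] (x ⊗ₜ[𝕜] b) := by
  simp [koszulInterchange, hx]

lemma koszulInterchange_eq (h : oddProj deg = 0) :
    koszulInterchange deg deg' A B =
      (TensorProduct.tensorTensorTensorComm 𝕜 A C D B).toLinearMap := by
  rw [koszulInterchange, h, TensorProduct.map_zero_right, TensorProduct.map_zero_left, smul_zero]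
  exact LinearMap.ext fun z =>
    congrArg (TensorProduct.tensorTensorTensorComm 𝕜 A C D B) (sub_zero z)

end KoszulEven

/-! ### Symmetry, associator, unitor and interchange as coalgebra maps, for expressing both sides of
the relations -/

section CoalgHom

open TensorProduct Coalgebra

variable (𝕜 A B C D : Type*) [CommRing 𝕜] [AddCommGroup A] [AddCommGroup B] [AddCommGroup C]
  [AddCommGroup D] [Module 𝕜 A] [Module 𝕜 B] [Module 𝕜 C] [Module 𝕜 D] [Coalgebra 𝕜 A]
  [Coalgebra 𝕜 B] [Coalgebra 𝕜 C] [Coalgebra 𝕜 D]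

/-- The symmetry, as a map of coalgebras. -/
def commCoalgHom : A ⊗[𝕜] B →ₗc[𝕜] B ⊗[𝕜] A where
  __ := TensorProduct.comm 𝕜 A B
  counit_comp := by ext; simp [mul_comm]
  map_comp_comul := by
    ext x y
    simp only [AlgebraTensorModule.curry_apply, TensorProduct.curry_apply, LinearMap.comp_apply,
      LinearMap.restrictScalars_self, LinearEquiv.coe_coe, comul_tmul, comm_tmul,
      AlgebraTensorModule.tensorTensorTensorComm_eq]
    induction comul (R := 𝕜) x with
    | zero => simp
    | add u v hu hv => simp only [add_tmul, tmul_add, map_add, hu, hv]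
    | tmul a a' =>
      induction comul (R := 𝕜) y with
      | zero => simp
      | add u v hu hv => simp only [add_tmul, tmul_add, map_add, hu, hv]
      | tmul b b' => simp

/-- The associator, as a map of coalgebras. -/
def assocCoalgHom : (A ⊗[𝕜] B) ⊗[𝕜] C →ₗc[𝕜] A ⊗[𝕜] (B ⊗[𝕜] C) :=
  (Coalgebra.TensorProduct.assoc 𝕜 𝕜 A B C).toCoalgHom

/-- The left unitor, as a map of coalgebras. -/
def lidCoalgHom : 𝕜 ⊗[𝕜] A →ₗc[𝕜] A := (Coalgebra.TensorProduct.lid 𝕜 A).toCoalgHom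

/-- The interchange of the two middle factors, as a map of coalgebras. -/
def interchangeCoalgHom : (A ⊗[𝕜] B) ⊗[𝕜] (C ⊗[𝕜] D) →ₗc[𝕜] (A ⊗[𝕜] C) ⊗[𝕜] (B ⊗[𝕜] D) where
  __ := TensorProduct.tensorTensorTensorComm 𝕜 A B C D
  counit_comp := by ext; simp [mul_assoc, mul_left_comm, mul_comm]
  map_comp_comul := by
    ext x y z w
    simp only [AlgebraTensorModule.curry_apply, TensorProduct.curry_apply, LinearMap.comp_apply,
      LinearMap.restrictScalars_self, LinearEquiv.coe_coe, comul_tmul, tensorTensorTensorComm_tmul,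
      AlgebraTensorModule.tensorTensorTensorComm_eq]
    induction comul (R := 𝕜) x with
    | zero => simp
    | add u v hu hv => simp only [add_tmul, map_add, hu, hv]
    | tmul a a' =>
      induction comul (R := 𝕜) y with
      | zero => simp
      | add u v hu hv => simp only [add_tmul, tmul_add, map_add, hu, hv]
      | tmul b b' =>
        induction comul (R := 𝕜) z with
        | zero => simp
        | add u v hu hv => simp only [add_tmul, tmul_add, map_add, hu, hv]
        | tmul c c' =>
          induction comul (R := 𝕜) w with
          | zero => simp
          | add u v hu hv => simp only [tmul_add, map_add, hu, hv]
          | tmul d d' => simp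

end CoalgHom

/-! ### Generators and relations -/

namespace FormalHopf

open FreeModule Coalgebra

variable {R : Type u} [CommRing R] {𝒜 : ℤ → AddSubgroup R} {𝕜 : Type} [CommRing 𝕜]

/-- The right hand side `∑ (s' ∘ t) * (s'' ∘ r)` of the distributive law. -/
def distribHom {i j k : ℤ} (h : i + j = k) : FreeModule 𝕜 𝒜 i ⊗[𝕜]
    (FreeModule 𝕜 𝒜 j ⊗[𝕜] FreeModule 𝕜 𝒜 j) →ₗc[𝕜] FreeModule 𝕜 𝒜 k :=
  (addHom 𝒜 𝕜 k).comp <| (Coalgebra.TensorProduct.map (mulHom 𝒜 𝕜 h) (mulHom 𝒜 𝕜 h)).comp <|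
    (interchangeCoalgHom 𝕜 _ _ _ _).comp <|
      Coalgebra.TensorProduct.map (comulCoalgHom 𝕜 _) (CoalgHom.id 𝕜 _)

lemma distribHom_tmul {i j k : ℤ} (h : i + j = k) (x : FreeModule 𝕜 𝒜 i)
    (y : FreeModule 𝕜 𝒜 j ⊗[𝕜] FreeModule 𝕜 𝒜 j) : distribHom h (x ⊗ₜ y) =
      add 𝒜 𝕜 k (TensorProduct.map (mul 𝒜 𝕜 h) (mul 𝒜 𝕜 h)
        (TensorProduct.tensorTensorTensorComm 𝕜 _ _ _ _ (comul (R := 𝕜) x ⊗ₜ y))) := rfl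

variable [SetLike.GradedOne 𝒜] (F : FormalGroup R) (hF : F.IsGraded 𝒜)

variable (𝕜) in
/-- The defining relations of the Ravenel-Wilson Hopf ring. -/
inductive Rel : ∀ {n : ℤ}, FreeModule 𝕜 𝒜 n → Prop
  | add_assoc {n : ℤ} (s t r : Term 𝒜 n) :
    Rel (add 𝒜 𝕜 n (add 𝒜 𝕜 n (of 𝕜 s ⊗ₜ of 𝕜 t) ⊗ₜ of 𝕜 r) -
      add 𝒜 𝕜 n (of 𝕜 s ⊗ₜ add 𝒜 𝕜 n (of 𝕜 t ⊗ₜ of 𝕜 r)))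
  | add_comm {n : ℤ} (s t : Term 𝒜 n) :
    Rel (add 𝒜 𝕜 n (of 𝕜 s ⊗ₜ of 𝕜 t) - add 𝒜 𝕜 n (of 𝕜 t ⊗ₜ of 𝕜 s))
  | zero_add {n : ℤ} (t : Term 𝒜 n) :
    Rel (add 𝒜 𝕜 n (of 𝕜 (.const n 0) ⊗ₜ of 𝕜 t) - of 𝕜 t)
  | mul_assoc {i j k ij jk l : ℤ} (h₁ : i + j = ij) (h₂ : ij + k = l) (h₃ : j + k = jk)
    (h₄ : i + jk = l) (s : Term 𝒜 i) (t : Term 𝒜 j) (r : Term 𝒜 k) :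
    Rel (mul 𝒜 𝕜 h₂ (mul 𝒜 𝕜 h₁ (of 𝕜 s ⊗ₜ of 𝕜 t) ⊗ₜ of 𝕜 r) -
      mul 𝒜 𝕜 h₄ (of 𝕜 s ⊗ₜ mul 𝒜 𝕜 h₃ (of 𝕜 t ⊗ₜ of 𝕜 r)))
  | mul_comm {i j k : ℤ} (h : i + j = k) (h' : j + i = k) (s : Term 𝒜 i) (t : Term 𝒜 j) :
    Rel (mul 𝒜 𝕜 h (of 𝕜 s ⊗ₜ of 𝕜 t) - mul 𝒜 𝕜 h' (of 𝕜 t ⊗ₜ of 𝕜 s))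
  | one_mul (e : 𝒜 0) (he : (e : R) = 1) {n : ℤ} (h : 0 + n = n) (t : Term 𝒜 n) :
    Rel (mul 𝒜 𝕜 h (of 𝕜 (.const 0 e) ⊗ₜ of 𝕜 t) - of 𝕜 t)
  | zero_mul {i j k : ℤ} (h : i + j = k) (t : Term 𝒜 j) :
    Rel (mul 𝒜 𝕜 h (of 𝕜 (.const i 0) ⊗ₜ of 𝕜 t) -
      counit (R := 𝕜) (of 𝕜 t) • of 𝕜 (.const k 0))
  | mul_add {i j k : ℤ} (h : i + j = k) (s : Term 𝒜 i) (t r : Term 𝒜 j) :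
    Rel (mul 𝒜 𝕜 h (of 𝕜 s ⊗ₜ add 𝒜 𝕜 j (of 𝕜 t ⊗ₜ of 𝕜 r)) -
      distribHom h (of 𝕜 s ⊗ₜ (of 𝕜 t ⊗ₜ of 𝕜 r)))
  | const_add {n : ℤ} (a b : 𝒜 n) :
    Rel (of 𝕜 (.const n (a + b)) - add 𝒜 𝕜 n (of 𝕜 (.const n a) ⊗ₜ of 𝕜 (.const n b)))
  | const_mul {i j k : ℤ} (h : i + j = k) (a : 𝒜 i) (b : 𝒜 j) (c : 𝒜 k) (hc : (c : R) = a * b) :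
    Rel (of 𝕜 (.const k c) - mul 𝒜 𝕜 h (of 𝕜 (.const i a) ⊗ₜ of 𝕜 (.const j b)))
  | curve_zero : Rel (of 𝕜 (.curve 0) - of 𝕜 (.const 1 0))
  -- Imposed for every admissible cutoff `N`, as in the definition of an additive curve.
  | curve_μ (m n N : ℕ) (hm : m ≤ N) (hn : n ≤ N) :
    Rel (curve 𝒜 𝕜 (AffineLine.μ (AffineLine.β m ⊗ₜ AffineLine.β n)) -
      formalSum 𝕜 F hF N (AffineLine.β m ⊗ₜ AffineLine.β n))
  -- The last four constructors close the relations under sum and product with a term on either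
  -- side. By bilinearity this suffices for both operations to descend to the quotient.
  | add_right {n : ℤ} {z : FreeModule 𝕜 𝒜 n} (hz : Rel z) (t : Term 𝒜 n) :
    Rel (add 𝒜 𝕜 n (z ⊗ₜ of 𝕜 t))
  | add_left {n : ℤ} (t : Term 𝒜 n) {z : FreeModule 𝕜 𝒜 n} (hz : Rel z) :
    Rel (add 𝒜 𝕜 n (of 𝕜 t ⊗ₜ z))
  | mul_right {i j k : ℤ} (h : i + j = k) {z : FreeModule 𝕜 𝒜 i} (hz : Rel z) (t : Term 𝒜 j) :
    Rel (mul 𝒜 𝕜 h (z ⊗ₜ of 𝕜 t))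
  | mul_left {i j k : ℤ} (h : i + j = k) (t : Term 𝒜 i) {z : FreeModule 𝕜 𝒜 j} (hz : Rel z) :
    Rel (mul 𝒜 𝕜 h (of 𝕜 t ⊗ₜ z))

variable (𝕜) in
/-- The span of the relations. -/
def ideal (n : ℤ) : Submodule 𝕜 (FreeModule 𝕜 𝒜 n) := Submodule.span 𝕜 {z | Rel 𝕜 F hF z}

variable {F hF}

lemma Rel.mem_ideal {n : ℤ} {z : FreeModule 𝕜 𝒜 n} (h : Rel 𝕜 F hF z) : z ∈ ideal 𝕜 F hF n :=
  Submodule.subset_span h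

/-- Stability of relations under terms extends bilinearly, as the relations span the first factor
and the terms the second. -/
lemma map_tmul_mem_ideal {i j k : ℤ}
    (m : FreeModule 𝕜 𝒜 i ⊗[𝕜] FreeModule 𝕜 𝒜 j →ₗ[𝕜] FreeModule 𝕜 𝒜 k)
    (hm : ∀ (z : FreeModule 𝕜 𝒜 i) (t : Term 𝒜 j), Rel 𝕜 F hF z → Rel 𝕜 F hF (m (z ⊗ₜ of 𝕜 t)))
    {z : FreeModule 𝕜 𝒜 i} (hz : z ∈ ideal 𝕜 F hF i) (y : FreeModule 𝕜 𝒜 j) :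
    m (z ⊗ₜ y) ∈ ideal 𝕜 F hF k := by
  have h : ideal 𝕜 F hF i ≤ LinearMap.ker
      ((TensorProduct.curry m).compr₂ (ideal 𝕜 F hF k).mkQ) := by
    rw [ideal, Submodule.span_le]
    intro w hw
    rw [SetLike.mem_coe, LinearMap.mem_ker]
    refine hom_ext fun t => ?_
    simpa using (hm w t hw).mem_ideal
  simpa using LinearMap.congr_fun (h hz) y

lemma add_tmul_mem_ideal {n : ℤ} {z : FreeModule 𝕜 𝒜 n} (hz : z ∈ ideal 𝕜 F hF n)
    (y : FreeModule 𝕜 𝒜 n) : add 𝒜 𝕜 n (z ⊗ₜ y) ∈ ideal 𝕜 F hF n :=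
  map_tmul_mem_ideal _ (fun _ t h => h.add_right t) hz y

lemma add_tmul_mem_ideal' {n : ℤ} (y : FreeModule 𝕜 𝒜 n) {z : FreeModule 𝕜 𝒜 n}
    (hz : z ∈ ideal 𝕜 F hF n) : add 𝒜 𝕜 n (y ⊗ₜ z) ∈ ideal 𝕜 F hF n :=
  map_tmul_mem_ideal (add 𝒜 𝕜 n ∘ₗ (TensorProduct.comm 𝕜 _ _).toLinearMap)
    (fun _ t h => h.add_left t) hz y

lemma mul_tmul_mem_ideal {i j k : ℤ} (h : i + j = k) {z : FreeModule 𝕜 𝒜 i}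
    (hz : z ∈ ideal 𝕜 F hF i) (y : FreeModule 𝕜 𝒜 j) :
    mul 𝒜 𝕜 h (z ⊗ₜ y) ∈ ideal 𝕜 F hF k :=
  map_tmul_mem_ideal _ (fun _ t hz => hz.mul_right h t) hz y

lemma mul_tmul_mem_ideal' {i j k : ℤ} (h : i + j = k) (y : FreeModule 𝕜 𝒜 i)
    {z : FreeModule 𝕜 𝒜 j} (hz : z ∈ ideal 𝕜 F hF j) :
    mul 𝒜 𝕜 h (y ⊗ₜ z) ∈ ideal 𝕜 F hF k :=
  map_tmul_mem_ideal (mul 𝒜 𝕜 h ∘ₗ (TensorProduct.comm 𝕜 _ _).toLinearMap)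
    (fun _ t hz => hz.mul_left h t) hz y

variable (𝕜 F hF) in
/-- The components of the Ravenel-Wilson Hopf ring. -/
abbrev Carrier (n : ℤ) : Type u := FreeModule 𝕜 𝒜 n ⧸ ideal 𝕜 F hF n

variable (𝕜 F hF) in
/-- The projection from the free module. -/
abbrev proj (n : ℤ) : FreeModule 𝕜 𝒜 n →ₗ[𝕜] Carrier 𝕜 F hF n := (ideal 𝕜 F hF n).mkQ

lemma proj_surjective (n : ℤ) : Function.Surjective (proj 𝕜 F hF n) := Submodule.mkQ_surjective _

lemma Rel.proj_eq {n : ℤ} {x y : FreeModule 𝕜 𝒜 n} (h : Rel 𝕜 F hF (x - y)) :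
    proj 𝕜 F hF n x = proj 𝕜 F hF n y :=
  (Submodule.Quotient.eq _).2 h.mem_ideal

/-- Terms span the quotient, so the axioms there can be checked on terms, where they are the
relations. -/
lemma carrier_ext {n : ℤ} {M : Type*} [AddCommGroup M] [Module 𝕜 M]
    {f g : Carrier 𝕜 F hF n →ₗ[𝕜] M}
    (h : ∀ t, f (proj 𝕜 F hF n (of 𝕜 t)) = g (proj 𝕜 F hF n (of 𝕜 t))) : f = g :=
  Submodule.linearMap_qext _ (hom_ext h)

variable (𝕜 F hF) in
/-- Addition. -/
def carrierAdd (n : ℤ) : Carrier 𝕜 F hF n ⊗[𝕜] Carrier 𝕜 F hF n →ₗ[𝕜] Carrier 𝕜 F hF n :=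
  TensorProduct.lift <| LinearMap.liftQ₂ _ _
    ((TensorProduct.curry (add 𝒜 𝕜 n)).compr₂ (proj 𝕜 F hF n))
    (fun z hz => LinearMap.ext fun y => by simpa using add_tmul_mem_ideal hz y)
    (fun z hz => LinearMap.ext fun y => by simpa using add_tmul_mem_ideal' y hz)

variable (𝕜 F hF) in
/-- Multiplication. -/
def carrierMul {i j k : ℤ} (h : i + j = k) :
    Carrier 𝕜 F hF i ⊗[𝕜] Carrier 𝕜 F hF j →ₗ[𝕜] Carrier 𝕜 F hF k :=
  TensorProduct.lift <| LinearMap.liftQ₂ _ _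
    ((TensorProduct.curry (mul 𝒜 𝕜 h)).compr₂ (proj 𝕜 F hF k))
    (fun z hz => LinearMap.ext fun y => by simpa using mul_tmul_mem_ideal h hz y)
    (fun z hz => LinearMap.ext fun y => by simpa using mul_tmul_mem_ideal' h y hz)

/-! #### The relations span coideals -/

variable (𝕜 F hF) in
/-- The coideal condition for a single element. -/
def IsCoidealElem {n : ℤ} (z : FreeModule 𝕜 𝒜 n) : Prop :=
  counit (R := 𝕜) z = 0 ∧
    TensorProduct.map (proj 𝕜 F hF n) (proj 𝕜 F hF n) (comul (R := 𝕜) z) = 0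

/-- With `p` the projection, `(p ⊗ p) Δ (f c) = (p f ⊗ p f) Δ c`, which depends on `f` only through
`p f`. Thus a law that holds identically in the quotient between two coalgebra maps contributes
coideal elements. -/
lemma isCoidealElem_sub {n : ℤ} {C : Type*} [AddCommGroup C] [Module 𝕜 C] [Coalgebra 𝕜 C]
    (f g : C →ₗc[𝕜] FreeModule 𝕜 𝒜 n)
    (h : proj 𝕜 F hF n ∘ₗ f.toLinearMap = proj 𝕜 F hF n ∘ₗ g.toLinearMap) (c : C) :
    IsCoidealElem 𝕜 F hF (f c - g c) := by
  constructor
  · rw [map_sub, CoalgHomClass.counit_comp_apply, CoalgHomClass.counit_comp_apply, sub_self]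
  · rw [map_sub, map_sub, ← CoalgHomClass.map_comp_comul_apply,
      ← CoalgHomClass.map_comp_comul_apply, sub_eq_zero]
    have := congr(TensorProduct.map $h $h (comul (R := 𝕜) c))
    rwa [TensorProduct.map_comp, TensorProduct.map_comp] at this

lemma isCoidealElem_of_groupLike {n : ℤ} {x y : FreeModule 𝕜 𝒜 n}
    (hx : counit (R := 𝕜) x = 1) (hx' : comul (R := 𝕜) x = x ⊗ₜ x)
    (hy : counit (R := 𝕜) y = 1) (hy' : comul (R := 𝕜) y = y ⊗ₜ y) (h : Rel 𝕜 F hF (x - y)) :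
    IsCoidealElem 𝕜 F hF (x - y) := by
  constructor
  · rw [map_sub, hx, hy, sub_self]
  · rw [map_sub, map_sub, hx', hy', TensorProduct.map_tmul, TensorProduct.map_tmul, h.proj_eq,
      sub_self]

lemma map_map_proj {i j k : ℤ}
    (m : FreeModule 𝕜 𝒜 i ⊗[𝕜] FreeModule 𝕜 𝒜 j →ₗc[𝕜] FreeModule 𝕜 𝒜 k)
    (mQ : Carrier 𝕜 F hF i ⊗[𝕜] Carrier 𝕜 F hF j →ₗ[𝕜] Carrier 𝕜 F hF k)
    (hm : ∀ x y, mQ (proj 𝕜 F hF i x ⊗ₜ proj 𝕜 F hF j y) = proj 𝕜 F hF k (m (x ⊗ₜ y)))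
    (u : FreeModule 𝕜 𝒜 i ⊗[𝕜] FreeModule 𝕜 𝒜 i) (v : FreeModule 𝕜 𝒜 j ⊗[𝕜] FreeModule 𝕜 𝒜 j) :
    TensorProduct.map (proj 𝕜 F hF k) (proj 𝕜 F hF k)
        (TensorProduct.map (m : _ →ₗ[𝕜] _) (m : _ →ₗ[𝕜] _)
          (TensorProduct.tensorTensorTensorComm 𝕜 _ _ _ _ (u ⊗ₜ v))) =
        TensorProduct.map mQ mQ (TensorProduct.tensorTensorTensorComm 𝕜 _ _ _ _
          (TensorProduct.map (proj 𝕜 F hF i) (proj 𝕜 F hF i) u ⊗ₜ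
            TensorProduct.map (proj 𝕜 F hF j) (proj 𝕜 F hF j) v)) := by
  induction u with
  | zero => simp
  | add u₁ u₂ h₁ h₂ => simp only [TensorProduct.add_tmul, map_add, h₁, h₂]
  | tmul a a' =>
    induction v with
    | zero => simp
    | add u₁ u₂ h₁ h₂ => simp only [TensorProduct.tmul_add, map_add, h₁, h₂]
    | tmul b b' =>
      simp only [TensorProduct.tensorTensorTensorComm_tmul, TensorProduct.map_tmul, hm]
      rfl

/-- The projected coproduct of `m (z ⊗ y)` is obtained from the projected coproducts of `z` and `y`
(`map_map_proj`), and the first of these is zero. This handles the closure constructors of `Rel`. -/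
lemma IsCoidealElem.map_tmul {i j k : ℤ}
    (m : FreeModule 𝕜 𝒜 i ⊗[𝕜] FreeModule 𝕜 𝒜 j →ₗc[𝕜] FreeModule 𝕜 𝒜 k)
    (mQ : Carrier 𝕜 F hF i ⊗[𝕜] Carrier 𝕜 F hF j →ₗ[𝕜] Carrier 𝕜 F hF k)
    (hm : ∀ x y, mQ (proj 𝕜 F hF i x ⊗ₜ proj 𝕜 F hF j y) = proj 𝕜 F hF k (m (x ⊗ₜ y)))
    {z : FreeModule 𝕜 𝒜 i} (hz : IsCoidealElem 𝕜 F hF z) (y : FreeModule 𝕜 𝒜 j) :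
    IsCoidealElem 𝕜 F hF (m (z ⊗ₜ y)) := by
  constructor
  · rw [CoalgHomClass.counit_comp_apply, TensorProduct.counit_tmul, hz.1, smul_zero]
  · rw [← CoalgHomClass.map_comp_comul_apply, TensorProduct.comul_tmul,
      TensorProduct.AlgebraTensorModule.tensorTensorTensorComm_eq]
    rw [map_map_proj m mQ hm, hz.2, TensorProduct.zero_tmul, map_zero, map_zero]

omit [SetLike.GradedOne 𝒜] in
lemma counit_const {n : ℤ} (a : 𝒜 n) : counit (R := 𝕜) (of 𝕜 (.const n a)) = 1 := by
  rw [counit_of, termCounit]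

omit [SetLike.GradedOne 𝒜] in
lemma comul_const {n : ℤ} (a : 𝒜 n) : comul (R := 𝕜) (of 𝕜 (.const n a)) =
    of 𝕜 (.const n a) ⊗ₜ of 𝕜 (.const n a) := by
  rw [comul_of, termComul]

/-- The algebraic laws are differences of coalgebra maps that agree in the quotient, since the same
law is imposed on all terms. The laws for constants and for `β₀` compare group-like elements. -/
lemma Rel.isCoidealElem {n : ℤ} {z : FreeModule 𝕜 𝒜 n} (h : Rel 𝕜 F hF z) :
    IsCoidealElem 𝕜 F hF z := by
  induction h with
  | @add_assoc n s t r =>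
    exact isCoidealElem_sub
      ((addHom 𝒜 𝕜 n).comp (Coalgebra.TensorProduct.map (addHom 𝒜 𝕜 n) (CoalgHom.id 𝕜 _)))
      ((addHom 𝒜 𝕜 n).comp ((Coalgebra.TensorProduct.map (CoalgHom.id 𝕜 _) (addHom 𝒜 𝕜 n)).comp
        (assocCoalgHom 𝕜 _ _ _)))
      (TensorProduct.ext <| TensorProduct.ext <| hom_ext fun s => hom_ext fun t => hom_ext fun r =>
        (Rel.add_assoc s t r).proj_eq) ((of 𝕜 s ⊗ₜ of 𝕜 t) ⊗ₜ of 𝕜 r)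
  | @add_comm n s t =>
    exact isCoidealElem_sub (addHom 𝒜 𝕜 n) ((addHom 𝒜 𝕜 n).comp (commCoalgHom 𝕜 _ _))
      (TensorProduct.ext <| hom_ext fun s => hom_ext fun t => (Rel.add_comm s t).proj_eq)
      (of 𝕜 s ⊗ₜ of 𝕜 t)
  | @zero_add n t =>
    -- The constant enters as a coalgebra map from the unit `𝕜`, so both sides are coalgebra maps on
    -- `𝕜 ⊗ _`, taken at `1 ⊗ t`.
    have := isCoidealElem_sub (F := F) (hF := hF)
      ((addHom 𝒜 𝕜 n).comp (Coalgebra.TensorProduct.map (constHom 𝕜 n 0) (CoalgHom.id 𝕜 _)))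
      (lidCoalgHom 𝕜 _) (TensorProduct.ext <| LinearMap.ext_ring <| hom_ext fun t => by
        change proj 𝕜 F hF n (add 𝒜 𝕜 n (((1 : 𝕜) • of 𝕜 (.const n 0)) ⊗ₜ of 𝕜 t)) =
          proj 𝕜 F hF n ((1 : 𝕜) • of 𝕜 t)
        rw [one_smul, one_smul]
        exact (Rel.zero_add t).proj_eq) (1 ⊗ₜ of 𝕜 t)
    change IsCoidealElem 𝕜 F hF (add 𝒜 𝕜 n (((1 : 𝕜) • of 𝕜 (.const n 0)) ⊗ₜ of 𝕜 t) -
      (1 : 𝕜) • of 𝕜 t) at this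
    rwa [one_smul, one_smul] at this
  | @mul_assoc i j k ij jk l h₁ h₂ h₃ h₄ s t r =>
    exact isCoidealElem_sub
      ((mulHom 𝒜 𝕜 h₂).comp (Coalgebra.TensorProduct.map (mulHom 𝒜 𝕜 h₁) (CoalgHom.id 𝕜 _)))
      ((mulHom 𝒜 𝕜 h₄).comp ((Coalgebra.TensorProduct.map (CoalgHom.id 𝕜 _) (mulHom 𝒜 𝕜 h₃)).comp
        (assocCoalgHom 𝕜 _ _ _)))
      (TensorProduct.ext <| TensorProduct.ext <| hom_ext fun s => hom_ext fun t => hom_ext fun r =>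
        (Rel.mul_assoc h₁ h₂ h₃ h₄ s t r).proj_eq) ((of 𝕜 s ⊗ₜ of 𝕜 t) ⊗ₜ of 𝕜 r)
  | @mul_comm i j k h h' s t =>
    exact isCoidealElem_sub (mulHom 𝒜 𝕜 h) ((mulHom 𝒜 𝕜 h').comp (commCoalgHom 𝕜 _ _))
      (TensorProduct.ext <| hom_ext fun s => hom_ext fun t => (Rel.mul_comm h h' s t).proj_eq)
      (of 𝕜 s ⊗ₜ of 𝕜 t)
  | @one_mul e he n h t =>
    have := isCoidealElem_sub (F := F) (hF := hF)
      ((mulHom 𝒜 𝕜 h).comp (Coalgebra.TensorProduct.map (constHom 𝕜 0 e) (CoalgHom.id 𝕜 _)))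
      (lidCoalgHom 𝕜 _) (TensorProduct.ext <| LinearMap.ext_ring <| hom_ext fun t => by
        change proj 𝕜 F hF n (mul 𝒜 𝕜 h (((1 : 𝕜) • of 𝕜 (.const 0 e)) ⊗ₜ of 𝕜 t)) =
          proj 𝕜 F hF n ((1 : 𝕜) • of 𝕜 t)
        rw [one_smul, one_smul]
        exact (Rel.one_mul e he h t).proj_eq) (1 ⊗ₜ of 𝕜 t)
    change IsCoidealElem 𝕜 F hF (mul 𝒜 𝕜 h (((1 : 𝕜) • of 𝕜 (.const 0 e)) ⊗ₜ of 𝕜 t) -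
      (1 : 𝕜) • of 𝕜 t) at this
    rwa [one_smul, one_smul] at this
  | @zero_mul i j k h t =>
    have := isCoidealElem_sub (F := F) (hF := hF)
      ((mulHom 𝒜 𝕜 h).comp (Coalgebra.TensorProduct.map (constHom 𝕜 i 0) (CoalgHom.id 𝕜 _)))
      ((ptConst k 0).comp (lidCoalgHom 𝕜 _))
      (TensorProduct.ext <| LinearMap.ext_ring <| hom_ext fun t => by
        change proj 𝕜 F hF k (mul 𝒜 𝕜 h (((1 : 𝕜) • of 𝕜 (.const i 0)) ⊗ₜ of 𝕜 t)) =
          proj 𝕜 F hF k (counit (R := 𝕜) ((1 : 𝕜) • of 𝕜 t) • of 𝕜 (.const k 0))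
        rw [one_smul, one_smul]
        exact (Rel.zero_mul h t).proj_eq) (1 ⊗ₜ of 𝕜 t)
    change IsCoidealElem 𝕜 F hF (mul 𝒜 𝕜 h (((1 : 𝕜) • of 𝕜 (.const i 0)) ⊗ₜ of 𝕜 t) -
      counit (R := 𝕜) ((1 : 𝕜) • of 𝕜 t) • of 𝕜 (.const k 0)) at this
    rwa [one_smul, one_smul] at this
  | @mul_add i j k h s t r =>
    exact isCoidealElem_sub
      ((mulHom 𝒜 𝕜 h).comp (Coalgebra.TensorProduct.map (CoalgHom.id 𝕜 _) (addHom 𝒜 𝕜 j)))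
      (distribHom h)
      (TensorProduct.ext <| hom_ext fun s => TensorProduct.ext <| hom_ext fun t => hom_ext fun r =>
        (Rel.mul_add h s t r).proj_eq) (of 𝕜 s ⊗ₜ (of 𝕜 t ⊗ₜ of 𝕜 r))
  | const_add a b =>
    refine isCoidealElem_of_groupLike (counit_const _) (comul_const _) ?_ ?_ (.const_add a b)
    · rw [FreeModule.counit_add, TensorProduct.counit_tmul, counit_const, counit_const, one_smul]
    · rw [FreeModule.comul_add, TensorProduct.comul_tmul, comul_const, comul_const]
      rfl
  | const_mul h a b c hc =>
    refine isCoidealElem_of_groupLike (counit_const _) (comul_const _) ?_ ?_ (.const_mul h a b c hc)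
    · rw [FreeModule.counit_mul, TensorProduct.counit_tmul, counit_const, counit_const, one_smul]
    · rw [FreeModule.comul_mul, TensorProduct.comul_tmul, comul_const, comul_const]
      rfl
  | curve_zero =>
    refine isCoidealElem_of_groupLike ?_ ?_ (counit_const _) (comul_const _) .curve_zero
    · rw [counit_of, termCounit, if_pos rfl]
    · rw [comul_of, termComul, Finset.HasAntidiagonal.antidiagonal_zero, Finset.sum_singleton]
  | curve_μ m n N hm hn =>
    set f := (curveHom 𝒜 𝕜).comp AffineLine.μHom
    set g := formalSum 𝕜 F hF N
    -- For fixed `N` agreement in the quotient is available only up to index `N`, so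
    -- `isCoidealElem_sub` does not apply. It is enough because the coproduct of `βₘ ⊗ βₙ` involves
    -- no index above `m` or `n`.
    have h : ∀ m n : ℕ, m ≤ N → n ≤ N →
        proj 𝕜 F hF 1 (f (AffineLine.β m ⊗ₜ AffineLine.β n)) =
        proj 𝕜 F hF 1 (g (AffineLine.β m ⊗ₜ AffineLine.β n)) :=
      fun m n hm hn => (Rel.curve_μ m n N hm hn).proj_eq
    change IsCoidealElem 𝕜 F hF
      (f (AffineLine.β m ⊗ₜ AffineLine.β n) - g (AffineLine.β m ⊗ₜ AffineLine.β n))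
    constructor
    · rw [map_sub, CoalgHomClass.counit_comp_apply, CoalgHomClass.counit_comp_apply, sub_self]
    · rw [map_sub, map_sub, ← CoalgHomClass.map_comp_comul_apply,
        ← CoalgHomClass.map_comp_comul_apply, sub_eq_zero, AffineLine.comul_β_tmul_β]
      simp only [map_sum]
      refine Finset.sum_congr rfl fun p hp => Finset.sum_congr rfl fun q hq => ?_
      rw [Finset.HasAntidiagonal.mem_antidiagonal] at hp hq
      exact congr_arg₂ (· ⊗ₜ[𝕜] ·) (h _ _ (by omega) (by omega)) (h _ _ (by omega) (by omega))
  | add_right hz t ih => exact ih.map_tmul (addHom 𝒜 𝕜 _) (carrierAdd 𝕜 F hF _) (fun _ _ => rfl) _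
  | add_left t hz ih =>
    -- The left-handed closure is the right-handed one for the operation with its arguments
    -- exchanged.
    exact ih.map_tmul ((addHom 𝒜 𝕜 _).comp (commCoalgHom 𝕜 _ _))
      (carrierAdd 𝕜 F hF _ ∘ₗ (TensorProduct.comm 𝕜 _ _).toLinearMap) (fun _ _ => rfl) _
  | mul_right h hz t ih =>
    exact ih.map_tmul (mulHom 𝒜 𝕜 h) (carrierMul 𝕜 F hF h) (fun _ _ => rfl) _
  | mul_left h t hz ih =>
    exact ih.map_tmul ((mulHom 𝒜 𝕜 h).comp (commCoalgHom 𝕜 _ _))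
      (carrierMul 𝕜 F hF h ∘ₗ (TensorProduct.comm 𝕜 _ _).toLinearMap) (fun _ _ => rfl) _

end FormalHopf

section Quotient

variable {𝕜 M N : Type*} [CommRing 𝕜] [AddCommGroup M] [Module 𝕜 M] [AddCommMonoid N] [Module 𝕜 N]

/-- `Submodule.liftQ` for a target that is not given as a group. -/
def quotientLift (I : Submodule 𝕜 M) (f : M →ₗ[𝕜] N) (h : I ≤ LinearMap.ker f) : M ⧸ I →ₗ[𝕜] N :=
  let _ : AddCommGroup N := Module.addCommMonoidToAddCommGroup 𝕜
  I.liftQ f h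

lemma quotientLift_mkQ (I : Submodule 𝕜 M) (f : M →ₗ[𝕜] N) (h : I ≤ LinearMap.ker f) (x : M) :
    quotientLift I f h (I.mkQ x) = f x := rfl

end Quotient

/-! ### The quotient coalgebra -/

namespace FormalHopf

open FreeModule Coalgebra

variable {R : Type u} [CommRing R] {𝒜 : ℤ → AddSubgroup R} {𝕜 : Type} [CommRing 𝕜]
  [SetLike.GradedOne 𝒜] {F : FormalGroup R} {hF : F.IsGraded 𝒜}

instance (n : ℤ) : (ideal 𝕜 F hF n).IsCoideal where
  counit_eq_zero z hz := by
    have h : ideal 𝕜 F hF n ≤ LinearMap.ker (counit (R := 𝕜)) :=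
      Submodule.span_le.2 fun z hz => (Rel.isCoidealElem hz).1
    exact h hz
  map_mkQ_comul_eq_zero z hz := by
    have h : ideal 𝕜 F hF n ≤ LinearMap.ker
        (TensorProduct.map (proj 𝕜 F hF n) (proj 𝕜 F hF n) ∘ₗ comul (R := 𝕜)) :=
      Submodule.span_le.2 fun z hz => (Rel.isCoidealElem hz).2
    exact h hz

lemma comul_proj {n : ℤ} (x : FreeModule 𝕜 𝒜 n) : comul (R := 𝕜) (proj 𝕜 F hF n x) =
    TensorProduct.map (proj 𝕜 F hF n) (proj 𝕜 F hF n) (comul (R := 𝕜) x) := rfl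

lemma counit_proj {n : ℤ} (x : FreeModule 𝕜 𝒜 n) :
    counit (R := 𝕜) (proj 𝕜 F hF n x) = counit (R := 𝕜) x := rfl

instance (n : ℤ) : IsCocomm 𝕜 (Carrier 𝕜 F hF n) where
  comm_comp_comul := Submodule.linearMap_qext _ <| LinearMap.ext fun x => by
    have h : ∀ u, TensorProduct.comm 𝕜 _ _ (TensorProduct.map (proj 𝕜 F hF n) (proj 𝕜 F hF n) u) =
        TensorProduct.map (proj 𝕜 F hF n) (proj 𝕜 F hF n) (TensorProduct.comm 𝕜 _ _ u) := by
      intro u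
      induction u with
      | zero => simp
      | add u v hu hv => simp only [map_add, hu, hv]
      | tmul a b => rfl
    have := h (comul (R := 𝕜) x)
    rwa [comm_comul] at this

/-! #### The grading -/

omit [SetLike.GradedOne 𝒜] in
-- The coproduct distributes the weight of `s` over its two factors, so `s` is counted once although
-- it meets both `t` and `r`.
lemma distribHom_mem {i j k : ℤ} (h : i + j = k) (s : Term 𝒜 i) (t r : Term 𝒜 j) :
    distribHom h (of 𝕜 s ⊗ₜ (of 𝕜 t ⊗ₜ of 𝕜 r)) ∈
      weightPart 𝒜 𝕜 k (s.weight + t.weight + r.weight) := by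
  rw [distribHom_tmul, comul_of]
  have hs := termComul_mem (𝕜 := 𝕜) s
  generalize termComul 𝕜 s = u at hs
  induction hs using Submodule.span_induction with
  | zero => simp
  | add a b _ _ ha hb =>
    simp only [TensorProduct.add_tmul, map_add]
    exact add_mem ha hb
  | smul c a _ ha =>
    simp only [← TensorProduct.smul_tmul', map_smul]
    exact Submodule.smul_mem _ _ ha
  | mem z hz =>
    obtain ⟨a, b, hab, rfl⟩ := hz
    rw [← hab, TensorProduct.tensorTensorTensorComm_tmul, TensorProduct.map_tmul, mul_of, mul_of,
      add_of, show a.weight + b.weight + t.weight + r.weight =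
        ((a.mul h t).add (b.mul h r)).weight by simp only [Term.weight]; omega]
    exact of_mem_weightPart _

omit [SetLike.GradedOne 𝒜] in
-- This makes the relation `[0] ∘ t = ε(t) [0]` homogeneous: its right side has weight zero, and it
-- is zero unless `t` has weight zero too.
lemma weight_eq_zero_of_termCounit_ne_zero {n : ℤ} (t : Term 𝒜 n) (ht : termCounit 𝕜 t ≠ 0) :
    t.weight = 0 := by
  induction t with
  | const n a => rfl
  | curve i =>
    by_contra h
    exact ht (by rw [termCounit, if_neg (show ¬i = 0 from h)])
  | add s t hs ht' | mul _ s t hs ht' =>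
    rw [termCounit] at ht
    rw [Term.weight, hs (left_ne_zero_of_mul ht), ht' (right_ne_zero_of_mul ht)]

/-- Homogeneity of all relations is what lets the weight grading pass to the quotient. -/
lemma Rel.exists_weight {n : ℤ} {z : FreeModule 𝕜 𝒜 n} (h : Rel 𝕜 F hF z) :
    ∃ w, z ∈ weightPart 𝒜 𝕜 n w := by
  induction h with
  | @add_assoc n s t r =>
    refine ⟨s.weight + t.weight + r.weight, sub_mem ?_ ?_⟩
    · rw [add_of, add_of]
      exact of_mem_weightPart ((s.add t).add r)
    · rw [add_of, add_of, _root_.add_assoc]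
      exact of_mem_weightPart (s.add (t.add r))
  | @add_comm n s t =>
    refine ⟨s.weight + t.weight, sub_mem ?_ ?_⟩
    · rw [add_of]
      exact of_mem_weightPart (s.add t)
    · rw [add_of, _root_.add_comm]
      exact of_mem_weightPart (t.add s)
  | @zero_add n t =>
    refine ⟨t.weight, sub_mem ?_ (of_mem_weightPart t)⟩
    have := add_mem_weightPart (of_mem_weightPart (𝕜 := 𝕜) (.const n 0)) (of_mem_weightPart t)
    rwa [Term.weight, _root_.zero_add] at this
  | @mul_assoc i j k ij jk l h₁ h₂ h₃ h₄ s t r =>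
    refine ⟨s.weight + t.weight + r.weight, sub_mem ?_ ?_⟩
    · rw [mul_of, mul_of]
      exact of_mem_weightPart ((s.mul h₁ t).mul h₂ r)
    · rw [mul_of, mul_of, _root_.add_assoc]
      exact of_mem_weightPart (s.mul h₄ (t.mul h₃ r))
  | @mul_comm i j k h h' s t =>
    refine ⟨s.weight + t.weight, sub_mem ?_ ?_⟩
    · rw [mul_of]
      exact of_mem_weightPart (s.mul h t)
    · rw [mul_of, _root_.add_comm]
      exact of_mem_weightPart (t.mul h' s)
  | @one_mul e he n h t =>
    refine ⟨t.weight, sub_mem ?_ (of_mem_weightPart t)⟩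
    have := mul_mem_weightPart h (of_mem_weightPart (𝕜 := 𝕜) (.const 0 e)) (of_mem_weightPart t)
    rwa [Term.weight, _root_.zero_add] at this
  | @zero_mul i j k h t =>
    refine ⟨t.weight, sub_mem ?_ ?_⟩
    · have := mul_mem_weightPart h (of_mem_weightPart (𝕜 := 𝕜) (.const i 0)) (of_mem_weightPart t)
      rwa [Term.weight, _root_.zero_add] at this
    · rw [counit_of]
      by_cases ht : termCounit 𝕜 t = 0
      · rw [ht, zero_smul]
        exact zero_mem _
      · rw [weight_eq_zero_of_termCounit_ne_zero t ht]
        exact Submodule.smul_mem _ _ (of_mem_weightPart (.const k 0))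
  | @mul_add i j k h s t r =>
    refine ⟨s.weight + t.weight + r.weight, sub_mem ?_ (distribHom_mem h s t r)⟩
    rw [add_of, mul_of, _root_.add_assoc]
    exact of_mem_weightPart (s.mul h (t.add r))
  | @const_add n a b =>
    refine ⟨0, sub_mem (of_mem_weightPart (.const n (a + b))) ?_⟩
    rw [add_of]
    exact of_mem_weightPart ((Term.const n a).add (.const n b))
  | @const_mul i j k h a b c hc =>
    refine ⟨0, sub_mem (of_mem_weightPart (.const k c)) ?_⟩
    rw [mul_of]
    exact of_mem_weightPart ((Term.const i a).mul h (.const j b))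
  | curve_zero =>
    exact ⟨0, sub_mem (of_mem_weightPart (.curve 0)) (of_mem_weightPart (.const 1 0))⟩
  | curve_μ m n N hm hn =>
    refine ⟨m + n, sub_mem ?_ (isHomogeneous_formalSum F hF N m n)⟩
    rw [AffineLine.μ_β, map_smul, curve_β]
    exact Submodule.smul_mem _ _ (of_mem_weightPart (.curve (m + n)))
  | add_right hz t ih =>
    obtain ⟨w, hw⟩ := ih
    exact ⟨_, add_mem_weightPart hw (of_mem_weightPart t)⟩
  | add_left t hz ih =>
    obtain ⟨w, hw⟩ := ih
    exact ⟨_, add_mem_weightPart (of_mem_weightPart t) hw⟩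
  | mul_right h hz t ih =>
    obtain ⟨w, hw⟩ := ih
    exact ⟨_, mul_mem_weightPart h hw (of_mem_weightPart t)⟩
  | mul_left h t hz ih =>
    obtain ⟨w, hw⟩ := ih
    exact ⟨_, mul_mem_weightPart h (of_mem_weightPart t) hw⟩

variable (𝕜 F hF) in
/-- The part of degree `i`: the span of the terms with twice the weight equal to `i`. -/
def degPart (n i : ℤ) : Submodule 𝕜 (Carrier 𝕜 F hF n) :=
  Submodule.span 𝕜 ((fun t => proj 𝕜 F hF n (of 𝕜 t)) '' {t | 2 * (t.weight : ℤ) = i})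

lemma proj_of_mem {n : ℤ} (t : Term 𝒜 n) :
    proj 𝕜 F hF n (of 𝕜 t) ∈ degPart 𝕜 F hF n (2 * t.weight) :=
  Submodule.subset_span ⟨t, rfl, rfl⟩

lemma proj_mem {n : ℤ} {w : ℕ} {z : FreeModule 𝕜 𝒜 n} (hz : z ∈ weightPart 𝒜 𝕜 n w) :
    proj 𝕜 F hF n z ∈ degPart 𝕜 F hF n (2 * w) := by
  have h : weightPart 𝒜 𝕜 n w ≤ (degPart 𝕜 F hF n (2 * w)).comap (proj 𝕜 F hF n) :=
    weightPart_le <| by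
      rintro t rfl
      exact proj_of_mem t
  exact h hz

variable (𝕜 F hF) in
/-- The decomposition of an element of the free module into homogeneous parts. -/
def freeDecompose (n : ℤ) : FreeModule 𝕜 𝒜 n →ₗ[𝕜] ⨁ i, degPart 𝕜 F hF n i :=
  FreeModule.lift fun t => DirectSum.lof 𝕜 ℤ (fun i => degPart 𝕜 F hF n i) (2 * t.weight)
    ⟨proj 𝕜 F hF n (of 𝕜 t), proj_of_mem t⟩

lemma freeDecompose_of_mem {n : ℤ} {w : ℕ} {z : FreeModule 𝕜 𝒜 n} (hz : z ∈ weightPart 𝒜 𝕜 n w) :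
    ∀ h : proj 𝕜 F hF n z ∈ degPart 𝕜 F hF n (2 * w), freeDecompose 𝕜 F hF n z =
      DirectSum.lof 𝕜 ℤ (fun i => degPart 𝕜 F hF n i) (2 * w) ⟨proj 𝕜 F hF n z, h⟩ := by
  induction hz using Submodule.span_induction with
  | mem z hz =>
    obtain ⟨t, rfl, rfl⟩ := hz
    intro h
    rw [freeDecompose, lift_of]
  | zero =>
    intro h
    rw [map_zero, ← map_zero (DirectSum.lof 𝕜 ℤ (fun i => degPart 𝕜 F hF n i) (2 * w))]
    rfl
  | add x y hx hy hx' hy' =>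
    intro h
    rw [map_add, hx' (proj_mem hx), hy' (proj_mem hy), ← map_add]
    rfl
  | smul c x hx hx' =>
    intro h
    rw [map_smul, hx' (proj_mem hx), ← map_smul]
    rfl

/-- A homogeneous element is sent to its own class in a single summand, and the class of a relation
is zero. -/
lemma freeDecompose_of_rel {n : ℤ} {z : FreeModule 𝕜 𝒜 n} (hz : Rel 𝕜 F hF z) :
    freeDecompose 𝕜 F hF n z = 0 := by
  obtain ⟨w, hw⟩ := Rel.exists_weight hz
  rw [freeDecompose_of_mem hw (proj_mem hw)]
  have : proj 𝕜 F hF n z = 0 := (Submodule.Quotient.mk_eq_zero _).2 (Rel.mem_ideal hz)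
  simp only [this]
  exact map_zero _

lemma ideal_le_ker_freeDecompose (n : ℤ) :
    ideal 𝕜 F hF n ≤ LinearMap.ker (freeDecompose 𝕜 F hF n) :=
  Submodule.span_le.2 fun _ hz => freeDecompose_of_rel hz

variable (𝕜 F hF) in
/-- The decomposition of an element into homogeneous parts. -/
def carrierDecompose (n : ℤ) : Carrier 𝕜 F hF n →ₗ[𝕜] ⨁ i, degPart 𝕜 F hF n i :=
  quotientLift (ideal 𝕜 F hF n) (freeDecompose 𝕜 F hF n) (ideal_le_ker_freeDecompose n)

lemma carrierDecompose_proj {n : ℤ} (t : Term 𝒜 n) :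
    carrierDecompose 𝕜 F hF n (proj 𝕜 F hF n (of 𝕜 t)) =
      DirectSum.lof 𝕜 ℤ (fun i => degPart 𝕜 F hF n i) (2 * t.weight)
        ⟨proj 𝕜 F hF n (of 𝕜 t), proj_of_mem t⟩ :=
  (quotientLift_mkQ _ _ (ideal_le_ker_freeDecompose n) _).trans (lift_of _ t)

/-- Recomposing after decomposing is the identity on terms, hence everywhere. The other composite is
checked on each summand, by induction over the span of its terms. -/
instance (n : ℤ) : DirectSum.Decomposition (degPart 𝕜 F hF n) :=
  .ofLinearMap _ (carrierDecompose 𝕜 F hF n)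
    (carrier_ext fun t => by
      rw [LinearMap.comp_apply, carrierDecompose_proj, DirectSum.coeLinearMap_lof]
      rfl)
    (DirectSum.linearMap_ext _ fun i => LinearMap.ext fun x => by
      obtain ⟨x, hx⟩ := x
      rw [LinearMap.comp_apply, LinearMap.comp_apply, DirectSum.coeLinearMap_lof,
        LinearMap.comp_apply, LinearMap.id_apply]
      dsimp only
      have key : ∀ h : x ∈ degPart 𝕜 F hF n i, carrierDecompose 𝕜 F hF n x =
          DirectSum.lof 𝕜 ℤ (fun i => degPart 𝕜 F hF n i) i ⟨x, h⟩ := by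
        induction hx using Submodule.span_induction with
        | mem z hz =>
          obtain ⟨t, rfl, rfl⟩ := hz
          intro h
          exact carrierDecompose_proj t
        | zero =>
          intro h
          rw [map_zero, ← map_zero (DirectSum.lof 𝕜 ℤ (fun i => degPart 𝕜 F hF n i) i)]
          rfl
        | add x y hx hy hx' hy' =>
          intro h
          rw [map_add, hx' hx, hy' hy, ← map_add]
          rfl
        | smul c x hx hx' =>
          intro h
          rw [map_smul, hx' hx, ← map_smul]
          rfl
      exact key hx)

/-- Degrees are twice the weights, so the Koszul symmetry and interchange of the quotient are the
plain ones. -/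
lemma oddProj_degPart (n : ℤ) : oddProj (degPart 𝕜 F hF n) = 0 :=
  carrier_ext fun t => oddProj_of_mem _ (even_two_mul _) (proj_of_mem t)

variable (𝕜 F hF) in
/-- The components of the Ravenel-Wilson Hopf ring, as graded coalgebras. -/
def gradedCoalg (n : ℤ) : GradedCoalg.{u} 𝕜 where
  carrier := Carrier 𝕜 F hF n
  deg := degPart 𝕜 F hF n
  counit_deg i hi x hx := by
    have h : degPart 𝕜 F hF n i ≤ LinearMap.ker (counit (R := 𝕜)) := by
      refine Submodule.span_le.2 ?_
      rintro _ ⟨t, rfl, rfl⟩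
      rw [SetLike.mem_coe, LinearMap.mem_ker, counit_proj, counit_of]
      by_contra ht
      exact hi (by rw [weight_eq_zero_of_termCounit_ne_zero t ht]; rfl)
    exact h hx
  comul_deg i x hx := by
    have h : degPart 𝕜 F hF n i ≤ (⨆ (p : ℤ) (q : ℤ) (_ : p + q = i), LinearMap.range
        (TensorProduct.map (degPart 𝕜 F hF n p).subtype (degPart 𝕜 F hF n q).subtype)).comap
          (comul (R := 𝕜)) := by
      refine Submodule.span_le.2 ?_
      rintro _ ⟨t, rfl, rfl⟩
      rw [SetLike.mem_coe, Submodule.mem_comap, comul_proj, comul_of, ← Submodule.mem_comap]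
      refine (Submodule.span_le.2 ?_ : tensorWeightPart 𝒜 𝕜 n t.weight ≤ _) (termComul_mem t)
      rintro _ ⟨a, b, hab, rfl⟩
      refine Submodule.mem_iSup_of_mem (2 * a.weight) <| Submodule.mem_iSup_of_mem (2 * b.weight) <|
        Submodule.mem_iSup_of_mem (by rw [← hab]; push_cast; ring) ?_
      exact ⟨⟨_, proj_of_mem a⟩ ⊗ₜ ⟨_, proj_of_mem b⟩, rfl⟩
    exact h hx
  cocomm := by
    rw [koszulSwap_eq _ _ (oddProj_degPart n)]
    exact comm_comp_comul 𝕜 _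

end FormalHopf

/-! ### The Hopf ring structure on the quotient -/

namespace FormalHopf

open FreeModule Coalgebra

section Ring

variable {R : Type u} [CommRing R] {𝒜 : ℤ → AddSubgroup R} {𝕜 : Type} [CommRing 𝕜]
  [SetLike.GradedOne 𝒜] {F : FormalGroup R} {hF : F.IsGraded 𝒜}

variable (𝕜 F hF) in
/-- The constants. -/
def carrierConst (n : ℤ) (a : 𝒜 n) : Carrier 𝕜 F hF n := proj 𝕜 F hF n (of 𝕜 (.const n a))

lemma isTensorHom_of_coalgHom {i j k : ℤ}
    (m : FreeModule 𝕜 𝒜 i ⊗[𝕜] FreeModule 𝕜 𝒜 j →ₗc[𝕜] FreeModule 𝕜 𝒜 k)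
    (op : Term 𝒜 i → Term 𝒜 j → Term 𝒜 k) (hm : ∀ s t, m (of 𝕜 s ⊗ₜ of 𝕜 t) = of 𝕜 (op s t))
    (hop : ∀ s t, (op s t).weight = s.weight + t.weight)
    (mQ : Carrier 𝕜 F hF i ⊗[𝕜] Carrier 𝕜 F hF j →ₗ[𝕜] Carrier 𝕜 F hF k)
    (hmQ : ∀ x y, mQ (proj 𝕜 F hF i x ⊗ₜ proj 𝕜 F hF j y) = proj 𝕜 F hF k (m (x ⊗ₜ y))) :
    GradedCoalg.IsTensorHom (C := gradedCoalg 𝕜 F hF i) (D := gradedCoalg 𝕜 F hF j)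
      (E := gradedCoalg 𝕜 F hF k) mQ where
  map_deg p q x y hx hy := by
    change mQ (x ⊗ₜ y) ∈ degPart 𝕜 F hF k (p + q)
    have h₁ : ∀ t : Term 𝒜 j, 2 * (t.weight : ℤ) = q →
        degPart 𝕜 F hF i p ≤ (degPart 𝕜 F hF k (p + q)).comap
          (mQ ∘ₗ (TensorProduct.mk 𝕜 _ _).flip (proj 𝕜 F hF j (of 𝕜 t))) := by
      rintro t rfl
      refine Submodule.span_le.2 ?_
      rintro _ ⟨s, rfl, rfl⟩
      change mQ (proj 𝕜 F hF i (of 𝕜 s) ⊗ₜ proj 𝕜 F hF j (of 𝕜 t)) ∈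
        degPart 𝕜 F hF k (2 * s.weight + 2 * t.weight)
      rw [hmQ, hm]
      have := proj_of_mem (𝕜 := 𝕜) (F := F) (hF := hF) (op s t)
      rwa [hop, Nat.cast_add, mul_add] at this
    have h₂ : degPart 𝕜 F hF j q ≤ (degPart 𝕜 F hF k (p + q)).comap
        (mQ ∘ₗ TensorProduct.mk 𝕜 _ _ x) := by
      refine Submodule.span_le.2 ?_
      rintro _ ⟨t, ht, rfl⟩
      exact h₁ t ht hx
    exact h₂ hy
  counit_map x y := by
    obtain ⟨x, rfl⟩ := proj_surjective i x
    obtain ⟨y, rfl⟩ := proj_surjective j y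
    change counit (R := 𝕜) (mQ (proj 𝕜 F hF i x ⊗ₜ proj 𝕜 F hF j y)) =
      counit (R := 𝕜) (proj 𝕜 F hF i x) * counit (R := 𝕜) (proj 𝕜 F hF j y)
    rw [hmQ, counit_proj, counit_proj, counit_proj, CoalgHomClass.counit_comp_apply,
      TensorProduct.counit_tmul, smul_eq_mul, mul_comm]
  comul_map := by
    have h : koszulInterchange (gradedCoalg 𝕜 F hF i).deg (gradedCoalg 𝕜 F hF j).deg
        (gradedCoalg 𝕜 F hF i) (gradedCoalg 𝕜 F hF j) =
          (TensorProduct.tensorTensorTensorComm 𝕜 (Carrier 𝕜 F hF i) (Carrier 𝕜 F hF i)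
            (Carrier 𝕜 F hF j) (Carrier 𝕜 F hF j)).toLinearMap :=
      koszulInterchange_eq _ _ (oddProj_degPart i)
    rw [h]
    refine TensorProduct.ext' fun x y => ?_
    obtain ⟨x, rfl⟩ := proj_surjective i x
    obtain ⟨y, rfl⟩ := proj_surjective j y
    change comul (R := 𝕜) (mQ (proj 𝕜 F hF i x ⊗ₜ proj 𝕜 F hF j y)) = TensorProduct.map mQ mQ
      (TensorProduct.tensorTensorTensorComm 𝕜 _ _ _ _
        (comul (R := 𝕜) (proj 𝕜 F hF i x) ⊗ₜ comul (R := 𝕜) (proj 𝕜 F hF j y)))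
    rw [hmQ, comul_proj, comul_proj, comul_proj, ← CoalgHomClass.map_comp_comul_apply,
      TensorProduct.comul_tmul, TensorProduct.AlgebraTensorModule.tensorTensorTensorComm_eq,
      map_map_proj m mQ hmQ]

lemma isTensorHom_carrierAdd (n : ℤ) :
    GradedCoalg.IsTensorHom (C := gradedCoalg 𝕜 F hF n) (D := gradedCoalg 𝕜 F hF n)
      (E := gradedCoalg 𝕜 F hF n) (carrierAdd 𝕜 F hF n) :=
  isTensorHom_of_coalgHom (addHom 𝒜 𝕜 n) Term.add add_of (fun _ _ => rfl) _ (fun _ _ => rfl)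

lemma isTensorHom_carrierMul {i j k : ℤ} (h : i + j = k) :
    GradedCoalg.IsTensorHom (C := gradedCoalg 𝕜 F hF i) (D := gradedCoalg 𝕜 F hF j)
      (E := gradedCoalg 𝕜 F hF k) (carrierMul 𝕜 F hF h) :=
  isTensorHom_of_coalgHom (mulHom 𝒜 𝕜 h) (Term.mul h) (mul_of h) (fun _ _ => rfl) _ (fun _ _ => rfl)

lemma carrierAdd_assoc {n : ℤ} (x y z : Carrier 𝕜 F hF n) :
    carrierAdd 𝕜 F hF n (carrierAdd 𝕜 F hF n (x ⊗ₜ y) ⊗ₜ z) =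
      carrierAdd 𝕜 F hF n (x ⊗ₜ carrierAdd 𝕜 F hF n (y ⊗ₜ z)) := by
  have h : carrierAdd 𝕜 F hF n ∘ₗ TensorProduct.map (carrierAdd 𝕜 F hF n) .id =
      carrierAdd 𝕜 F hF n ∘ₗ TensorProduct.map .id (carrierAdd 𝕜 F hF n) ∘ₗ
        (TensorProduct.assoc 𝕜 _ _ _).toLinearMap :=
    TensorProduct.ext <| TensorProduct.ext <| carrier_ext fun s => carrier_ext fun t =>
      carrier_ext fun r => (Rel.add_assoc s t r).proj_eq
  exact LinearMap.congr_fun h ((x ⊗ₜ y) ⊗ₜ z)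

lemma carrierAdd_comm (n : ℤ) : carrierAdd 𝕜 F hF n ∘ₗ (TensorProduct.comm 𝕜 _ _).toLinearMap =
    carrierAdd 𝕜 F hF n :=
  TensorProduct.ext <| carrier_ext fun s => carrier_ext fun t => (Rel.add_comm t s).proj_eq

lemma carrierAdd_zero {n : ℤ} (x : Carrier 𝕜 F hF n) :
    carrierAdd 𝕜 F hF n (carrierConst 𝕜 F hF n 0 ⊗ₜ x) = x := by
  have h : carrierAdd 𝕜 F hF n ∘ₗ TensorProduct.mk 𝕜 _ _ (carrierConst 𝕜 F hF n 0) = .id :=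
    carrier_ext fun t => (Rel.zero_add t).proj_eq
  exact LinearMap.congr_fun h x

lemma carrierMul_assoc {i j k ij jk l : ℤ} (h₁ : i + j = ij) (h₂ : ij + k = l) (h₃ : j + k = jk)
    (h₄ : i + jk = l) (x : Carrier 𝕜 F hF i) (y : Carrier 𝕜 F hF j) (z : Carrier 𝕜 F hF k) :
    carrierMul 𝕜 F hF h₂ (carrierMul 𝕜 F hF h₁ (x ⊗ₜ y) ⊗ₜ z) =
      carrierMul 𝕜 F hF h₄ (x ⊗ₜ carrierMul 𝕜 F hF h₃ (y ⊗ₜ z)) := by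
  have h : carrierMul 𝕜 F hF h₂ ∘ₗ TensorProduct.map (carrierMul 𝕜 F hF h₁) .id =
      carrierMul 𝕜 F hF h₄ ∘ₗ TensorProduct.map .id (carrierMul 𝕜 F hF h₃) ∘ₗ
        (TensorProduct.assoc 𝕜 _ _ _).toLinearMap :=
    TensorProduct.ext <| TensorProduct.ext <| carrier_ext fun s => carrier_ext fun t =>
      carrier_ext fun r => (Rel.mul_assoc h₁ h₂ h₃ h₄ s t r).proj_eq
  exact LinearMap.congr_fun h ((x ⊗ₜ y) ⊗ₜ z)

lemma carrierMul_comm {i j k : ℤ} (h : i + j = k) (h' : j + i = k) :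
    carrierMul 𝕜 F hF h' ∘ₗ (TensorProduct.comm 𝕜 _ _).toLinearMap = carrierMul 𝕜 F hF h :=
  TensorProduct.ext <| carrier_ext fun s => carrier_ext fun t => (Rel.mul_comm h' h t s).proj_eq

lemma carrierMul_one {e : 𝒜 0} (he : (e : R) = 1) {n : ℤ} (h : 0 + n = n)
    (x : Carrier 𝕜 F hF n) : carrierMul 𝕜 F hF h (carrierConst 𝕜 F hF 0 e ⊗ₜ x) = x := by
  have h : carrierMul 𝕜 F hF h ∘ₗ TensorProduct.mk 𝕜 _ _ (carrierConst 𝕜 F hF 0 e) = .id :=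
    carrier_ext fun t => (Rel.one_mul e he h t).proj_eq
  exact LinearMap.congr_fun h x

lemma carrierMul_zero {i j k : ℤ} (h : i + j = k) (x : Carrier 𝕜 F hF j) :
    carrierMul 𝕜 F hF h (carrierConst 𝕜 F hF i 0 ⊗ₜ x) =
      counit (R := 𝕜) x • carrierConst 𝕜 F hF k 0 := by
  have h : carrierMul 𝕜 F hF h ∘ₗ TensorProduct.mk 𝕜 _ _ (carrierConst 𝕜 F hF i 0) =
      (counit (R := 𝕜)).smulRight (carrierConst 𝕜 F hF k 0) :=
    carrier_ext fun t => (Rel.zero_mul h t).proj_eq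
  exact LinearMap.congr_fun h x

/-- The relation uses the coproduct of `s` in the free module; `map_map_proj` replaces it by the
coproduct of the class of `s`. -/
lemma carrierMul_add {i j k : ℤ} (h : i + j = k) :
    carrierMul 𝕜 F hF h ∘ₗ TensorProduct.map .id (carrierAdd 𝕜 F hF j) =
      carrierAdd 𝕜 F hF k ∘ₗ TensorProduct.map (carrierMul 𝕜 F hF h) (carrierMul 𝕜 F hF h) ∘ₗ
        (TensorProduct.tensorTensorTensorComm 𝕜 _ _ _ _).toLinearMap ∘ₗ
          TensorProduct.map (comul (R := 𝕜)) .id :=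
  TensorProduct.ext <| carrier_ext fun s => TensorProduct.ext <| carrier_ext fun t =>
    carrier_ext fun r => by
      refine (Rel.mul_add h s t r).proj_eq.trans ?_
      have h₁ : ∀ u, carrierAdd 𝕜 F hF k (TensorProduct.map (proj 𝕜 F hF k) (proj 𝕜 F hF k) u) =
          proj 𝕜 F hF k (add 𝒜 𝕜 k u) := LinearMap.congr_fun (f := carrierAdd 𝕜 F hF k ∘ₗ
            TensorProduct.map (proj 𝕜 F hF k) (proj 𝕜 F hF k)) (g := proj 𝕜 F hF k ∘ₗ add 𝒜 𝕜 k)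
              (TensorProduct.ext' fun _ _ => rfl)
      refine (h₁ _).symm.trans (congrArg (carrierAdd 𝕜 F hF k) ?_)
      exact map_map_proj (mulHom 𝒜 𝕜 h) (carrierMul 𝕜 F hF h) (fun _ _ => rfl)
        (comul (R := 𝕜) (of 𝕜 s)) (of 𝕜 t ⊗ₜ of 𝕜 r)

lemma comul_carrierMul {i j k : ℤ} (h : i + j = k)
    (z : Carrier 𝕜 F hF i ⊗[𝕜] Carrier 𝕜 F hF j) : comul (R := 𝕜) (carrierMul 𝕜 F hF h z) =
      TensorProduct.map (carrierMul 𝕜 F hF h) (carrierMul 𝕜 F hF h)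
        (TensorProduct.tensorTensorTensorComm 𝕜 _ _ _ _
          (TensorProduct.map (comul (R := 𝕜)) (comul (R := 𝕜)) z)) := by
  have h₁ := (isTensorHom_carrierMul (𝕜 := 𝕜) (F := F) (hF := hF) h).comul_map
  have h₂ : koszulInterchange (gradedCoalg 𝕜 F hF i).deg (gradedCoalg 𝕜 F hF j).deg
      (gradedCoalg 𝕜 F hF i) (gradedCoalg 𝕜 F hF j) =
        (TensorProduct.tensorTensorTensorComm 𝕜 (Carrier 𝕜 F hF i) (Carrier 𝕜 F hF i)
          (Carrier 𝕜 F hF j) (Carrier 𝕜 F hF j)).toLinearMap :=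
    koszulInterchange_eq _ _ (oddProj_degPart i)
  rw [h₂] at h₁
  exact LinearMap.congr_fun h₁ z

lemma comul_carrierConst (n : ℤ) (a : 𝒜 n) : comul (R := 𝕜) (carrierConst 𝕜 F hF n a) =
    carrierConst 𝕜 F hF n a ⊗ₜ carrierConst 𝕜 F hF n a := by
  rw [carrierConst, comul_proj, comul_const]
  rfl

lemma counit_carrierConst (n : ℤ) (a : 𝒜 n) :
    counit (R := 𝕜) (carrierConst 𝕜 F hF n a) = 1 := by
  rw [carrierConst, counit_proj, counit_const]

lemma carrierConst_mem (n : ℤ) (a : 𝒜 n) : carrierConst 𝕜 F hF n a ∈ degPart 𝕜 F hF n 0 :=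
  proj_of_mem (.const n a)

variable (𝕜 F hF) in
/-- Multiplication by a constant of degree zero, as a linear map. -/
def mulConstLinear (n : ℤ) (a : 𝒜 0) : Carrier 𝕜 F hF n →ₗ[𝕜] Carrier 𝕜 F hF n :=
  carrierMul 𝕜 F hF (add_zero n) ∘ₗ (TensorProduct.mk 𝕜 _ _).flip (carrierConst 𝕜 F hF 0 a)

variable (𝕜 F hF) in
/-- Multiplication by a constant of degree zero, as a map of coalgebras. -/
def mulConstHom (n : ℤ) (a : 𝒜 0) : Carrier 𝕜 F hF n →ₗc[𝕜] Carrier 𝕜 F hF n where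
  __ := mulConstLinear 𝕜 F hF n a
  counit_comp := LinearMap.ext fun x => by
    refine ((isTensorHom_carrierMul (add_zero n)).counit_map x
      (carrierConst 𝕜 F hF 0 a)).trans ?_
    exact (congrArg _ (counit_carrierConst 0 a)).trans (mul_one _)
  map_comp_comul := LinearMap.ext fun x => by
    refine Eq.trans ?_ (comul_carrierMul (add_zero n) (x ⊗ₜ carrierConst 𝕜 F hF 0 a)).symm
    rw [TensorProduct.map_tmul, comul_carrierConst, LinearMap.comp_apply]
    generalize comul (R := 𝕜) x = u
    induction u with
    | zero => simp
    | add u v hu hv => simp only [TensorProduct.add_tmul, map_add, hu, hv]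
    | tmul u v => rfl

variable (𝕜 F hF) in
/-- Multiplication by a constant of degree zero, as a map of graded coalgebras. -/
def mulConst (n : ℤ) (a : 𝒜 0) :
    GradedCoalg.Hom (gradedCoalg 𝕜 F hF n) (gradedCoalg 𝕜 F hF n) where
  map := mulConstHom 𝕜 F hF n a
  map_deg i x hx := by
    have := (isTensorHom_carrierMul (𝕜 := 𝕜) (F := F) (hF := hF) (add_zero n)).map_deg i 0 x
      (carrierConst 𝕜 F hF 0 a) hx (carrierConst_mem 0 a)
    rwa [add_zero] at this

lemma mulConst_one (n : ℤ) {a : 𝒜 0} (ha : (a : R) = 1) (x : Carrier 𝕜 F hF n) :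
    carrierMul 𝕜 F hF (add_zero n) (x ⊗ₜ carrierConst 𝕜 F hF 0 a) = x := by
  have h := LinearMap.congr_fun (carrierMul_comm (𝕜 := 𝕜) (F := F) (hF := hF) (add_zero n)
    (zero_add n)) (x ⊗ₜ carrierConst 𝕜 F hF 0 a)
  exact h.symm.trans (carrierMul_one ha _ x)

/-- Expand `x ∘ ([1] * [-1])` by distributivity. Since `[1] * [-1] = [0]`, the left side is `ε(x)
[0]`; the right side is `∑ x' * (x'' ∘ [-1])`. So multiplication by `[-1]` is the antipode. -/
lemma carrierAdd_mulConstLinear_neg_one (n : ℤ) {e : 𝒜 0} (he : (e : R) = 1)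
    (x : Carrier 𝕜 F hF n) :
    carrierAdd 𝕜 F hF n (TensorProduct.map .id (mulConstLinear 𝕜 F hF n (-e))
      (comul (R := 𝕜) x)) = counit (R := 𝕜) x • carrierConst 𝕜 F hF n 0 := by
  have h := LinearMap.congr_fun (carrierMul_add (𝕜 := 𝕜) (F := F) (hF := hF) (add_zero n))
    (x ⊗ₜ (carrierConst 𝕜 F hF 0 e ⊗ₜ carrierConst 𝕜 F hF 0 (-e)))
  have h₁ : carrierAdd 𝕜 F hF 0 (carrierConst 𝕜 F hF 0 e ⊗ₜ carrierConst 𝕜 F hF 0 (-e)) =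
      carrierConst 𝕜 F hF 0 0 := by
    rw [← add_neg_cancel e]
    exact (Rel.const_add e (-e)).proj_eq.symm
  have h₂ : carrierMul 𝕜 F hF (add_zero n) (x ⊗ₜ carrierConst 𝕜 F hF 0 0) =
      counit (R := 𝕜) x • carrierConst 𝕜 F hF n 0 :=
    (LinearMap.congr_fun (carrierMul_comm (add_zero n) (zero_add n)) _).symm.trans
      (carrierMul_zero _ x)
  simp only [LinearMap.comp_apply, TensorProduct.map_tmul, LinearMap.id_apply, h₁, h₂] at h
  rw [h]
  congr 1
  generalize comul (R := 𝕜) x = u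
  induction u with
  | zero => simp
  | add u v hu hv => simp only [TensorProduct.add_tmul, map_add, hu, hv]
  | tmul u v => exact congrArg (· ⊗ₜ[𝕜] _) (mulConst_one n he u).symm

variable (𝕜 F hF) in
/-- The Ravenel-Wilson Hopf ring, by generators and relations. -/
def ravenelWilson : HopfRing 𝕜 𝒜 where
  obj := gradedCoalg 𝕜 F hF
  add := carrierAdd 𝕜 F hF
  mul _ _ _ h := carrierMul 𝕜 F hF h
  const := carrierConst 𝕜 F hF
  add_isHom := isTensorHom_carrierAdd
  mul_isHom _ _ _ h := isTensorHom_carrierMul h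
  const_deg := carrierConst_mem
  counit_const := counit_carrierConst
  comul_const := comul_carrierConst
  add_assoc _ := carrierAdd_assoc
  add_comm n := by
    rw [show koszulSwap (gradedCoalg 𝕜 F hF n).deg (gradedCoalg 𝕜 F hF n).deg =
      (TensorProduct.comm 𝕜 (Carrier 𝕜 F hF n) (Carrier 𝕜 F hF n)).toLinearMap from
        koszulSwap_eq _ _ (oddProj_degPart n)]
    exact carrierAdd_comm n
  zero_add _ := carrierAdd_zero
  exists_neg n := ⟨mulConst 𝕜 F hF n (-⟨1, SetLike.GradedOne.one_mem⟩),
    carrierAdd_mulConstLinear_neg_one n rfl⟩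
  mul_assoc _ _ _ _ _ _ := carrierMul_assoc
  mul_comm i j k h h' := by
    rw [show koszulSwap (gradedCoalg 𝕜 F hF i).deg (gradedCoalg 𝕜 F hF j).deg =
      (TensorProduct.comm 𝕜 (Carrier 𝕜 F hF i) (Carrier 𝕜 F hF j)).toLinearMap from
        koszulSwap_eq _ _ (oddProj_degPart i)]
    exact carrierMul_comm h h'
  one_mul _ he _ h := carrierMul_one he h
  zero_mul _ _ _ h := carrierMul_zero h
  mul_add i j k h := by
    rw [show koszulInterchange (gradedCoalg 𝕜 F hF i).deg (gradedCoalg 𝕜 F hF j).deg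
      (gradedCoalg 𝕜 F hF i) (gradedCoalg 𝕜 F hF j) =
        (TensorProduct.tensorTensorTensorComm 𝕜 (Carrier 𝕜 F hF i) (Carrier 𝕜 F hF i)
          (Carrier 𝕜 F hF j) (Carrier 𝕜 F hF j)).toLinearMap from
      koszulInterchange_eq _ _ (oddProj_degPart i)]
    exact carrierMul_add h
  const_add _ a b := (Rel.const_add a b).proj_eq
  const_mul _ _ _ h a b c hc := (Rel.const_mul h a b c hc).proj_eq

lemma isEval_proj : IsEval (ravenelWilson 𝕜 F hF) (proj 𝕜 F hF) where
  map_add _ _ _ := rfl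
  map_mul _ _ _ _ _ _ := rfl
  map_const _ _ := rfl

variable (𝕜 F hF) in
/-- The tautological additive curve. -/
def tautologicalCurve : (ravenelWilson 𝕜 F hF).AdditiveCurve F hF where
  map := (Coalgebra.Quotient.mkQCoalgHom (ideal 𝕜 F hF 1)).comp (curveHom 𝒜 𝕜)
  map_deg n := by
    change proj 𝕜 F hF 1 (curve 𝒜 𝕜 (AffineLine.β n)) ∈ degPart 𝕜 F hF 1 (2 * n)
    rw [curve_β]
    exact proj_of_mem (.curve n)
  map_zero := by
    change proj 𝕜 F hF 1 (curve 𝒜 𝕜 (AffineLine.β 0)) = _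
    rw [curve_β]
    exact Rel.curve_zero.proj_eq
  map_mu m n N hm hn :=
    (Rel.curve_μ m n N hm hn).proj_eq.trans
      (LinearMap.congr_fun (isEval_proj.comp_formalSum F hF N) _)

end Ring

end FormalHopf

/-! ### Evaluation of terms and the universal property -/

namespace FormalHopf

open FreeModule Coalgebra

variable {R : Type u} [CommRing R] {𝒜 : ℤ → AddSubgroup R} {𝕜 : Type} [CommRing 𝕜]
  [SetLike.GradedOne 𝒜] {F : FormalGroup R} {hF : F.IsGraded 𝒜}
  {K : HopfRing 𝕜 𝒜} (y : K.AdditiveCurve F hF)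

/-- The value of a term in a Hopf ring with an additive curve. -/
def termValue : {n : ℤ} → Term 𝒜 n → K.obj n
  | _, .const n a => K.const n a
  | _, .curve i => y.map (AffineLine.β i)
  | n, .add s t => K.add n (termValue s ⊗ₜ termValue t)
  | _, .mul h s t => K.mul _ _ _ h (termValue s ⊗ₜ termValue t)

/-- Evaluation of formal linear combinations of terms. -/
def eval (n : ℤ) : FreeModule 𝕜 𝒜 n →ₗ[𝕜] K.obj n := FreeModule.lift (termValue y)

lemma eval_of {n : ℤ} (t : Term 𝒜 n) : eval y n (of 𝕜 t) = termValue y t := lift_of _ t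

lemma eval_add {n : ℤ} (a b : FreeModule 𝕜 𝒜 n) :
    eval y n (add 𝒜 𝕜 n (a ⊗ₜ b)) = K.add n (eval y n a ⊗ₜ eval y n b) := by
  have h : eval y n ∘ₗ add 𝒜 𝕜 n = K.add n ∘ₗ TensorProduct.map (eval y n) (eval y n) :=
    TensorProduct.ext <| hom_ext fun s => hom_ext fun t => by
      simp [eval_of, termValue]
  exact LinearMap.congr_fun h (a ⊗ₜ b)

lemma eval_mul {i j k : ℤ} (e : i + j = k) (a : FreeModule 𝕜 𝒜 i) (b : FreeModule 𝕜 𝒜 j) :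
    eval y k (mul 𝒜 𝕜 e (a ⊗ₜ b)) = K.mul i j k e (eval y i a ⊗ₜ eval y j b) := by
  have h : eval y k ∘ₗ mul 𝒜 𝕜 e = K.mul i j k e ∘ₗ TensorProduct.map (eval y i) (eval y j) :=
    TensorProduct.ext <| hom_ext fun s => hom_ext fun t => by
      simp [eval_of, termValue]
  exact LinearMap.congr_fun h (a ⊗ₜ b)

lemma isEval_eval : IsEval K (eval y) where
  map_add _ := eval_add y
  map_mul _ _ _ := eval_mul y
  map_const n a := by rw [eval_of, termValue]

lemma eval_comp_curve : eval y 1 ∘ₗ curve 𝒜 𝕜 = y.map.toLinearMap :=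
  AffineLine.hom_ext fun i => by
    rw [LinearMap.comp_apply, curve_β, eval_of, termValue]
    rfl

lemma termValue_mem {n : ℤ} (t : Term 𝒜 n) : termValue y t ∈ (K.obj n).deg (2 * t.weight) := by
  induction t with
  | const n a =>
    rw [termValue]
    exact K.const_deg n a
  | curve i =>
    rw [termValue]
    exact y.map_deg i
  | add s t hs ht =>
    rw [termValue, Term.weight, Nat.cast_add, mul_add]
    exact (K.add_isHom _).map_deg _ _ _ _ hs ht
  | mul h s t hs ht =>
    rw [termValue, Term.weight, Nat.cast_add, mul_add]
    exact (K.mul_isHom _ _ _ h).map_deg _ _ _ _ hs ht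

/-- The target may have odd elements, but values of terms are even. This is why the sign-free
relations hold after evaluation in a Hopf ring with signs. -/
lemma oddProj_eval {n : ℤ} (a : FreeModule 𝕜 𝒜 n) : oddProj (K.obj n).deg (eval y n a) = 0 := by
  have h : oddProj (K.obj n).deg ∘ₗ eval y n = 0 := hom_ext fun t => by
    rw [LinearMap.comp_apply, eval_of, LinearMap.zero_apply]
    exact oddProj_of_mem _ (even_two_mul _) (termValue_mem y t)
  exact LinearMap.congr_fun h a

lemma map_map_eval {i j k : ℤ}
    (m : FreeModule 𝕜 𝒜 i ⊗[𝕜] FreeModule 𝕜 𝒜 j →ₗ[𝕜] FreeModule 𝕜 𝒜 k)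
    (mK : K.obj i ⊗[𝕜] K.obj j →ₗ[𝕜] K.obj k)
    (hm : ∀ a b, eval y k (m (a ⊗ₜ b)) = mK (eval y i a ⊗ₜ eval y j b))
    (u : FreeModule 𝕜 𝒜 i ⊗[𝕜] FreeModule 𝕜 𝒜 i) (v : FreeModule 𝕜 𝒜 j ⊗[𝕜] FreeModule 𝕜 𝒜 j) :
    TensorProduct.map (eval y k) (eval y k) (TensorProduct.map m m
      (TensorProduct.tensorTensorTensorComm 𝕜 _ _ _ _ (u ⊗ₜ v))) =
    TensorProduct.map mK mK (koszulInterchange (K.obj i).deg (K.obj j).deg (K.obj i) (K.obj j)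
      (TensorProduct.map (eval y i) (eval y i) u ⊗ₜ
        TensorProduct.map (eval y j) (eval y j) v)) := by
  induction u with
  | zero => simp
  | add u₁ u₂ h₁ h₂ => simp only [TensorProduct.add_tmul, map_add, h₁, h₂]
  | tmul a a' =>
    induction v with
    | zero => simp
    | add u₁ u₂ h₁ h₂ => simp only [TensorProduct.tmul_add, map_add, h₁, h₂]
    | tmul b b' =>
      simp only [TensorProduct.tensorTensorTensorComm_tmul, TensorProduct.map_tmul, hm,
        koszulInterchange_tmul _ _ (oddProj_eval y a')]

lemma counit_termValue {n : ℤ} (t : Term 𝒜 n) :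
    counit (R := 𝕜) (termValue y t) = termCounit 𝕜 t := by
  induction t with
  | const n a => rw [termValue, termCounit, K.counit_const]
  | curve i =>
    rw [termValue, termCounit, CoalgHomClass.counit_comp_apply, AffineLine.counit_β]
  | add s t hs ht => rw [termValue, termCounit, (K.add_isHom _).counit_map, hs, ht]
  | mul h s t hs ht => rw [termValue, termCounit, (K.mul_isHom _ _ _ h).counit_map, hs, ht]

/-- The operations of `K` obey the recursion that defines `termComul`, up to Koszul signs that are
trivial on values of terms. -/
lemma comul_termValue {n : ℤ} (t : Term 𝒜 n) : comul (R := 𝕜) (termValue y t) =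
    TensorProduct.map (eval y n) (eval y n) (termComul 𝕜 t) := by
  induction t with
  | const n a =>
    rw [termValue, termComul, K.comul_const, TensorProduct.map_tmul, eval_of, termValue]
  | curve i =>
    rw [termValue, termComul, ← CoalgHomClass.map_comp_comul_apply, AffineLine.comul_β, map_sum,
      map_sum]
    refine Finset.sum_congr rfl fun p _ => ?_
    rw [TensorProduct.map_tmul, TensorProduct.map_tmul, eval_of, eval_of, termValue, termValue]
    rfl
  | @add n s t hs ht =>
    rw [termValue, termComul, map_map_eval y _ (K.add n) (fun _ _ => eval_add y _ _), ← hs, ← ht]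
    exact LinearMap.congr_fun (K.add_isHom n).comul_map (termValue y s ⊗ₜ termValue y t)
  | @mul i j k h s t hs ht =>
    rw [termValue, termComul, map_map_eval y _ (K.mul i j k h) (fun _ _ => eval_mul y h _ _),
      ← hs, ← ht]
    exact LinearMap.congr_fun (K.mul_isHom i j k h).comul_map (termValue y s ⊗ₜ termValue y t)

lemma counit_comp_eval (n : ℤ) : counit (R := 𝕜) ∘ₗ eval y n = counit (R := 𝕜) :=
  hom_ext fun t => by rw [LinearMap.comp_apply, eval_of, counit_termValue, counit_of]

lemma map_eval_comp_comul (n : ℤ) : TensorProduct.map (eval y n) (eval y n) ∘ₗ comul (R := 𝕜) =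
    comul (R := 𝕜) ∘ₗ eval y n :=
  hom_ext fun t => by
    rw [LinearMap.comp_apply, LinearMap.comp_apply, eval_of, comul_termValue, comul_of]

/-- Each relation evaluates to an axiom of the Hopf ring `K` or of the additive curve `y`. -/
lemma Rel.eval_eq_zero {n : ℤ} {z : FreeModule 𝕜 𝒜 n} (h : Rel 𝕜 F hF z) : eval y n z = 0 := by
  induction h with
  | add_assoc s t r => rw [map_sub, eval_add, eval_add, eval_add, eval_add, K.add_assoc, sub_self]
  | @add_comm n s t =>
    have := LinearMap.congr_fun (K.add_comm n) (eval y n (of 𝕜 s) ⊗ₜ eval y n (of 𝕜 t))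
    rw [LinearMap.comp_apply, koszulSwap_tmul _ (oddProj_eval y _)] at this
    rw [map_sub, eval_add, eval_add, this, sub_self]
  | zero_add t =>
    rw [map_sub, eval_add, (isEval_eval y).map_const, K.zero_add, sub_self]
  | mul_assoc h₁ h₂ h₃ h₄ s t r =>
    rw [map_sub, eval_mul, eval_mul, eval_mul, eval_mul, K.mul_assoc _ _ _ _ _ _ h₁ h₂ h₃ h₄,
      sub_self]
  | @mul_comm i j k h h' s t =>
    have := LinearMap.congr_fun (K.mul_comm i j k h h') (eval y i (of 𝕜 s) ⊗ₜ eval y j (of 𝕜 t))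
    rw [LinearMap.comp_apply, koszulSwap_tmul _ (oddProj_eval y _)] at this
    rw [map_sub, eval_mul, eval_mul, this, sub_self]
  | one_mul e he h t =>
    rw [map_sub, eval_mul, (isEval_eval y).map_const, K.one_mul e he, sub_self]
  | zero_mul h t =>
    rw [map_sub, map_smul, eval_mul, (isEval_eval y).map_const, (isEval_eval y).map_const,
      K.zero_mul, ← LinearMap.comp_apply, counit_comp_eval, sub_self]
  | @mul_add i j k h s t r =>
    have h₁ := LinearMap.congr_fun (K.mul_add i j k h)
      (eval y i (of 𝕜 s) ⊗ₜ (eval y j (of 𝕜 t) ⊗ₜ eval y j (of 𝕜 r)))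
    have h₂ := map_map_eval y (mul 𝒜 𝕜 h) (K.mul i j k h) (fun _ _ => eval_mul y h _ _)
      (comul (R := 𝕜) (of 𝕜 s)) (of 𝕜 t ⊗ₜ of 𝕜 r)
    have h₃ : ∀ u, eval y k (add 𝒜 𝕜 k u) =
        K.add k (TensorProduct.map (eval y k) (eval y k) u) :=
      LinearMap.congr_fun (f := eval y k ∘ₗ add 𝒜 𝕜 k)
        (g := K.add k ∘ₗ TensorProduct.map (eval y k) (eval y k))
        (TensorProduct.ext' fun _ _ => eval_add y _ _)
    have h₄ := LinearMap.congr_fun (map_eval_comp_comul y i) (of 𝕜 s)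
    rw [LinearMap.comp_apply, LinearMap.comp_apply] at h₄
    rw [h₄] at h₂
    rw [map_sub, eval_mul, eval_add, distribHom_tmul, h₃, h₂, sub_eq_zero]
    exact h₁
  | const_add a b =>
    rw [map_sub, eval_add, (isEval_eval y).map_const, (isEval_eval y).map_const,
      (isEval_eval y).map_const, K.const_add, sub_self]
  | const_mul h a b c hc =>
    rw [map_sub, eval_mul, (isEval_eval y).map_const, (isEval_eval y).map_const,
      (isEval_eval y).map_const, K.const_mul _ _ _ h a b c hc, sub_self]
  | curve_zero =>
    rw [map_sub, (isEval_eval y).map_const, eval_of, termValue, y.map_zero, sub_self]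
  | curve_μ m n N hm hn =>
    have h := LinearMap.congr_fun ((isEval_eval y).comp_formalSum F hF N)
      (AffineLine.β m ⊗ₜ AffineLine.β n)
    rw [eval_comp_curve] at h
    rw [map_sub, sub_eq_zero]
    refine Eq.trans ?_ ((y.map_mu m n N hm hn).trans h.symm)
    exact LinearMap.congr_fun (eval_comp_curve y) _
  | add_right hz t ih => rw [eval_add, ih, TensorProduct.zero_tmul, map_zero]
  | add_left t hz ih => rw [eval_add, ih, TensorProduct.tmul_zero, map_zero]
  | mul_right h hz t ih => rw [eval_mul, ih, TensorProduct.zero_tmul, map_zero]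
  | mul_left h t hz ih => rw [eval_mul, ih, TensorProduct.tmul_zero, map_zero]

lemma ideal_le_ker_eval (n : ℤ) : ideal 𝕜 F hF n ≤ LinearMap.ker (eval y n) :=
  Submodule.span_le.2 fun _ hz => Rel.eval_eq_zero y hz

/-- Evaluation, as a map of coalgebras. -/
def evalCoalgHom (n : ℤ) : Carrier 𝕜 F hF n →ₗc[𝕜] K.obj n where
  __ := (ideal 𝕜 F hF n).liftQ (eval y n) (ideal_le_ker_eval y n)
  counit_comp := Submodule.linearMap_qext _ (counit_comp_eval y n)
  map_comp_comul := Submodule.linearMap_qext _ <| LinearMap.ext fun a => by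
    refine Eq.trans ?_ (LinearMap.congr_fun (map_eval_comp_comul y n) a)
    change TensorProduct.map _ _ (TensorProduct.map (proj 𝕜 F hF n) (proj 𝕜 F hF n)
      (comul (R := 𝕜) a)) = _
    rw [LinearMap.comp_apply]
    generalize comul (R := 𝕜) a = u
    induction u with
    | zero => simp
    | add u v hu hv => simp only [map_add, hu, hv]
    | tmul u v => rfl

/-- Evaluation, as a map of Hopf rings. -/
def evalHom : HopfRing.Hom (ravenelWilson 𝕜 F hF) K where
  app n :=
    { map := evalCoalgHom y n
      map_deg := fun i a ha => by
        have h : degPart 𝕜 F hF n i ≤ ((K.obj n).deg i).comap (evalCoalgHom y n).toLinearMap := by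
          refine Submodule.span_le.2 ?_
          rintro _ ⟨t, rfl, rfl⟩
          change eval y n (of 𝕜 t) ∈ (K.obj n).deg (2 * t.weight)
          rw [eval_of]
          exact termValue_mem y t
        exact h ha }
  map_add n a b := by
    obtain ⟨a, rfl⟩ := proj_surjective n a
    obtain ⟨b, rfl⟩ := proj_surjective n b
    exact eval_add y a b
  map_mul i j k h a b := by
    obtain ⟨a, rfl⟩ := proj_surjective i a
    obtain ⟨b, rfl⟩ := proj_surjective j b
    exact eval_mul y h a b
  map_const := (isEval_eval y).map_const

/-- Uniqueness in the universal property: constants, curve and operations force the value on every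
term. -/
lemma hom_apply_proj (f : HopfRing.Hom (ravenelWilson 𝕜 F hF) K)
    (hf : ∀ c, (f.app 1).map ((tautologicalCurve 𝕜 F hF).map c) = y.map c) {n : ℤ}
    (t : Term 𝒜 n) : (f.app n).map (proj 𝕜 F hF n (of 𝕜 t)) = termValue y t := by
  induction t with
  | const n a =>
    rw [termValue]
    exact f.map_const n a
  | curve i =>
    rw [termValue, ← hf]
    refine congrArg (f.app 1).map ?_
    exact congrArg (proj 𝕜 F hF 1) (curve_β i).symm
  | @add n s t hs ht =>
    rw [termValue, ← hs, ← ht, ← add_of]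
    exact f.map_add n (proj 𝕜 F hF n (of 𝕜 s)) (proj 𝕜 F hF n (of 𝕜 t))
  | @mul i j k h s t hs ht =>
    rw [termValue, ← hs, ← ht, ← mul_of]
    exact f.map_mul i j k h (proj 𝕜 F hF i (of 𝕜 s)) (proj 𝕜 F hF j (of 𝕜 t))

omit [SetLike.GradedOne 𝒜] in
lemma hopfRingHom_ext {H K : HopfRing 𝕜 𝒜} {f g : HopfRing.Hom H K}
    (h : ∀ n x, (f.app n).map x = (g.app n).map x) : f = g := by
  obtain ⟨f, _, _, _⟩ := f
  obtain ⟨g, _, _, _⟩ := g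
  obtain rfl : f = g := by
    funext n
    have h' := h n
    dsimp only at h'
    generalize f n = a at h'
    generalize g n = b at h'
    obtain ⟨a, _⟩ := a
    obtain ⟨b, _⟩ := b
    obtain rfl : a = b := CoalgHom.ext h'
    rfl
  rfl

variable (𝕜 F hF) in
theorem isRavenelWilson_ravenelWilson :
    HopfRing.IsRavenelWilson F hF (ravenelWilson 𝕜 F hF) (tautologicalCurve 𝕜 F hF) := by
  intro K y
  refine ⟨evalHom y, fun c => LinearMap.congr_fun (eval_comp_curve y) c, fun f hf => ?_⟩
  refine hopfRingHom_ext fun n x => ?_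
  have h : (f.app n).map.toLinearMap = (evalCoalgHom y n).toLinearMap := carrier_ext fun t =>
    (hom_apply_proj y f hf t).trans (eval_of y t).symm
  exact LinearMap.congr_fun h x

end FormalHopf

/-! ### The Verschiebung of the Ravenel-Wilson Hopf ring -/

section IsVerschiebung

open TensorProduct Coalgebra

variable {𝕜 : Type*} [CommRing 𝕜] {A B : Type*} [AddCommGroup A] [AddCommGroup B]
  [Module 𝕜 A] [Module 𝕜 B] [CoalgebraStruct 𝕜 A] [CoalgebraStruct 𝕜 B]

variable (𝕜) in
/-- The coproduct of `x` is `x' ⊗ x'`, modulo symmetrised tensors and modulo 2. -/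
def IsVerschiebung (x x' : A) : Prop :=
  ∃ w u : A ⊗[𝕜] A, comul (R := 𝕜) x =
    x' ⊗ₜ x' + (w + TensorProduct.comm 𝕜 A A w) + (2 : 𝕜) • u

lemma IsVerschiebung.of_comul_eq {x : A} (h : comul (R := 𝕜) x = x ⊗ₜ x) :
    IsVerschiebung 𝕜 x x :=
  ⟨0, 0, by simp [h]⟩

/-- Symmetrised tensors behave like an ideal among symmetric ones: a symmetric tensor times a
symmetrised one is symmetrised. So only the product of the two diagonal parts survives. -/
lemma IsVerschiebung.tmul {x x' : A} {y y' : B} (hx : IsVerschiebung 𝕜 x x')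
    (hy : IsVerschiebung 𝕜 y y') : IsVerschiebung 𝕜 (x ⊗ₜ[𝕜] y) (x' ⊗ₜ[𝕜] y') := by
  obtain ⟨w, u, hx⟩ := hx
  obtain ⟨w', u', hy⟩ := hy
  let T : A ⊗[𝕜] A →ₗ[𝕜] B ⊗[𝕜] B →ₗ[𝕜] (A ⊗[𝕜] B) ⊗[𝕜] (A ⊗[𝕜] B) :=
    (TensorProduct.mk 𝕜 _ _).compr₂ (tensorTensorTensorComm 𝕜 A A B B).toLinearMap
  have hT : ∀ (a : A ⊗[𝕜] A) (b : B ⊗[𝕜] B), TensorProduct.comm 𝕜 _ _ (T a b) =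
      T (TensorProduct.comm 𝕜 _ _ a) (TensorProduct.comm 𝕜 _ _ b) := by
    intro a b
    induction a with
    | zero => simp
    | add a₁ a₂ h₁ h₂ => simp only [LinearMap.add_apply, map_add, h₁, h₂]
    | tmul a a' =>
      induction b with
      | zero => simp
      | add b₁ b₂ h₁ h₂ => simp only [map_add, h₁, h₂]
      | tmul b b' => rfl
  have hd : T (x' ⊗ₜ x') (y' ⊗ₜ y') = (x' ⊗ₜ y') ⊗ₜ (x' ⊗ₜ y') := rfl
  have hxy : comul (R := 𝕜) (x ⊗ₜ[𝕜] y) = T (comul (R := 𝕜) x) (comul (R := 𝕜) y) := rfl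
  -- The product `(w + τ w)(w' + τ w')` is the symmetrisation of `w w' + w (τ w')`; the other two
  -- terms are a diagonal times `w` or `w'`.
  refine ⟨T (x' ⊗ₜ x') w' + T w (y' ⊗ₜ y') + T w w' + T w (TensorProduct.comm 𝕜 _ _ w'),
    T u (comul (R := 𝕜) y) + T (x' ⊗ₜ x' + (w + TensorProduct.comm 𝕜 _ _ w)) u', ?_⟩
  simp only [hxy, map_add, hT, comm_tmul, comm_comm, ← hd]
  rw [hx, hy]
  simp only [map_add, LinearMap.add_apply, map_smul, LinearMap.smul_apply, smul_add]
  abel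

lemma IsVerschiebung.map {x x' : A} (hx : IsVerschiebung 𝕜 x x') (f : A →ₗ[𝕜] B)
    (hf : ∀ a, comul (R := 𝕜) (f a) = TensorProduct.map f f (comul (R := 𝕜) a)) :
    IsVerschiebung 𝕜 (f x) (f x') := by
  obtain ⟨w, u, hx⟩ := hx
  refine ⟨TensorProduct.map f f w, TensorProduct.map f f u, ?_⟩
  have h : TensorProduct.comm 𝕜 _ _ (TensorProduct.map f f w) =
      TensorProduct.map f f (TensorProduct.comm 𝕜 _ _ w) := by
    clear hx
    induction w with
    | zero => simp
    | add a b ha hb => simp only [map_add, ha, hb]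
    | tmul a b => rfl
  rw [hf, hx, h]
  simp only [map_add, map_smul, map_tmul]

/-- The off-diagonal terms of the coproduct come in pairs exchanged by the symmetry. What remains is
`βᵢ ⊗ βᵢ` for `n = 2i` and nothing for odd `n`. -/
lemma AffineLine.exists_comul_β (n : ℕ) : ∃ w : AffineLine 𝕜 ⊗[𝕜] AffineLine 𝕜,
    comul (R := 𝕜) (β (𝕜 := 𝕜) n) =
      ∑ p ∈ Finset.HasAntidiagonal.antidiagonal n with p.1 = p.2, β p.1 ⊗ₜ[𝕜] β p.2 +
        (w + TensorProduct.comm 𝕜 _ _ w) := by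
  refine ⟨∑ p ∈ Finset.HasAntidiagonal.antidiagonal n with p.1 < p.2, β p.1 ⊗ₜ[𝕜] β p.2, ?_⟩
  have h : ∑ p ∈ Finset.HasAntidiagonal.antidiagonal n with p.1 < p.2,
      β (𝕜 := 𝕜) p.2 ⊗ₜ[𝕜] β (𝕜 := 𝕜) p.1 =
      ∑ p ∈ Finset.HasAntidiagonal.antidiagonal n with p.2 < p.1,
        β (𝕜 := 𝕜) p.1 ⊗ₜ[𝕜] β p.2 := by
    refine Finset.sum_nbij' Prod.swap Prod.swap ?_ ?_ ?_ ?_ ?_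
    · simp [_root_.add_comm]
    · simp [_root_.add_comm]
    · simp
    · simp
    · simp
  rw [map_sum]
  simp only [comm_tmul]
  rw [h, comul_β, Finset.sum_filter, Finset.sum_filter, Finset.sum_filter,
    ← Finset.sum_add_distrib, ← Finset.sum_add_distrib]
  refine Finset.sum_congr rfl fun p _ => ?_
  rcases lt_trichotomy p.1 p.2 with h | h | h
  · simp [h, h.ne, h.not_gt]
  · simp [h]
  · simp [h, h.ne', h.not_gt]

lemma AffineLine.isVerschiebung_β_double (i : ℕ) :
    IsVerschiebung 𝕜 (β (𝕜 := 𝕜) (2 * i)) (β i) := by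
  obtain ⟨w, hw⟩ := exists_comul_β (𝕜 := 𝕜) (2 * i)
  refine ⟨w, 0, ?_⟩
  have h : (Finset.HasAntidiagonal.antidiagonal (2 * i)).filter (fun p => p.1 = p.2) =
      {(i, i)} := by
    ext ⟨a, b⟩
    simp only [Finset.mem_filter, Finset.HasAntidiagonal.mem_antidiagonal, Finset.mem_singleton,
      Prod.mk.injEq]
    omega
  rw [hw, h, Finset.sum_singleton, smul_zero, add_zero]

lemma AffineLine.isVerschiebung_β_odd (i : ℕ) :
    IsVerschiebung 𝕜 (β (𝕜 := 𝕜) (2 * i + 1)) 0 := by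
  obtain ⟨w, hw⟩ := exists_comul_β (𝕜 := 𝕜) (2 * i + 1)
  refine ⟨w, 0, ?_⟩
  have h : (Finset.HasAntidiagonal.antidiagonal (2 * i + 1)).filter (fun p => p.1 = p.2) = ∅ := by
    ext ⟨a, b⟩
    simp only [Finset.mem_filter, Finset.HasAntidiagonal.mem_antidiagonal, Finset.notMem_empty,
      iff_false]
    omega
  rw [hw, h, Finset.sum_empty, smul_zero, add_zero, tmul_zero]

end IsVerschiebung

lemma verschiebung_eq {V : Type*} [AddCommGroup V] [Module (ZMod 2) V] [Coalgebra (ZMod 2) V]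
    [Coalgebra.IsCocomm (ZMod 2) V] {x x' : V} (w : V ⊗[ZMod 2] V)
    (h : Coalgebra.comul (R := ZMod 2) x =
      x' ⊗ₜ x' + (w + TensorProduct.comm (ZMod 2) V V w)) :
    verschiebung V x = x' := by
  refine (tateEquiv V).symm_apply_eq.2 ?_
  refine (Submodule.Quotient.eq _).2 ?_
  refine ⟨w, ?_⟩
  change w + TensorProduct.comm (ZMod 2) V V w =
    Coalgebra.comul (R := ZMod 2) x - x' ⊗ₜ x'
  rw [h, add_sub_cancel_left]

/-- Reduction modulo 2 kills the even term, and the symmetrised term vanishes in Tate cohomology. -/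
lemma IsVerschiebung.verschiebung_tmul {𝕜 : Type*} [CommRing 𝕜] [Algebra 𝕜 (ZMod 2)]
    {C : GradedCoalg.{u} 𝕜} {x x' : C} (h : IsVerschiebung 𝕜 x x') :
    verschiebung C.Mod2 (1 ⊗ₜ x) = 1 ⊗ₜ x' := by
  obtain ⟨w, v, h⟩ := h
  -- The reduction `a ⊗ b ↦ (1 ⊗ a) ⊗ (1 ⊗ b)`, through which the base-changed coproduct is defined.
  let Ψ : C ⊗[𝕜] C →ₗ[𝕜] C.Mod2 ⊗[ZMod 2] C.Mod2 :=
    (TensorProduct.AlgebraTensorModule.tensorTensorTensorComm 𝕜 (ZMod 2) 𝕜 (ZMod 2)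
      (ZMod 2) (ZMod 2) C C).toLinearMap.restrictScalars 𝕜 ∘ₗ
      TensorProduct.mk 𝕜 (ZMod 2 ⊗[ZMod 2] ZMod 2) (C ⊗[𝕜] C) (1 ⊗ₜ 1)
  have hcomul : Coalgebra.comul (R := ZMod 2) ((1 : ZMod 2) ⊗ₜ[𝕜] x) =
      Ψ (Coalgebra.comul (R := 𝕜) x) := rfl
  have hcomm : TensorProduct.comm (ZMod 2) C.Mod2 C.Mod2 (Ψ w) =
      Ψ (TensorProduct.comm 𝕜 C C w) := by
    clear h
    induction w with
    | zero => simp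
    | tmul a b => rfl
    | add a b ha hb => simp only [map_add, ha, hb]
  have hv : Ψ v + Ψ v = 0 := two_eq_zero' (M := C.Mod2 ⊗[ZMod 2] C.Mod2) _
  refine verschiebung_eq (Ψ w) ?_
  rw [hcomul, h, map_add, map_add, map_add, map_smul, two_smul, hv, add_zero, hcomm]
  rfl

namespace HopfRing

variable {R : Type u} [CommRing R] {𝒜 : ℤ → AddSubgroup R} {𝕜 : Type*} [CommRing 𝕜]

/-- The identity map of a Hopf ring. -/
def Hom.id (H : HopfRing 𝕜 𝒜) : Hom H H where
  app n := { map := CoalgHom.id 𝕜 (H.obj n), map_deg := fun _ _ hx => hx }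
  map_add _ _ _ := rfl
  map_mul _ _ _ _ _ _ := rfl
  map_const _ _ := rfl

/-- The composition of maps of Hopf rings. -/
def Hom.comp {H K L : HopfRing 𝕜 𝒜} (g : Hom K L) (f : Hom H K) : Hom H L where
  app n :=
    { map := (g.app n).map.comp (f.app n).map
      map_deg := fun i x hx => (g.app n).map_deg i _ ((f.app n).map_deg i x hx) }
  map_add n x y := (congrArg _ (f.map_add n x y)).trans (g.map_add n _ _)
  map_mul i j k h x y := (congrArg _ (f.map_mul i j k h x y)).trans (g.map_mul i j k h _ _)
  map_const n a := (congrArg _ (f.map_const n a)).trans (g.map_const n a)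

end HopfRing

/-! ### Verschiebung of terms and of a universal Hopf ring -/

namespace FormalHopf

open FreeModule Coalgebra

variable {R : Type u} [CommRing R] {𝒜 : ℤ → AddSubgroup R} {𝕜 : Type} [CommRing 𝕜]

/-- Doubling the indices of all occurrences of the curve. -/
def Term.double : {n : ℤ} → Term 𝒜 n → Term 𝒜 n
  | _, .const n a => .const n a
  | _, .curve i => .curve (2 * i)
  | _, .add s t => .add s.double t.double
  | _, .mul h s t => .mul h s.double t.double

lemma Term.weight_double {n : ℤ} (t : Term 𝒜 n) : t.double.weight = 2 * t.weight := by
  induction t with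
  | const n a => rfl
  | curve i => rfl
  | add s t hs ht => simp only [Term.double, Term.weight, hs, ht, _root_.mul_add]
  | mul h s t hs ht => simp only [Term.double, Term.weight, hs, ht, _root_.mul_add]

lemma isVerschiebung_add {n : ℤ} {a a' b b' : FreeModule 𝕜 𝒜 n} (ha : IsVerschiebung 𝕜 a a')
    (hb : IsVerschiebung 𝕜 b b') :
    IsVerschiebung 𝕜 (add 𝒜 𝕜 n (a ⊗ₜ b)) (add 𝒜 𝕜 n (a' ⊗ₜ b')) :=
  (ha.tmul hb).map _ comul_add

lemma isVerschiebung_mul {i j k : ℤ} (h : i + j = k) {a a' : FreeModule 𝕜 𝒜 i}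
    {b b' : FreeModule 𝕜 𝒜 j} (ha : IsVerschiebung 𝕜 a a') (hb : IsVerschiebung 𝕜 b b') :
    IsVerschiebung 𝕜 (mul 𝒜 𝕜 h (a ⊗ₜ b)) (mul 𝒜 𝕜 h (a' ⊗ₜ b')) :=
  (ha.tmul hb).map _ (comul_mul h)

lemma isVerschiebung_curve {i : ℕ} {c : AffineLine 𝕜}
    (h : IsVerschiebung 𝕜 (AffineLine.β (𝕜 := 𝕜) i) c) :
    IsVerschiebung 𝕜 (of 𝕜 (Term.curve (𝒜 := 𝒜) i)) (curve 𝒜 𝕜 c) := by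
  rw [← curve_β]
  exact h.map _ comul_curve

/-- The source of surjectivity: doubling curve indices gives an explicit preimage of every term,
since `β₂ᵢ` goes to `βᵢ` and the Verschiebung respects both operations. -/
lemma isVerschiebung_double {n : ℤ} (t : Term 𝒜 n) :
    IsVerschiebung 𝕜 (of 𝕜 t.double) (of 𝕜 t) := by
  induction t with
  | const n a => exact .of_comul_eq (comul_of _)
  | curve i =>
    have h := isVerschiebung_curve (𝒜 := 𝒜) (AffineLine.isVerschiebung_β_double (𝕜 := 𝕜) i)
    rwa [curve_β] at h
  | add s t hs ht =>
    have h := isVerschiebung_add hs ht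
    rwa [add_of, add_of] at h
  | mul e s t hs ht =>
    have h := isVerschiebung_mul e hs ht
    rwa [mul_of, mul_of] at h

variable (𝕜) in
-- One odd curve index anywhere in the term gives zero; otherwise all indices are halved. This
-- controls the degree of the image.
lemma exists_isVerschiebung {n : ℤ} (t : Term 𝒜 n) : IsVerschiebung 𝕜 (of 𝕜 t) 0 ∨
    ∃ s : Term 𝒜 n, 2 * s.weight = t.weight ∧ IsVerschiebung 𝕜 (of 𝕜 t) (of 𝕜 s) := by
  induction t with
  | const n a => exact .inr ⟨.const n a, rfl, .of_comul_eq (comul_of _)⟩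
  | curve i =>
    obtain ⟨i, rfl | rfl⟩ := i.even_or_odd'
    · exact .inr ⟨.curve i, rfl, isVerschiebung_double (Term.curve i)⟩
    · have h := isVerschiebung_curve (𝒜 := 𝒜) (AffineLine.isVerschiebung_β_odd (𝕜 := 𝕜) i)
      rw [map_zero] at h
      exact .inl h
  | add s t hs ht =>
    rw [← add_of]
    rcases hs with hs | ⟨s', hs', hs⟩ <;> rcases ht with ht | ⟨t', ht', ht⟩
    · exact .inl (by simpa using isVerschiebung_add hs ht)
    · exact .inl (by simpa using isVerschiebung_add hs ht)
    · exact .inl (by simpa using isVerschiebung_add hs ht)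
    · refine .inr ⟨s'.add t', ?_, by simpa using isVerschiebung_add hs ht⟩
      rw [Term.weight, Term.weight, _root_.mul_add, hs', ht']
  | mul e s t hs ht =>
    rw [← mul_of]
    rcases hs with hs | ⟨s', hs', hs⟩ <;> rcases ht with ht | ⟨t', ht', ht⟩
    · exact .inl (by simpa using isVerschiebung_mul e hs ht)
    · exact .inl (by simpa using isVerschiebung_mul e hs ht)
    · exact .inl (by simpa using isVerschiebung_mul e hs ht)
    · refine .inr ⟨.mul e s' t', ?_, by simpa using isVerschiebung_mul e hs ht⟩
      rw [Term.weight, Term.weight, _root_.mul_add, hs', ht']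

variable [SetLike.GradedOne 𝒜] {F : FormalGroup R} {hF : F.IsGraded 𝒜}
  {H : HopfRing 𝕜 𝒜} {x : H.AdditiveCurve F hF}

lemma _root_.IsVerschiebung.eval {n : ℤ} {a a' : FreeModule 𝕜 𝒜 n} (h : IsVerschiebung 𝕜 a a') :
    IsVerschiebung 𝕜 (eval x n a) (eval x n a') :=
  h.map _ fun b => (LinearMap.congr_fun (map_eval_comp_comul x n) b).symm

/-- The terms span every graded piece of a Ravenel-Wilson Hopf ring. -/
lemma deg_eq_span (hx : HopfRing.IsRavenelWilson F hF H x) (n d : ℤ) :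
    (H.obj n).deg d =
      Submodule.span 𝕜 (termValue x '' {t : Term 𝒜 n | 2 * (t.weight : ℤ) = d}) := by
  refine le_antisymm (fun z hz => ?_) (Submodule.span_le.2 ?_)
  · obtain ⟨f, hf, -⟩ := hx (ravenelWilson 𝕜 F hF) (tautologicalCurve 𝕜 F hF)
    -- Both sides carry `x` to `x`, so uniqueness in the universal property of `H`, applied to `H`
    -- itself, identifies them. Every element is then the image of a combination of terms.
    have h : (evalHom x).comp f = HopfRing.Hom.id H := by
      obtain ⟨g, -, hg⟩ := hx H x
      refine (hg _ fun c => ?_).trans (hg _ fun c => rfl).symm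
      exact (congrArg ((evalHom x).app 1).map (hf c)).trans
        (LinearMap.congr_fun (eval_comp_curve x) c)
    have hz' : ((evalHom x).app n).map ((f.app n).map z) = z :=
      congrArg (fun e : HopfRing.Hom H H => (e.app n).map z) h
    have hle : degPart 𝕜 F hF n d ≤ (Submodule.span 𝕜
        (termValue x '' {t : Term 𝒜 n | 2 * (t.weight : ℤ) = d})).comap
          (evalCoalgHom x n).toLinearMap := by
      refine Submodule.span_le.2 ?_
      rintro _ ⟨t, ht, rfl⟩
      exact Submodule.subset_span ⟨t, ht, (eval_of x t).symm⟩
    rw [← hz']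
    exact hle ((f.app n).map_deg d z hz)
  · rintro _ ⟨t, rfl, rfl⟩
    exact termValue_mem x t

/-- A term of weight `w` has degree `2w`, so it lies in degree `k w` of `Φᵏ`. Indexing by terms
treats `k = 0`, where many `j` contribute, and negative `k` uniformly. -/
lemma phiDeg_eq_span [Algebra 𝕜 (ZMod 2)] (hx : HopfRing.IsRavenelWilson F hF H x) (n k m : ℤ) :
    (H.obj n).phiDeg k m = Submodule.span (ZMod 2)
      ((fun t : Term 𝒜 n => (1 : ZMod 2) ⊗ₜ[𝕜] termValue x t) ''
        {t | k * (t.weight : ℤ) = m}) := by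
  refine le_antisymm (iSup₂_le fun j hj => ?_) (Submodule.span_le.2 ?_)
  · rw [deg_eq_span hx, Submodule.baseChange_span]
    refine Submodule.span_mono ?_
    rintro _ ⟨_, ⟨t, ht, rfl⟩, rfl⟩
    refine ⟨t, ?_, rfl⟩
    have ht' : (t.weight : ℤ) = j := mul_left_cancel₀ two_ne_zero ht
    rwa [Set.mem_ofPred_eq, ht']
  · rintro _ ⟨t, ht, rfl⟩
    refine Submodule.mem_iSup_of_mem (t.weight : ℤ) (Submodule.mem_iSup_of_mem ht ?_)
    exact Submodule.tmul_mem_baseChange_of_mem 1 (termValue_mem x t)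

/-- Halving the weight while doubling `k` preserves `k w = m`. Spanning terms are sent to spanning
terms or to zero, and each spanning term of the target is hit by its double. -/
theorem map_verschiebung_phiDeg [Algebra 𝕜 (ZMod 2)] (hx : HopfRing.IsRavenelWilson F hF H x)
    (n k m : ℤ) : ((H.obj n).phiDeg k m).map (verschiebung (H.obj n).Mod2) =
      (H.obj n).phiDeg (2 * k) m := by
  rw [phiDeg_eq_span hx, phiDeg_eq_span hx, Submodule.map_span]
  refine le_antisymm (Submodule.span_le.2 ?_) (Submodule.span_mono ?_)
  · rintro _ ⟨_, ⟨t, ht, rfl⟩, rfl⟩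
    rcases exists_isVerschiebung 𝕜 t with h | ⟨s, hs, h⟩
    · have h' := (h.eval (x := x)).verschiebung_tmul
      rw [eval_of, map_zero, TensorProduct.tmul_zero] at h'
      rw [SetLike.mem_coe, h']
      exact zero_mem _
    · have h' := (h.eval (x := x)).verschiebung_tmul
      rw [eval_of, eval_of] at h'
      rw [SetLike.mem_coe, h']
      refine Submodule.subset_span ⟨s, ?_, rfl⟩
      rw [Set.mem_ofPred_eq, ← ht, ← hs]
      push_cast
      ring
  · rintro _ ⟨t, ht, rfl⟩
    refine ⟨_, ⟨t.double, ?_, rfl⟩, ?_⟩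
    · rw [Set.mem_ofPred_eq, ← ht, Term.weight_double]
      push_cast
      ring
    · have h := ((isVerschiebung_double (𝕜 := 𝕜) t).eval (x := x)).verschiebung_tmul
      rwa [eval_of, eval_of] at h

end FormalHopf

end

theorem proposition10 {R : Type u} [CommRing R] (𝒜 : ℤ → AddSubgroup R) [GradedRing 𝒜]
    (F : FormalGroup R) [F.IsComm] (hF : F.IsGraded 𝒜) :
    (∃ (H : HopfRing ℤ 𝒜) (x : H.AdditiveCurve F hF), HopfRing.IsRavenelWilson F hF H x) ∧
      ∀ (H : HopfRing ℤ 𝒜) (x : H.AdditiveCurve F hF), HopfRing.IsRavenelWilson F hF H x →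
        ∀ k n m : ℤ,
          ((H.obj n).phiDeg k m).map (verschiebung (H.obj n).Mod2) = (H.obj n).phiDeg (2 * k) m :=
  ⟨⟨FormalHopf.ravenelWilson ℤ F hF, FormalHopf.tautologicalCurve ℤ F hF,
    FormalHopf.isRavenelWilson_ravenelWilson ℤ F hF⟩,
    fun _ _ hx k n m => FormalHopf.map_verschiebung_phiDeg hx n k m⟩
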